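/- Let $M$ be either a smooth variety over an algebraically closed field of characteristic zero, or a complex analytic manifold, of dimension $n+1$. Let $X\subset M$ be a reduced hypersurface (so $\dim X=n$) whose singular locus $Z=\mathrm{Sing}(X)$, taken with its reduced structure, is a smooth compact (in the algebraic case: complete) connected curve. For a point $o\in X$ let $\mathrm{mult}(X,o)$ be the multiplicity of $X$ at $o$, i.e. the order at $o$ of a local equation of $X$. Assume that * the generic multiplicity of $X$ along $Z$ is $p$, i.e. $\mathrm{mult}(X,o)=p$ for all but finitely many points $o\in Z$; * the generic transversal type of $X$ along $Z$ is ordinary, i.e. for all but finitely many points $o\in Z$ the multiplicity of $X$ along $Z$ is locally constant near $o$, and for some germ $(L^\perp,o)\subset (M,o)$ of a smooth $n$-dimensional subspace transversal to $Z$ the hypersurface germ $(L^\perp\cap X,o)\subset(L^\perp,o)$ is an ordinary multiple point: its projectivized tangent cone $\{f_q=0\}\subset\mathbb P^{n-1}$, where $f_q$ is the leading form of a local equation, is smooth. Let $[X]$ denote the line bundle $\mathcal O_M(X)|_Z$, let $\mathcal N_{Z/M}$ be the normal bundle of $Z$ in $M$, and let $\deg$ be the degree of line bundles on $Z$ (the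 degree of the divisor of any nonzero rational, resp. meromorphic, section). If $o_1,\dots,o_s\in Z$ are distinct points with $\mathrm{mult}(X,o_i)=p+p_i$, $p_i\ge 0$, then $$\sum_{i=1}^s p_i\;\le\;\deg [X]-\frac{p}{n}\,\deg\bigl(\det \mathcal N_{Z/M}\bigr).$$ -/

import Mathlib

open CategoryTheory AlgebraicGeometry TopologicalSpace Opposite
open scoped Manifold ContDiff

universe u

namespace CurveSing

noncomputable section

/-! Everything below is formulated on a locally ringed space `M`, so that it applies verbatim to
schemes and to complex manifolds (with the sheaf of holomorphic functions). Subspaces are subsets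
with their reduced structure; "points" of the geometry are the closed points of `M`. -/

/-- The local ring `𝒪_{M,x}`. -/
abbrev Loc (M : LocallyRingedSpace.{u}) (x : M) : Type u := M.presheaf.stalk x

/-- The maximal ideal of `𝒪_{M,x}`. -/
abbrev maxI (M : LocallyRingedSpace.{u}) (x : M) : Ideal (Loc M x) :=
  IsLocalRing.maximalIdeal (Loc M x)

/-- Regular (holomorphic) functions on the open set `U`. -/
abbrev Sec (M : LocallyRingedSpace.{u}) (U : Opens M) : Type u := M.presheaf.obj (op U)

/-- The germ at `x ∈ U` of a function on `U`. -/
abbrev germAt {M : LocallyRingedSpace.{u}} {U : Opens M} (s : Sec M U) (x : M) (hx : x ∈ U) :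
    Loc M x :=
  (M.presheaf.germ U x hx).hom s

/-- The stalk at `x` of the ideal sheaf of the reduced subspace on the set `S`: the germs of
functions that vanish (lie in the maximal ideal) at all points of `S` near `x`. -/
def idealAt (M : LocallyRingedSpace.{u}) (S : Set M) (x : M) : Ideal (Loc M x) where
  carrier := {g | ∃ (U : Opens M) (hx : x ∈ U) (s : Sec M U), germAt s x hx = g ∧
    ∀ (w : M) (hw : w ∈ U), w ∈ S → germAt s w hw ∈ maxI M w}
  zero_mem' := ⟨⊤, trivial, 0, map_zero _, fun w hw _ => by
    have : germAt (0 : Sec M ⊤) w hw = 0 := map_zero _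
    rw [this]; exact zero_mem _⟩
  add_mem' := by
    rintro _ _ ⟨U, hU, s, rfl, hs⟩ ⟨V, hV, t, rfl, ht⟩
    let s' : Sec M (U ⊓ V) := (M.presheaf.map (homOfLE inf_le_left).op).hom s
    let t' : Sec M (U ⊓ V) := (M.presheaf.map (homOfLE inf_le_right).op).hom t
    have es : ∀ (w : M) (h : w ∈ U ⊓ V), germAt s' w h = germAt s w h.1 := fun w h =>
      M.presheaf.germ_res_apply (homOfLE inf_le_left) w h s
    have et : ∀ (w : M) (h : w ∈ U ⊓ V), germAt t' w h = germAt t w h.2 := fun w h =>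
      M.presheaf.germ_res_apply (homOfLE inf_le_right) w h t
    have e : ∀ (w : M) (h : w ∈ U ⊓ V),
        germAt (s' + t') w h = germAt s w h.1 + germAt t w h.2 := fun w h => by
      rw [← es w h, ← et w h]; exact map_add _ _ _
    exact ⟨U ⊓ V, ⟨hU, hV⟩, s' + t', e x _, fun w hw hS => by
      rw [e w hw]; exact add_mem (hs w _ hS) (ht w _ hS)⟩
  smul_mem' := by
    rintro c _ ⟨U, hU, s, rfl, hs⟩
    obtain ⟨V, hV, t, rfl⟩ := M.presheaf.exists_germ_eq c
    let s' : Sec M (U ⊓ V) := (M.presheaf.map (homOfLE inf_le_left).op).hom s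
    let t' : Sec M (U ⊓ V) := (M.presheaf.map (homOfLE inf_le_right).op).hom t
    have es : ∀ (w : M) (h : w ∈ U ⊓ V), germAt s' w h = germAt s w h.1 := fun w h =>
      M.presheaf.germ_res_apply (homOfLE inf_le_left) w h s
    have et : ∀ (w : M) (h : w ∈ U ⊓ V), germAt t' w h = germAt t w h.2 := fun w h =>
      M.presheaf.germ_res_apply (homOfLE inf_le_right) w h t
    have e : ∀ (w : M) (h : w ∈ U ⊓ V),
        germAt (t' * s') w h = germAt t w h.2 * germAt s w h.1 := fun w h => by
      rw [← es w h, ← et w h]; exact map_mul _ _ _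
    exact ⟨U ⊓ V, ⟨hU, hV⟩, t' * s', e x _, fun w hw hS => by
      rw [e w hw]; exact Ideal.mul_mem_left _ _ (hs w _ hS)⟩

/-- `f` is an equation of `X` on `U`: it generates the ideal of `X` at every point of `U`. -/
def IsEquation (M : LocallyRingedSpace.{u}) (X : Set M) (U : Opens M) (f : Sec M U) : Prop :=
  ∀ (w : M) (hw : w ∈ U), idealAt M X w = Ideal.span {germAt f w hw}

/-- `X` is a (reduced) hypersurface: a closed subspace given locally by one nonzero equation. -/
def IsHypersurface (M : LocallyRingedSpace.{u}) (X : Set M) : Prop :=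
  IsClosed X ∧ ∀ x : M, ∃ (U : Opens M) (_ : x ∈ U) (f : Sec M U),
    IsEquation M X U f ∧ ∀ (w : M) (hw : w ∈ U), germAt f w hw ≠ 0

/-- The multiplicity of a hypersurface `X` at `x`: the order at `x` of a local equation of `X`,
i.e. the largest `j` such that the ideal of `X` at `x` lies in `𝔪_x ^ j`. -/
def mult (M : LocallyRingedSpace.{u}) (X : Set M) (x : M) : ℕ∞ :=
  ⨆ (j : ℕ) (_ : idealAt M X x ≤ maxI M x ^ j), (j : ℕ∞)

/-- The singular locus of a hypersurface: the points where the differential of a local equation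
(generating the ideal) vanishes, i.e. where the equation has order at least two. -/
def singularLocus (M : LocallyRingedSpace.{u}) (X : Set M) : Set M :=
  {x | x ∈ X ∧ 2 ≤ mult M X x}

/-- `Z` is a smooth curve: a closed subspace whose local rings at its closed points are
one-dimensional regular local rings. -/
def IsSmoothCurve (M : LocallyRingedSpace.{u}) (Z : Set M) : Prop :=
  IsClosed Z ∧ ∀ z ∈ Z, IsClosed {z} →
    ∃ _ : IsDomain (Loc M z ⧸ idealAt M Z z),
      IsDiscreteValuationRing (Loc M z ⧸ idealAt M Z z)

/-- A homogeneous form `F` over an algebraically closed field defines a smooth hypersurface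
`{F = 0}` in projective space. -/
def IsSmoothForm {κ : Type u} [Field κ] {n : ℕ} (F : MvPolynomial (Fin n) κ) : Prop :=
  F ≠ 0 ∧ ∀ v : Fin n → κ, v ≠ 0 → MvPolynomial.eval v F = 0 →
    ∃ j, MvPolynomial.eval v (MvPolynomial.pderiv j F) ≠ 0

/-- `X` has ordinary transversal type along the curve `Z` at the closed point `x`
(`dim M = n + 1`): the multiplicity of `X` along `Z` is locally constant near `x`, and for some
smooth germ `L = {ℓ = 0}` transversal to `Z` at `x` (that is, `ℓ` restricts to a local coordinate
of `Z`) the germ `L ∩ X` is an ordinary multiple point. The latter means: for a local equation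
`f` of `X` and local coordinates `y₁, …, yₙ` of `L`, one has `f|_L = F(y) +` (order `> q`) with
`F` homogeneous of degree `q`, and the projectivized tangent cone `{F = 0} ⊂ ℙⁿ⁻¹` is smooth.
(Functions on `L` are written as functions on `M` modulo `ℓ`; only the values at `x` of the
coefficients of `F` matter.) -/
def IsOrdinaryAt (M : LocallyRingedSpace.{u}) (n : ℕ) (X Z : Set M) (x : M) : Prop :=
  (∃ V : Opens M, x ∈ V ∧ ∀ w ∈ V, w ∈ Z → mult M X w = mult M X x) ∧
  ∃ (ℓ f : Loc M x) (y : Fin n → Loc M x) (q : ℕ) (F : MvPolynomial (Fin n) (Loc M x)),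
    idealAt M Z x ⊔ Ideal.span {ℓ} = maxI M x ∧
    idealAt M X x = Ideal.span {f} ∧
    Ideal.span (Set.range y) ⊔ Ideal.span {ℓ} = maxI M x ∧
    F.IsHomogeneous q ∧
    f - MvPolynomial.eval y F ∈ maxI M x ^ (q + 1) ⊔ Ideal.span {ℓ} ∧
    IsSmoothForm (MvPolynomial.map (IsLocalRing.residue (Loc M x)) F)

/-- The order of vanishing at `w ∈ Z` of the restriction to `Z` of a germ `g` of a function. -/
def ordOn (M : LocallyRingedSpace.{u}) (Z : Set M) (w : M) (g : Loc M w) : ℕ∞ :=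
  ⨆ (j : ℕ) (_ : g ∈ maxI M w ^ j ⊔ idealAt M Z w), (j : ℕ∞)

/-- Local frames and transition functions of a line bundle on a subspace of `M`:
`Frame U` is a set of frames over `U`, and `Trans e e' w hw hw' u` says that near `w` the
coordinates `c, c'` of a section in the frames `e, e'` are related by `c' = u c`. -/
structure FrameSystem (M : LocallyRingedSpace.{u}) where
  Frame : Opens M → Type u
  Trans : ∀ {U V : Opens M}, Frame U → Frame V → ∀ w : M, w ∈ U → w ∈ V → Loc M w → Prop

/-- The line bundle `𝒪_M(X)|_Z`. A local equation `f` of `X` gives the frame `1 / f`; if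
`f' = u f` then `c (1 / f) = c' (1 / f')` for `c' = u c`. -/
def bundleOfHypersurface (M : LocallyRingedSpace.{u}) (X : Set M) : FrameSystem M where
  Frame U := {f : Sec M U // IsEquation M X U f}
  Trans f f' w hw hw' u := germAt f'.1 w hw' = u * germAt f.1 w hw

/-- The line bundle `det N_{Z/M}` for `Z` of codimension `n`. Equations `x₁, …, xₙ` that generate
the ideal of `Z` give a frame of the conormal bundle `I / I²`, hence the dual frame of
`N = (I / I²)^∨` and a frame of `det N`, the coordinate of `τ` being `(dx₁ ∧ … ∧ dxₙ)(τ)`.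
If `x' = A x` then `dx'₁ ∧ … ∧ dx'ₙ = det A · dx₁ ∧ … ∧ dxₙ` on `N`. -/
def detNormalBundle (M : LocallyRingedSpace.{u}) (n : ℕ) (Z : Set M) : FrameSystem M where
  Frame U := {x : Fin n → Sec M U // ∀ (w : M) (hw : w ∈ U),
    idealAt M Z w = Ideal.span (Set.range fun i => germAt (x i) w hw)}
  Trans x x' w hw hw' u := ∃ A : Matrix (Fin n) (Fin n) (Loc M w),
    (∀ i, germAt (x'.1 i) w hw' = ∑ j, A i j * germAt (x.1 j) w hw) ∧ u = A.det

/-- `D` is the divisor of a nonzero meromorphic (rational) section of the line bundle `L` on the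
compact curve `Z`: near each `z ∈ Z` the section is the fraction `a z / b z` (restricted to `Z`,
neither of the two vanishing identically) in a local frame `e z`, these local expressions agree
on overlaps, and `D` records order of zero minus order of pole at each closed point of `Z`. -/
def IsDivisorOfSection (M : LocallyRingedSpace.{u}) (Z : Set M) (L : FrameSystem M)
    (D : M →₀ ℤ) : Prop :=
  (∀ w, D w ≠ 0 → w ∈ Z ∧ IsClosed {w}) ∧
  ∃ (U : Z → Opens M) (e : ∀ z, L.Frame (U z)) (a b : ∀ z, Sec M (U z)),
    (∀ z : Z, (z : M) ∈ U z) ∧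
    (∀ (z : Z) (w : M) (hw : w ∈ U z), w ∈ Z → IsClosed {w} →
      ∃ i j : ℕ, ordOn M Z w (germAt (a z) w hw) = i ∧ ordOn M Z w (germAt (b z) w hw) = j ∧
        D w = (i : ℤ) - (j : ℤ)) ∧
    (∀ (z z' : Z) (w : M) (hw : w ∈ U z) (hw' : w ∈ U z') (u : Loc M w), w ∈ Z →
      L.Trans (e z) (e z') w hw hw' u →
      germAt (a z') w hw' * germAt (b z) w hw - u * (germAt (a z) w hw * germAt (b z') w hw')
        ∈ idealAt M Z w)

/-- `deg L = d` for a line bundle `L` on the compact curve `Z`: `d` is the degree of the divisor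
of a nonzero meromorphic (rational) section of `L`. -/
def HasDegree (M : LocallyRingedSpace.{u}) (Z : Set M) (L : FrameSystem M) (d : ℤ) : Prop :=
  ∃ D : M →₀ ℤ, IsDivisorOfSection M Z L D ∧ d = D.sum fun _ m => m

/-- The hypotheses on `X` and `Z` inside `M`, where `dim M = n + 1`: `X` is a hypersurface whose
singular locus is the smooth connected curve `Z`, with generic multiplicity `p` and generically
ordinary transversal type along `Z` (generic: at all but finitely many points of the curve). -/
structure IsOrdinaryAlongCurve (M : LocallyRingedSpace.{u}) (n p : ℕ) (X Z : Set M) : Prop where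
  hypersurface : IsHypersurface M X
  eq_singularLocus : Z = singularLocus M X
  smoothCurve : IsSmoothCurve M Z
  connected : IsConnected Z
  generic_mult : {x | x ∈ Z ∧ IsClosed {x} ∧ mult M X x ≠ p}.Finite
  generic_ordinary : {x | x ∈ Z ∧ IsClosed {x} ∧ ¬ IsOrdinaryAt M n X Z x}.Finite

/-- The bound on the jumps of the multiplicity: for all (distinct) points `o` of `Z` at which
`X` has multiplicity `p + r o`, one has `∑ r o ≤ deg [X] - (p / n) deg (det N_{Z/M})`. -/
def JumpBound (M : LocallyRingedSpace.{u}) (n p : ℕ) (X Z : Set M) : Prop :=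
  ∀ dX dN : ℤ, HasDegree M Z (bundleOfHypersurface M X) dX →
    HasDegree M Z (detNormalBundle M n Z) dN →
    ∀ (S : Finset M) (r : M → ℕ),
      (∀ o ∈ S, o ∈ Z ∧ IsClosed {o} ∧ mult M X o = ((p + r o : ℕ) : ℕ∞)) →
      ∑ o ∈ S, (r o : ℚ) ≤ (dX : ℚ) - (p : ℚ) / (n : ℚ) * (dN : ℚ)

end

end CurveSing

/-! Near a closed point of `Z` take a local equation `f` of `X` and equations `x₁, …, xₙ` of `Z`.
Since `X` has multiplicity `p` at almost all points of `Z`, `f` lies in the `p`-th power of the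
ideal of `Z`, so `f = ∑ c_α x^α` over `|α| = p`. Restricted to `Z`, the `c_α` are the coefficients
of a form of degree `p` on the normal spaces with values in `[X]`: replacing `f` by `u f` and `x` by
`A x` changes this leading form by the scalar `u` and the linear substitution `A`.

Let `Δ` be a discriminant of forms of degree `p` in `n` variables. It is homogeneous of degree `D >
0` in the coefficients, is multiplied by `det A ^ E` under a substitution `A`, and satisfies `p D =
n E`. Hence the local functions `Δ(c)` glue to a section of `[X]^D ⊗ (det N)^(-E)` on `Z`. Two facts
about it carry the theorem. At a generic point the transversal type is ordinary, so the leading form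
is smooth and `Δ(c)` does not vanish (`aeval_discriminant_notMem`); in particular the section is
nonzero. At a point of multiplicity `p + r` all `c_α` vanish on `Z` to order at least `r`, so `Δ(c)`
vanishes to order at least `D r` (`IsExpansion.le_ordOn_discriminant`). Comparing the zeros of the
section with its degree gives `D ∑ r ≤ D deg [X] - E deg det N`, and `E / D = p / n`.

The discriminant is constructed by `exists_discriminant`. Among the rational polynomials in the
coefficients consider the ideal of those vanishing on all real forms with a nonzero real critical
point, and take the greatest common divisor of its elements. It is not constant, because for an open
set of values of the other coefficients the coefficient of one pure power can be chosen so that a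
critical point exists. It is a semi-invariant, because the ideal is stable under linear
substitutions and polynomial characters of `GL_n` are powers of the determinant. It does not vanish
at smooth forms, because the Nullstellensatz provides a minor of Macaulay's matrix in the ideal that
is nonzero there.

Coefficients of expansions are controlled by derivations dual to `x₁, …, xₙ`
(`coeff_mem_of_eval_mem`); this is where characteristic zero and smoothness of `M` enter.

Comparing degrees of line bundles amounts to `DegreeZero`: a principal divisor on `Z` has degree
zero. For a complete curve, the zeros of a nonconstant `Φ` and of `Φ⁻¹` are both counted by the
degree of the function field over `k(Φ)`. For a compact Riemann surface, the number of preimages of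
a value near `c` is locally constant in `c`; it counts the zeros at `c = 0` and the poles for large
`c`. -/

namespace CurveSing

noncomputable section

section

/-! ### Forms of a fixed degree and linear substitutions -/

section Forms

open MvPolynomial

/-- The exponents of the monomials of degree `p` in `n` variables. -/
abbrev Expo (n p : ℕ) : Type := ↥((Finset.univ : Finset (Fin n)).finsuppAntidiag p)

variable {n p : ℕ} {S T : Type*} [CommRing S] [CommRing T]

theorem mem_finsuppAntidiag_univ_iff {α : Fin n →₀ ℕ} :
    α ∈ (Finset.univ : Finset (Fin n)).finsuppAntidiag p ↔ α.degree = p := by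
  rw [Finset.mem_finsuppAntidiag, Finsupp.degree_eq_sum]
  simp

theorem Expo.degree_eq (α : Expo n p) : α.1.degree = p :=
  mem_finsuppAntidiag_univ_iff.1 α.2

/-- The form of degree `p` with given coefficients. -/
def formOf (c : Expo n p → S) : MvPolynomial (Fin n) S := ∑ α, monomial α.1 (c α)

/-- The coefficients of the monomials of degree `p`. -/
def coeffsOf (p : ℕ) (F : MvPolynomial (Fin n) S) : Expo n p → S := fun α => F.coeff α.1

theorem isHomogeneous_formOf (c : Expo n p → S) : (formOf c).IsHomogeneous p :=
  IsHomogeneous.sum _ _ _ fun α _ => isHomogeneous_monomial _ α.degree_eq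

@[simp] theorem coeffsOf_formOf (c : Expo n p → S) : coeffsOf p (formOf c) = c := by
  ext α
  simp only [coeffsOf, formOf, coeff_sum, coeff_monomial]
  rw [Finset.sum_eq_single α]
  · simp
  · intro b _ hb
    rw [if_neg]
    exact fun h => hb (Subtype.ext h)
  · simp

theorem formOf_coeffsOf {F : MvPolynomial (Fin n) S} (hF : F.IsHomogeneous p) :
    formOf (coeffsOf p F) = F := by
  ext β
  by_cases h : β.degree = p
  · have := congrFun (coeffsOf_formOf (coeffsOf p F)) ⟨β, mem_finsuppAntidiag_univ_iff.2 h⟩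
    exact this
  · rw [hF.coeff_eq_zero h, (isHomogeneous_formOf _).coeff_eq_zero h]

theorem formOf_add (c d : Expo n p → S) : formOf (c + d) = formOf c + formOf d := by
  simp [formOf, Finset.sum_add_distrib]

theorem map_formOf (f : S →+* T) (c : Expo n p → S) :
    MvPolynomial.map f (formOf c) = formOf (fun α => f (c α)) := by
  simp [formOf, map_sum, map_monomial]

theorem coeffsOf_map (f : S →+* T) (F : MvPolynomial (Fin n) S) :
    coeffsOf p (MvPolynomial.map f F) = fun α => f (coeffsOf p F α) := by
  ext α; simp [coeffsOf, coeff_map]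

/-- The composition of a polynomial with a linear substitution of the variables. -/
def linSub (A : Matrix (Fin n) (Fin n) S) :
    MvPolynomial (Fin n) S →ₐ[S] MvPolynomial (Fin n) S :=
  aeval fun i => ∑ j, C (A i j) * X j

theorem linSub_isHomogeneous (A : Matrix (Fin n) (Fin n) S) {F : MvPolynomial (Fin n) S}
    (hF : F.IsHomogeneous p) : (linSub A F).IsHomogeneous p := by
  have := hF.aeval (fun i => ∑ j, C (A i j) * X j : Fin n → MvPolynomial (Fin n) S) (n := 1)
    fun i => IsHomogeneous.sum _ _ _ fun j _ => isHomogeneous_C_mul_X _ _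
  simpa [linSub] using this

theorem eval_linSub (A : Matrix (Fin n) (Fin n) S) (F : MvPolynomial (Fin n) S) (v : Fin n → S) :
    eval v (linSub A F) = eval (A.mulVec v) F := by
  induction F using MvPolynomial.induction_on with
  | C a => simp [linSub]
  | add f g hf hg => simp [hf, hg]
  | mul_X f i hf => rw [map_mul, map_mul, hf]; simp [linSub, Matrix.mulVec, dotProduct]

theorem linSub_mul (A B : Matrix (Fin n) (Fin n) S) (F : MvPolynomial (Fin n) S) :
    linSub (A * B) F = linSub B (linSub A F) := by
  induction F using MvPolynomial.induction_on with
  | C a => simp [linSub]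
  | add f g hf hg => simp [hf, hg]
  | mul_X f i hf =>
    simp only [map_mul, hf]
    congr 1
    simp only [linSub, aeval_X, map_sum, map_mul, algHom_C, algebraMap_eq, Matrix.mul_apply,
      Finset.sum_mul, Finset.mul_sum]
    rw [Finset.sum_comm]
    exact Finset.sum_congr rfl fun _ _ => Finset.sum_congr rfl fun _ _ => by ring

theorem linSub_one (F : MvPolynomial (Fin n) S) : linSub 1 F = F := by
  have : (fun i => ∑ j, C ((1 : Matrix (Fin n) (Fin n) S) i j) * X j :
      Fin n → MvPolynomial (Fin n) S) = X := by
    funext i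
    rw [Finset.sum_eq_single i] <;> simp +contextual [eq_comm]
  rw [linSub, this, aeval_X_left]; rfl

theorem map_linSub (f : S →+* T) (A : Matrix (Fin n) (Fin n) S) (F : MvPolynomial (Fin n) S) :
    MvPolynomial.map f (linSub A F) = linSub (A.map f) (MvPolynomial.map f F) := by
  induction F using MvPolynomial.induction_on with
  | C a => simp [linSub]
  | add g h hg hh => simp [hg, hh]
  | mul_X g i hg =>
    simp only [map_mul, hg]
    congr 1
    simp [linSub]

theorem pderiv_linSub (A : Matrix (Fin n) (Fin n) S) (F : MvPolynomial (Fin n) S) (j : Fin n) :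
    pderiv j (linSub A F) = ∑ i, C (A i j) * linSub A (pderiv i F) := by
  induction F using MvPolynomial.induction_on with
  | C a => simp [linSub]
  | add f g hf hg => simp [hf, hg, mul_add, Finset.sum_add_distrib]
  | mul_X f i hf =>
    have h1 : pderiv j (linSub A (X i)) = C (A i j) := by
      simp only [linSub, aeval_X, map_sum, Derivation.leibniz, pderiv_C, pderiv_X, smul_eq_mul]
      rw [Finset.sum_eq_single j] <;> simp +contextual [eq_comm]
    have h2 : ∀ k, C (A k j) * linSub A (pderiv k (f * X i)) =
        linSub A (X i) * (C (A k j) * linSub A (pderiv k f)) +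
          if k = i then C (A k j) * linSub A f else 0 := fun k => by
      rw [Derivation.leibniz, smul_eq_mul, smul_eq_mul, map_add, map_mul, map_mul, pderiv_X]
      by_cases h : k = i
      · subst h; simp; ring
      · simp [h, Ne.symm h]; ring
    rw [map_mul, Derivation.leibniz, hf, h1, Finset.sum_congr rfl fun k _ => h2 k,
      Finset.sum_add_distrib, ← Finset.mul_sum]
    simp [smul_eq_mul, mul_comm, add_comm]

theorem eval_pderiv_linSub (A : Matrix (Fin n) (Fin n) S) (F : MvPolynomial (Fin n) S) (j : Fin n)
    (v : Fin n → S) :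
    eval v (pderiv j (linSub A F)) = ∑ i, A i j * eval (A.mulVec v) (pderiv i F) := by
  simp [pderiv_linSub, eval_linSub]

end Forms

/-! ### Common factors of ideals in a polynomial ring in one variable -/

section CommonFactor

open Polynomial

theorem associated_of_unit_mul_eq {B : Type*} [CommMonoid B] {a b x y : B} (ha : IsUnit a)
    (hb : IsUnit b) (h : a * x = b * y) : Associated x y := by
  have h1 : Associated x (a * x) := by
    rw [mul_comm]; exact (associated_mul_unit_right x a ha)
  have h2 : Associated y (b * y) := by
    rw [mul_comm]; exact (associated_mul_unit_right y b hb)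
  rw [h] at h1
  exact h1.trans h2.symm

/-- An ideal of `A[X]` that contains no nonzero constant has a nonconstant common factor. -/
theorem exists_common_factor {A : Type*} [CommRing A] [IsDomain A] [NormalizedGCDMonoid A]
    (J : Ideal A[X]) (hJ : J ≠ ⊥) (h0 : ∀ a : A, C a ∈ J → a = 0) :
    ∃ g : A[X], ¬ IsUnit g ∧ ∀ h ∈ J, g ∣ h := by
  let K := FractionRing A
  let φ : A[X] →+* K[X] := mapRingHom (algebraMap A K)
  have hφ : Function.Injective φ := map_injective _ (IsFractionRing.injective A K)
  obtain ⟨d, hd⟩ := (IsPrincipalIdealRing.principal (J.map φ)).principal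
  have hd' : J.map φ = Ideal.span {d} := hd
  let : Algebra A[X] K[X] := φ.toAlgebra
  have : IsLocalization ((nonZeroDivisors A).map (C : A →+* A[X])) K[X] :=
    Polynomial.isLocalization (nonZeroDivisors A) K
  -- Otherwise `J` would become the unit ideal after inverting the nonzero constants, and clearing
  -- denominators would give a nonzero constant in `J`.
  have hne : ¬ IsUnit d := by
    intro hu
    have h1 : (1 : K[X]) ∈ J.map (algebraMap A[X] K[X]) := by
      change (1 : K[X]) ∈ J.map φ
      rw [hd', Ideal.span_singleton_eq_top.2 hu]; trivial
    rw [IsLocalization.mem_map_algebraMap_iff ((nonZeroDivisors A).map (C : A →+* A[X]))] at h1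
    obtain ⟨⟨⟨y, hy⟩, ⟨s, a, ha, rfl⟩⟩, hs⟩ := h1
    rw [one_mul] at hs
    have : (C : A →+* A[X]) a = y := hφ hs
    subst this
    exact nonZeroDivisors.ne_zero ha (h0 a hy)
  have hd0 : d ≠ 0 := by
    rintro rfl
    obtain ⟨y, hy, hy0⟩ := Submodule.exists_mem_ne_zero_of_ne_bot hJ
    have : φ y ∈ J.map φ := Ideal.mem_map_of_mem _ hy
    rw [hd', Ideal.mem_span_singleton, zero_dvd_iff] at this
    exact hy0 (hφ (by rw [this, map_zero]))
  obtain ⟨b, hb, hbd⟩ := IsLocalization.integerNormalization_spec (nonZeroDivisors A) d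
  set e := IsLocalization.integerNormalization (nonZeroDivisors A) d with he
  have hb0 : algebraMap A K b ≠ 0 := by
    rw [Ne, IsFractionRing.to_map_eq_zero_iff]; exact nonZeroDivisors.ne_zero hb
  have he0 : e ≠ 0 := by
    intro h
    rw [h, Polynomial.map_zero] at hbd
    rw [← algebraMap_smul K b d] at hbd
    exact (smul_ne_zero hb0 hd0) hbd.symm
  -- Gauss's lemma: `d` is replaced by an associated primitive polynomial, so that divisibility over
  -- the fraction field descends to `A[X]`.
  have hassoc : Associated (e.primPart.map (algebraMap A K)) d := by
    have h1 : e.map (algebraMap A K) =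
        C (algebraMap A K e.content) * e.primPart.map (algebraMap A K) := by
      conv_lhs => rw [e.eq_C_content_mul_primPart]
      rw [Polynomial.map_mul, map_C]
    have hc : algebraMap A K e.content ≠ 0 := by
      rw [Ne, IsFractionRing.to_map_eq_zero_iff, content_eq_zero_iff]; exact he0
    have h2 : C (algebraMap A K e.content) * e.primPart.map (algebraMap A K)
        = C (algebraMap A K b) * d := by
      rw [← h1, hbd, ← algebraMap_smul K b d, smul_eq_C_mul]
    have u1 : IsUnit (C (algebraMap A K e.content)) := isUnit_C.2 (isUnit_iff_ne_zero.2 hc)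
    have u2 : IsUnit (C (algebraMap A K b)) := isUnit_C.2 (isUnit_iff_ne_zero.2 hb0)
    exact associated_of_unit_mul_eq u1 u2 h2
  refine ⟨e.primPart, fun hu => hne ?_, fun h hh => ?_⟩
  · exact hassoc.isUnit (hu.map φ)
  · have h1 : d ∣ φ h := by
      rw [← Ideal.mem_span_singleton, ← hd']; exact Ideal.mem_map_of_mem _ hh
    exact (e.isPrimitive_primPart.dvd_iff_fraction_map_dvd_fraction_map K).2
      (hassoc.dvd.trans h1)

end CommonFactor

/-! ### Real critical points that persist under perturbation of the form -/

section CriticalPoint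

open MvPolynomial

theorem hasDerivAt_eval_update {n : ℕ} (F : MvPolynomial (Fin n) ℝ) (v : Fin n → ℝ) (j : Fin n) :
    HasDerivAt (fun t => eval (Function.update v j t) F) (eval v (pderiv j F)) (v j) := by
  induction F using MvPolynomial.induction_on with
  | C a => simpa using hasDerivAt_const _ _
  | add f g hf hg =>
    simp only [map_add]
    exact hf.add hg
  | mul_X f i hf =>
    have h2 : HasDerivAt (fun t => Function.update v j t i) (if i = j then 1 else 0) (v j) := by
      by_cases h : i = j
      · subst h; simpa using hasDerivAt_id' (v i)
      · simpa [h, Function.update_of_ne h] using hasDerivAt_const (v j) (v i)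
    convert! hf.mul h2 using 1
    · funext t; simp
    · simp only [Derivation.leibniz, pderiv_X, smul_eq_mul, map_add, map_mul, eval_X,
        Function.update_eq_self]
      by_cases h : i = j
      · subst h; simp; ring
      · simp [h, mul_comm]

/-- A form close to `∑ xⱼ² x₀ᵖ⁻²` has a critical point in the affine chart `x₀ = 1`. -/
theorem exists_critical_point {n p : ℕ} (i₀ : Fin n) :
    ∃ (q : Expo n (p + 2) → ℚ) (ε : ℝ), 0 < ε ∧ ∀ c : Expo n (p + 2) → ℝ,
      (∀ α, |c α - q α| < ε) →
      ∃ v : Fin n → ℝ, v i₀ = 1 ∧ ∀ j, j ≠ i₀ → eval v (pderiv j (formOf c)) = 0 := by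
  -- In the chart `x_{i₀} = 1` this form is the sum of squares of the other coordinates. Its minimum
  -- on a box is interior by a margin, which survives small changes of the coefficients.
  let Q : MvPolynomial (Fin n) ℚ := ∑ j ∈ Finset.univ.erase i₀, X j ^ 2 * X i₀ ^ p
  have hQ : Q.IsHomogeneous (p + 2) := IsHomogeneous.sum _ _ _ fun j _ => by
    simpa [add_comm] using (isHomogeneous_X_pow j 2).mul (isHomogeneous_X_pow (R := ℚ) i₀ p)
  -- On the box every monomial is at most one in absolute value, so coefficient errors below `1 / (2
  -- * N)` change values by less than `1 / 2`; the added `1` makes the estimate strict.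
  let N : ℝ := Fintype.card (Expo n (p + 2)) + 1
  have hN : 0 < N := by positivity
  refine ⟨coeffsOf _ Q, 1 / (2 * N), by positivity, fun c hc => ?_⟩
  let K : Set (Fin n → ℝ) := Set.pi Set.univ fun j => if j = i₀ then {1} else Set.Icc (-1) 1
  have hK : IsCompact K := isCompact_univ_pi fun j => by
    by_cases h : j = i₀
    · simp [h]
    · simp only [h, if_false]; exact isCompact_Icc
  have hv0K : (Function.update 0 i₀ 1 : Fin n → ℝ) ∈ K := fun j _ => by
    by_cases h : j = i₀
    · subst h; simp
    · simp [h]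
  have hcont : Continuous fun v : Fin n → ℝ => eval v (formOf c) := by
    exact MvPolynomial.continuous_eval _
  obtain ⟨v, hvK, hv⟩ := hK.exists_isMinOn ⟨_, hv0K⟩ hcont.continuousOn
  have habs : ∀ w ∈ K, ∀ j, |w j| ≤ 1 := fun w hw j => by
    have := hw j trivial
    by_cases h : j = i₀
    · simp only [h, if_true, Set.mem_singleton_iff] at this; subst h; simp [this]
    · simp only [h, if_false] at this; exact abs_le.2 this
  have hone : ∀ w ∈ K, w i₀ = 1 := fun w hw => by simpa using hw i₀ trivial
  have hQev : ∀ w ∈ K, eval w (formOf fun α => ((coeffsOf (p + 2) Q α : ℚ) : ℝ)) =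
      ∑ j ∈ Finset.univ.erase i₀, w j ^ 2 := fun w hw => by
    have h1 := map_formOf (Rat.castHom ℝ) (coeffsOf (p + 2) Q)
    rw [formOf_coeffsOf hQ] at h1
    have h2 : (fun α => ((coeffsOf (p + 2) Q α : ℚ) : ℝ)) =
      fun α => (Rat.castHom ℝ) (coeffsOf (p + 2) Q α) := rfl
    rw [h2, ← h1]
    simp [Q, hone w hw]
  have hclose : ∀ w ∈ K, |eval w (formOf c) - ∑ j ∈ Finset.univ.erase i₀, w j ^ 2| < 1 / 2 :=
    fun w hw => by
    rw [← hQev w hw]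
    simp only [formOf, map_sum, eval_monomial]
    rw [← Finset.sum_sub_distrib]
    have h3 : ∀ α : Expo n (p + 2), |c α * (α.1.prod fun i e => w i ^ e) -
        ((coeffsOf (p + 2) Q α : ℚ) : ℝ) * (α.1.prod fun i e => w i ^ e)| ≤ 1 / (2 * N) := by
      intro α
      rw [← sub_mul, abs_mul]
      have h4 : |α.1.prod fun i e => w i ^ e| ≤ 1 := by
        rw [Finsupp.prod, Finset.abs_prod]
        exact Finset.prod_le_one (fun _ _ => abs_nonneg _) fun i _ => by
          rw [abs_pow]; exact pow_le_one₀ (abs_nonneg _) (habs w hw i)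
      calc _ ≤ 1 / (2 * N) * 1 := mul_le_mul (hc α).le h4 (abs_nonneg _) (by positivity)
        _ = _ := mul_one _
    calc _ ≤ _ := Finset.abs_sum_le_sum_abs _ _
      _ ≤ ∑ _α : Expo n (p + 2), 1 / (2 * N) := Finset.sum_le_sum fun α _ => h3 α
      _ = (N - 1) * (1 / (2 * N)) := by simp [N, nsmul_eq_mul]
      _ < N * (1 / (2 * N)) := by
        apply mul_lt_mul_of_pos_right _ (by positivity); linarith
      _ = 1 / 2 := by field_simp
  -- The value at the minimum is at most the value at the centre of the box. Both differ from the
  -- sum of squares by less than `1 / 2`, so the minimum is not on the boundary.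
  have hlow : ∑ j ∈ Finset.univ.erase i₀, v j ^ 2 < 1 := by
    have h1 := abs_lt.1 (hclose v hvK)
    have h2 := abs_lt.1 (hclose _ hv0K)
    have h3 : eval v (formOf c) ≤ eval (Function.update 0 i₀ 1) (formOf c) := hv hv0K
    have h4 : ∑ j ∈ Finset.univ.erase i₀, (Function.update (0 : Fin n → ℝ) i₀ 1) j ^ 2 = 0 := by
      apply Finset.sum_eq_zero
      intro j hj
      simp [Finset.ne_of_mem_erase hj]
    rw [h4] at h2
    linarith [h1.1, h2.2]
  refine ⟨v, hone v hvK, fun j hj => ?_⟩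
  have hvj : v j ∈ Set.Ioo (-1 : ℝ) 1 := by
    have h1 : v j ^ 2 ≤ ∑ j ∈ Finset.univ.erase i₀, v j ^ 2 :=
      Finset.single_le_sum (f := fun j => v j ^ 2) (fun _ _ => sq_nonneg _)
        (Finset.mem_erase.2 ⟨hj, Finset.mem_univ _⟩)
    exact abs_lt.1 ((sq_lt_one_iff_abs_lt_one _).1 (h1.trans_lt hlow))
  have hmin : IsLocalMin (fun t => eval (Function.update v j t) (formOf c)) (v j) := by
    filter_upwards [Ioo_mem_nhds hvj.1 hvj.2] with t ht
    rw [Function.update_eq_self]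
    apply hv
    intro i _
    by_cases h : i = j
    · subst h; simp only [hj, if_false, Function.update_self]; exact ⟨ht.1.le, ht.2.le⟩
    · rw [Function.update_of_ne h]; exact hvK i trivial
  exact hmin.hasDerivAt_eq_zero (hasDerivAt_eval_update _ _ _)

end CriticalPoint

end

/-! ### The ideal of singular forms and elimination by Macaulay's matrix -/

section DiscIdeal

open MvPolynomial

variable {n p : ℕ}

theorem aeval_coeff {R S σ ι : Type*} [CommRing R] [CommRing S] [Algebra R S] (c : ι → S)
    (F : MvPolynomial σ (MvPolynomial ι R)) (β : σ →₀ ℕ) :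
    aeval c (coeff β F) = coeff β (MvPolynomial.map (aeval c : _ →ₐ[R] S).toRingHom F) := by
  rw [coeff_map]; rfl

theorem map_aeval_formOf_X {R S : Type*} [CommRing R] [CommRing S] [Algebra R S]
    (c : Expo n p → S) :
    MvPolynomial.map (aeval c : _ →ₐ[R] S).toRingHom (formOf X) = formOf c := by
  rw [map_formOf]; simp

/-- The polynomials in the coefficients of forms that vanish on all real forms with a real
critical point. -/
def discIdeal (n p : ℕ) : Ideal (MvPolynomial (Expo n p) ℚ) where
  carrier := {g | ∀ c : Expo n p → ℝ,
    (∃ v : Fin n → ℝ, v ≠ 0 ∧ ∀ j, eval v (pderiv j (formOf c)) = 0) → aeval c g = 0}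
  zero_mem' := fun c _ => map_zero _
  add_mem' := fun hf hg c hc => by rw [map_add, hf c hc, hg c hc, add_zero]
  smul_mem' := fun a g hg c hc => by rw [smul_eq_mul, map_mul, hg c hc, mul_zero]

/-- The exponent of the power of a variable. -/
def Expo.pure (p : ℕ) (i : Fin n) : Expo n p :=
  ⟨Finsupp.single i p, mem_finsuppAntidiag_univ_iff.2 (by simp)⟩

/-- If the coefficients other than that of the pure power of `x_{i₀}` are near those of the
reference form, the partial derivatives in the other directions have a common zero with `x_{i₀} =
1`. The free coefficient can then be adjusted to kill the last partial derivative as well. So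
elements of the ideal that omit this coefficient vanish on an open set. -/
theorem eq_zero_of_rename_mem_discIdeal (i₀ : Fin n)
    (r : MvPolynomial {α : Expo n (p + 2) // α ≠ Expo.pure (p + 2) i₀} ℚ)
    (hr : rename Subtype.val r ∈ discIdeal n (p + 2)) : r = 0 := by
  obtain ⟨q, ε, hε, H⟩ := exists_critical_point (p := p) i₀
  refine funext_set (fun α => {x : ℚ | |(x : ℝ) - q α.1| < ε}) (fun α => ?_) fun x hx => ?_
  · obtain ⟨δ, hδ0, hδ⟩ := exists_rat_btwn hε
    refine (Set.Ioo_infinite (show q α.1 < q α.1 + δ by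
      have : (0 : ℚ) < δ := by exact_mod_cast hδ0
      linarith)).mono fun x hx => ?_
    have h1 : (q α.1 : ℝ) < x := by exact_mod_cast hx.1
    have h2 : (x : ℝ) < q α.1 + δ := by exact_mod_cast hx.2
    change |(x : ℝ) - q α.1| < ε
    rw [abs_of_pos (by linarith)]; linarith
  · classical
    let c₀ : Expo n (p + 2) → ℝ := fun α => if h : α ≠ Expo.pure (p + 2) i₀ then x ⟨α, h⟩ else q α
    obtain ⟨v, hv1, hv⟩ := H c₀ fun α => by
      by_cases h : α ≠ Expo.pure (p + 2) i₀
      · simp only [c₀, dif_pos h]; exact hx ⟨α, h⟩ trivial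
      · simp only [c₀, dif_neg h]; simpa using hε
    -- Adding `s x_{i₀}^(p+2)` changes only the `i₀`-th partial derivative, by `(p + 2) s` at a
    -- point with `x_{i₀} = 1`.
    let s : ℝ := - eval v (pderiv i₀ (formOf c₀)) / (p + 2)
    let d : Expo n (p + 2) → ℝ := Pi.single (Expo.pure (p + 2) i₀) s
    have hd : formOf d = monomial (Finsupp.single i₀ (p + 2)) s := by
      rw [formOf, Finset.sum_eq_single (Expo.pure (p + 2) i₀)]
      · simp [d, Expo.pure]
      · intro b _ hb; simp [d, hb]
      · simp
    have h0 := hr (c₀ + d) ⟨v, fun h => by simp [h] at hv1, fun j => by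
      rw [formOf_add, hd, map_add, map_add, pderiv_monomial, eval_monomial]
      by_cases h : j = i₀
      · subst h
        have : ((p : ℝ) + 2) ≠ 0 := by positivity
        simp only [Finsupp.single_eq_same, ← Finsupp.single_tsub, Finsupp.prod_pow]
        rw [Finset.prod_eq_single j]
        · simp only [hv1, one_pow, mul_one, s]
          push_cast
          field_simp
          ring
        · intro b _ hb; simp [Ne.symm hb]
        · simp
      · rw [hv j h]; simp [Finsupp.single_apply, Ne.symm h]⟩
    rw [aeval_rename] at h0
    have h1 : (c₀ + d) ∘ Subtype.val = fun α => algebraMap ℚ ℝ (x α) := by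
      funext α
      simp [c₀, d, α.2]
    rw [h1, show (fun α => algebraMap ℚ ℝ (x α)) = (algebraMap ℚ ℝ) ∘ x from rfl,
      aeval_algebraMap_apply] at h0
    rw [map_zero, ← coe_aeval_eq_eval]
    exact (map_eq_zero _).1 h0

/-- Only the component of `h` of degree `e` contributes. This turns membership of monomials in the
ideal of the partial derivatives into finite linear algebra. -/
theorem coeff_mul_of_isHomogeneous {S : Type*} [CommRing S] {e q : ℕ}
    (h : MvPolynomial (Fin n) S) {G : MvPolynomial (Fin n) S} (hG : G.IsHomogeneous q)
    (β : Expo n (e + q)) :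
    coeff β.1 (h * G) = ∑ γ : Expo n e, coeff γ.1 h * coeff β.1 (monomial γ.1 1 * G) := by
  have h1 : coeff β.1 (h * G) = coeff β.1 (homogeneousComponent e h * G) := by
    conv_lhs => rw [← sum_homogeneousComponent h, Finset.sum_mul, coeff_sum]
    have hz : ∀ i, i ≠ e → coeff β.1 (homogeneousComponent i h * G) = 0 := fun i hi => by
      apply ((homogeneousComponent_isHomogeneous i h).mul hG).coeff_eq_zero
      rw [β.degree_eq]; omega
    by_cases he : e ∈ Finset.range (h.totalDegree + 1)
    · exact Finset.sum_eq_single_of_mem e he fun i _ hi => hz i hi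
    · rw [Finset.sum_eq_zero fun i hi => hz i fun h => he (h ▸ hi),
        homogeneousComponent_eq_zero _ _ (by simpa using he), zero_mul, coeff_zero]
  rw [h1, ← formOf_coeffsOf (homogeneousComponent_isHomogeneous e h), formOf, Finset.sum_mul,
    coeff_sum]
  refine Finset.sum_congr rfl fun γ _ => ?_
  rw [← coeff_C_mul, ← mul_assoc, C_mul_monomial, mul_one, coeffsOf, coeff_homogeneousComponent,
    if_pos γ.degree_eq]

/-- A square submatrix of the matrix expressing the multiples of the partial derivatives of a form
by monomials. -/
def macaulayMatrix {S : Type*} [CommRing S] {e : ℕ} (ρ : Expo n (e + p) → Fin n × Expo n e)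
    (c : Expo n (p + 1) → S) : Matrix (Expo n (e + p)) (Expo n (e + p)) S :=
  Matrix.of fun β β' => coeff β'.1 (monomial (ρ β).2.1 1 * pderiv (ρ β).1 (formOf c))

theorem aeval_det_macaulayMatrix {S : Type*} [CommRing S] [Algebra ℚ S] {e : ℕ}
    (ρ : Expo n (e + p) → Fin n × Expo n e) (c : Expo n (p + 1) → S) :
    aeval c (macaulayMatrix ρ (X : _ → MvPolynomial (Expo n (p + 1)) ℚ)).det =
      (macaulayMatrix ρ c).det := by
  rw [AlgHom.map_det]
  congr 1
  ext β β'
  simp only [macaulayMatrix, AlgHom.mapMatrix_apply, Matrix.map_apply, Matrix.of_apply]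
  rw [aeval_coeff, map_mul, map_monomial, map_one, ← pderiv_map, map_aeval_formOf_X]

/-- At a nonzero critical point `v` every multiple of a partial derivative vanishes, so the matrix
annihilates the vector of the monomials of `v`. That vector is nonzero because it contains the pure
powers of the entries of `v`. -/
theorem det_macaulayMatrix_mem_discIdeal {e : ℕ} (ρ : Expo n (e + p) → Fin n × Expo n e) :
    (macaulayMatrix ρ (X : _ → MvPolynomial (Expo n (p + 1)) ℚ)).det ∈ discIdeal n (p + 1) := by
  rintro c ⟨v, hv, hcv⟩
  rw [aeval_det_macaulayMatrix, ← Matrix.exists_mulVec_eq_zero_iff]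
  refine ⟨fun β => eval v (monomial β.1 1), fun h => ?_, ?_⟩
  · obtain ⟨i, hi⟩ := Function.ne_iff.1 hv
    have h1 := congrFun h (Expo.pure (e + p) i)
    simp only [Expo.pure, eval_monomial, Pi.zero_apply, one_mul] at h1
    rw [Finsupp.prod_single_index (by simp)] at h1
    exact pow_ne_zero _ hi h1
  · funext β
    have hG : (monomial (ρ β).2.1 1 * pderiv (ρ β).1 (formOf c)).IsHomogeneous (e + p) :=
      (isHomogeneous_monomial _ (ρ β).2.degree_eq).mul (isHomogeneous_formOf c).pderiv
    have h1 : eval v (monomial (ρ β).2.1 1 * pderiv (ρ β).1 (formOf c)) = 0 := by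
      rw [map_mul, hcv, mul_zero]
    rw [← formOf_coeffsOf hG, formOf, map_sum] at h1
    rw [Pi.zero_apply, ← h1]
    refine Finset.sum_congr rfl fun β' _ => ?_
    simp [macaulayMatrix, coeffsOf, eval_monomial]

/-- Elimination: a form without critical points is separated from the singular ones by a polynomial
in the coefficients, a minor of the matrix of Macaulay. -/
theorem exists_mem_discIdeal {K : Type*} [Field K] [IsAlgClosed K] [CharZero K]
    (c : Expo n (p + 1) → K) (hc : ∀ v : Fin n → K, v ≠ 0 → ∃ j, eval v (pderiv j (formOf c)) ≠ 0) :
    ∃ g ∈ discIdeal n (p + 1), aeval c g ≠ 0 := by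
  classical
  let I : Ideal (MvPolynomial (Fin n) K) := Ideal.span (Set.range fun j => pderiv j (formOf c))
  -- Nullstellensatz: the partial derivatives have no common zero other than the origin, where every
  -- variable vanishes.
  have hrad : ∀ i : Fin n, ∃ k : ℕ, (X i : MvPolynomial (Fin n) K) ^ k ∈ I := fun i => by
    change (X i : MvPolynomial (Fin n) K) ∈ I.radical
    rw [← vanishingIdeal_zeroLocus_eq_radical (K := K), mem_vanishingIdeal_iff]
    intro v hv
    rw [aeval_X]
    by_contra hi
    obtain ⟨j, hj⟩ := hc v fun h => hi (by simp [h])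
    exact hj (hv _ (Ideal.subset_span ⟨j, rfl⟩))
  choose k hk using hrad
  -- By the pigeonhole principle a monomial of degree `e + p` has some exponent at least `k i`, so
  -- it lies in `I`.
  set e : ℕ := ∑ i, k i + 1 with he
  have hmon : ∀ β : Expo n (e + p), ∃ h : Fin n → MvPolynomial (Fin n) K,
      ∑ j, h j * pderiv j (formOf c) = monomial β.1 1 := fun β => by
    rw [← Ideal.mem_span_range_iff_exists_fun]
    obtain ⟨i, hi⟩ : ∃ i, k i ≤ β.1 i := by
      by_contra! hlt
      have h1 := β.degree_eq
      rw [Finsupp.degree_eq_sum] at h1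
      have h2 : ∑ i, β.1 i ≤ ∑ i, k i := Finset.sum_le_sum fun i _ => (hlt i).le
      omega
    have h3 : monomial β.1 (1 : K) = monomial (β.1 - Finsupp.single i (k i)) 1 * X i ^ k i := by
      rw [X_pow_eq_monomial, monomial_mul, mul_one, tsub_add_cancel_of_le]
      simpa using hi
    rw [h3]
    exact I.mul_mem_left _ (hk i)
  choose h hh using hmon
  have hpd : ∀ {S : Type _} [CommRing S] (c : Expo n (p + 1) → S) (j : Fin n),
      (pderiv j (formOf c)).IsHomogeneous p := fun c j => (isHomogeneous_formOf c).pderiv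
  let row : Fin n × Expo n e → Expo n (e + p) → K := fun ρ β =>
    coeff β.1 (monomial ρ.2.1 1 * pderiv ρ.1 (formOf c))
  -- All monomials of degree `e + p` are combinations of the rows, so the rows have full rank and a
  -- basis among them selects an invertible square submatrix.
  have hspan : Submodule.span K (Set.range row) = ⊤ := by
    rw [eq_top_iff, ← (Pi.basisFun K (Expo n (e + p))).span_eq, Submodule.span_le]
    rintro _ ⟨β, rfl⟩
    have h1 : Pi.basisFun K (Expo n (e + p)) β =
        ∑ ρ : Fin n × Expo n e, coeff ρ.2.1 (h β ρ.1) • row ρ := by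
      funext β'
      have h2 := congrArg (coeff β'.1) (hh β)
      rw [coeff_sum, coeff_monomial] at h2
      rw [Finset.sum_apply, Fintype.sum_prod_type, Pi.basisFun_apply, Pi.single_apply]
      have h3 : (if β' = β then (1 : K) else 0) = if β.1 = β'.1 then 1 else 0 := by
        exact if_congr (by rw [eq_comm, Subtype.ext_iff]) rfl rfl
      rw [h3, ← h2]
      refine Finset.sum_congr rfl fun j _ => ?_
      rw [coeff_mul_of_isHomogeneous _ (hpd c j)]
      rfl
    rw [h1]
    exact Submodule.sum_mem _ fun ρ _ => Submodule.smul_mem _ _ (Submodule.subset_span ⟨ρ, rfl⟩)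
  obtain ⟨κ, a, -, ha, hli⟩ := exists_linearIndependent' K row
  let b := Module.Basis.mk hli (by rw [ha, hspan])
  let σ : Expo n (e + p) ≃ κ := (Pi.basisFun K (Expo n (e + p))).indexEquiv b
  refine ⟨(macaulayMatrix (fun β => a (σ β)) (X : _ → MvPolynomial (Expo n (p + 1)) ℚ)).det,
    det_macaulayMatrix_mem_discIdeal _, ?_⟩
  rw [aeval_det_macaulayMatrix]
  have h1 : LinearIndependent K (macaulayMatrix (fun β => a (σ β)) c).row :=
    hli.comp σ σ.injective
  exact ((Matrix.isUnit_iff_isUnit_det _).1 (Matrix.linearIndependent_rows_iff_isUnit.1 h1)).ne_zero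
end DiscIdeal

section

/-! ### Polynomial characters of the general linear group -/

section Characters

open Matrix Polynomial

/-- A polynomial character of the general linear group is a power of the determinant. -/
theorem exists_eq_det_pow {n : ℕ} (i₀ : Fin n) (χ : Matrix (Fin n) (Fin n) ℚ → ℚ)
    (hmul : ∀ A B : Matrix (Fin n) (Fin n) ℚ, A.det ≠ 0 → B.det ≠ 0 → χ (A * B) = χ A * χ B)
    (hone : χ 1 = 1)
    (hpoly : ∀ A : Matrix (Fin n) (Fin n) ℚ[X], ∃ P : ℚ[X], ∀ x, P.eval x = χ (A.map (eval x))) :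
    ∃ e : ℕ, ∀ A : Matrix (Fin n) (Fin n) ℚ, A.det ≠ 0 → χ A = A.det ^ e := by
  have hunit : ∀ A B : Matrix (Fin n) (Fin n) ℚ, A * B = 1 → χ A * χ B = 1 := fun A B h => by
    have hd : A.det * B.det = 1 := by rw [← det_mul, h, det_one]
    rw [← hmul A B (left_ne_zero_of_mul_eq_one hd) (right_ne_zero_of_mul_eq_one hd), h, hone]
  -- The value on a transvection is a polynomial in its parameter, invertible because the
  -- transvection with the opposite parameter is the inverse. It is therefore constant, equal to its
  -- value at zero.
  have htrans : ∀ (i j : Fin n), i ≠ j → ∀ x : ℚ, χ (transvection i j x) = 1 := by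
    intro i j hij
    obtain ⟨P, hP⟩ := hpoly (transvection i j X)
    have hP' : ∀ x, P.eval x = χ (transvection i j x) := fun x => by
      rw [hP]
      congr 1
      ext a b
      simp only [transvection, map_apply, Matrix.add_apply, one_apply, single_apply, eval_add]
      split_ifs <;> simp
    have hu : IsUnit P := by
      refine IsUnit.of_mul_eq_one (P.comp (-X)) (Polynomial.funext fun x => ?_)
      rw [eval_mul, eval_comp, hP', eval_neg, eval_X, hP', eval_one]
      apply hunit
      rw [transvection_mul_transvection_same _ _ hij]
      simp
    obtain ⟨c, -, hc⟩ := isUnit_iff.1 hu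
    intro x
    have h0 := hP' 0
    rw [transvection_zero, hone, ← hc, eval_C] at h0
    rw [← hP', ← hc, eval_C, h0]
  obtain ⟨P, hP⟩ := hpoly (diagonal (Function.update 1 i₀ X))
  have hP' : ∀ x, P.eval x = χ (diagonal (Function.update 1 i₀ x)) := fun x => by
    rw [hP]
    congr 1
    ext a b
    simp only [map_apply, diagonal_apply, Function.update_apply]
    split_ifs <;> simp
  have hdet : ∀ (i : Fin n) (x : ℚ), (diagonal (Function.update (1 : Fin n → ℚ) i x)).det = x := by
    intro i x
    rw [det_diagonal, Finset.prod_eq_single i] <;> simp +contextual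
  have hPm : ∀ x y : ℚ, x ≠ 0 → y ≠ 0 → P.eval (x * y) = P.eval x * P.eval y := fun x y hx hy => by
    rw [hP', hP', hP', ← hmul _ _ (by rwa [hdet]) (by rwa [hdet]), diagonal_mul_diagonal]
    congr 2
    funext j
    simp only [Function.update_apply]
    split_ifs <;> simp
  have hP1 : P.eval 1 = 1 := by
    have : Function.update (1 : Fin n → ℚ) i₀ 1 = 1 := by simp
    rw [hP', this, ← hone]
    exact congrArg χ diagonal_one
  have hP0 : P ≠ 0 := fun h => by simp [h] at hP1
  -- Comparison of the leading coefficients in `y` of `P(x) P(y) = P(x y)`.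
  have hPx : ∀ x : ℚ, x ≠ 0 → P.eval x = x ^ P.natDegree := fun x hx => by
    have h1 : C (P.eval x) * P = P.comp (C x * X) := by
      refine eq_of_infinite_eval_eq _ _ ((Set.Ioi_infinite (0 : ℚ)).mono fun y hy => ?_)
      have hy : 0 < y := hy
      simp [eval_comp, hPm x y hx hy.ne']
    have h2 := congrArg (fun Q => Q.coeff P.natDegree) h1
    simp only [coeff_C_mul, comp_C_mul_X_coeff] at h2
    rw [mul_comm] at h2
    exact mul_left_cancel₀ (by simpa using hP0) h2
  refine ⟨P.natDegree, ?_⟩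
  have hdiag1 : ∀ (i : Fin n) (x : ℚ), x ≠ 0 →
      χ (diagonal (Function.update 1 i x)) = x ^ P.natDegree := fun i x hx => by
    -- The matrix of the transposition of `i` and `i₀`, which conjugates the one-parameter diagonal
    -- matrices at these two places into each other.
    let W : Matrix (Fin n) (Fin n) ℚ := of fun a b => if Equiv.swap i i₀ a = b then 1 else 0
    have hW : W * W = 1 := by
      ext a b
      simp only [W, mul_apply, of_apply, one_apply, ite_mul, one_mul, zero_mul]
      rw [Finset.sum_ite_eq]
      simp
    have hWd : W.det ≠ 0 := by
      have : W.det * W.det = 1 := by rw [← det_mul, hW, det_one]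
      exact left_ne_zero_of_mul_eq_one this
    have h1 : W * diagonal (Function.update 1 i₀ x) = diagonal (Function.update 1 i x) * W := by
      ext a b
      rw [mul_diagonal, diagonal_mul]
      simp only [W, of_apply]
      by_cases h : Equiv.swap i i₀ a = b
      · simp only [if_pos h, one_mul, mul_one, Function.update_apply, Pi.one_apply]
        refine if_congr ?_ rfl rfl
        rw [← h, Equiv.swap_apply_eq_iff, Equiv.swap_apply_right]
      · simp [if_neg h]
    have h2 := congrArg χ h1
    rw [hmul _ _ hWd (by rwa [hdet]), hmul _ _ (by rwa [hdet]) hWd, mul_comm, ← hP'] at h2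
    rw [← hPx x hx]
    exact (mul_right_cancel₀ (fun h => by simpa [h] using hunit W W hW) h2).symm
  have hdiag : ∀ d : Fin n → ℚ, (∀ i, d i ≠ 0) → ∀ s : Finset (Fin n),
      χ (diagonal fun i => if i ∈ s then d i else 1) = (∏ i ∈ s, d i) ^ P.natDegree := by
    intro d hd s
    induction s using Finset.induction_on with
    | empty => simpa using hone
    | insert a s ha ih =>
      have h1 : (diagonal fun i => if i ∈ insert a s then d i else 1) =
          diagonal (Function.update 1 a (d a)) * diagonal fun i => if i ∈ s then d i else 1 := by
        rw [diagonal_mul_diagonal]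
        congr 1
        funext j
        by_cases h : j = a
        · subst h; simp [ha]
        · simp [h]
      have h2 : (diagonal fun i => if i ∈ s then d i else 1).det ≠ 0 := by
        rw [det_diagonal, Finset.prod_ne_zero_iff]
        intro i _
        split_ifs
        exacts [hd i, one_ne_zero]
      rw [h1, hmul _ _ (by rw [hdet]; exact hd a) h2, ih, hdiag1 _ _ (hd a),
        Finset.prod_insert ha, mul_pow]
  intro A hA
  refine diagonal_transvection_induction_of_det_ne_zero (fun A => χ A = A.det ^ P.natDegree) A hA
    (fun D hD => ?_) (fun t => ?_) fun A B hA hB h1 h2 => ?_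
  · rw [det_diagonal] at hD ⊢
    have := hdiag D (fun i => Finset.prod_ne_zero_iff.1 hD i (Finset.mem_univ _)) Finset.univ
    simpa using this
  · rw [t.det, one_pow]
    exact htrans t.i t.j t.hij t.c
  · rw [hmul A B hA hB, h1, h2, det_mul, mul_pow]

end Characters

/-! ### The action of substitutions on polynomials in the coefficients -/

section Discriminant

open MvPolynomial

variable {n p : ℕ}

theorem aeval_C_mul_X {S σ : Type*} [CommRing S] (a : S) (f : MvPolynomial σ S) (m : σ →₀ ℕ) :
    coeff m (aeval (fun i => C a * X i : σ → MvPolynomial σ S) f) = a ^ m.degree * coeff m f := by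
  induction f using MvPolynomial.induction_on' with
  | monomial d r =>
    have : aeval (fun i => C a * X i : σ → MvPolynomial σ S) (monomial d r) =
        monomial d (a ^ d.degree * r) := by
      rw [aeval_monomial, Finsupp.prod]
      simp only [mul_pow, Finset.prod_mul_distrib, algebraMap_eq]
      rw [Finset.prod_pow_eq_pow_sum, ← Finsupp.degree_apply, ← C_pow, mul_left_comm, ← mul_assoc,
        ← C_mul, mul_comm, ← Finsupp.prod, monomial_eq]
      ring
    classical
    rw [this, coeff_monomial, coeff_monomial]
    split_ifs with h
    · rw [h]
    · simp
  | add f g hf hg => rw [map_add, coeff_add, coeff_add, hf, hg, mul_add]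

/-- The action of linear substitutions on the coefficients of forms. -/
def subCoeffs {S : Type*} [CommRing S] (A : Matrix (Fin n) (Fin n) S) (c : Expo n p → S) :
    Expo n p → S := coeffsOf p (linSub A (formOf c))

section

variable {S T : Type*} [CommRing S] [CommRing T]

theorem formOf_subCoeffs (A : Matrix (Fin n) (Fin n) S) (c : Expo n p → S) :
    formOf (subCoeffs A c) = linSub A (formOf c) :=
  formOf_coeffsOf (linSub_isHomogeneous A (isHomogeneous_formOf c))

theorem map_subCoeffs (f : S →+* T) (A : Matrix (Fin n) (Fin n) S) (c : Expo n p → S) :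
    (fun α => f (subCoeffs A c α)) = subCoeffs (A.map f) (fun α => f (c α)) := by
  rw [subCoeffs, ← coeffsOf_map, map_linSub, map_formOf]; rfl

theorem subCoeffs_mul (A B : Matrix (Fin n) (Fin n) S) (c : Expo n p → S) :
    subCoeffs (A * B) c = subCoeffs B (subCoeffs A c) := by
  rw [subCoeffs, linSub_mul, ← formOf_subCoeffs A c]; rfl

theorem subCoeffs_one (c : Expo n p → S) : subCoeffs 1 c = c := by
  rw [subCoeffs, linSub_one, coeffsOf_formOf]

theorem subCoeffs_smul_one (a : S) (c : Expo n p → S) :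
    subCoeffs (a • (1 : Matrix (Fin n) (Fin n) S)) c = fun α => a ^ p * c α := by
  funext α
  have h : (fun i => ∑ j, C ((a • (1 : Matrix (Fin n) (Fin n) S)) i j) * X j :
      Fin n → MvPolynomial (Fin n) S) = fun i => C a * X i := by
    funext i
    rw [Finset.sum_eq_single i] <;> simp +contextual [eq_comm]
  rw [subCoeffs, coeffsOf, linSub, h, aeval_C_mul_X, α.degree_eq]
  exact congrArg (a ^ p * ·) (congrFun (coeffsOf_formOf c) α)

end

/-- The action of linear substitutions on polynomials in the coefficients of forms. -/
def subHom (A : Matrix (Fin n) (Fin n) ℚ) :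
    MvPolynomial (Expo n p) ℚ →ₐ[ℚ] MvPolynomial (Expo n p) ℚ :=
  aeval (subCoeffs (A.map C) X)

theorem aeval_subHom {S : Type*} [CommRing S] [Algebra ℚ S] (A : Matrix (Fin n) (Fin n) ℚ)
    (c : Expo n p → S) (g : MvPolynomial (Expo n p) ℚ) :
    aeval c (subHom A g) = aeval (subCoeffs (A.map (algebraMap ℚ S)) c) g := by
  have h : (aeval c).comp (subHom A) = aeval (subCoeffs (A.map (algebraMap ℚ S)) c) := by
    apply algHom_ext
    intro α
    have := congrFun (map_subCoeffs (aeval c : _ →ₐ[ℚ] S).toRingHom (A.map C)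
      (X : Expo n p → MvPolynomial (Expo n p) ℚ)) α
    simp only [AlgHom.comp_apply, subHom, aeval_X]
    refine this.trans ?_
    have h1 : (A.map C).map (aeval c : _ →ₐ[ℚ] S).toRingHom = A.map (algebraMap ℚ S) := by
      ext i j; simp
    have h2 : (fun α => (aeval c : _ →ₐ[ℚ] S).toRingHom (X α)) = c := by
      funext β; simp
    rw [h1, h2]
  exact DFunLike.congr_fun h g

theorem subHom_subHom (A B : Matrix (Fin n) (Fin n) ℚ) (g : MvPolynomial (Expo n p) ℚ) :
    subHom A (subHom B g) = subHom (A * B) g := by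
  refine MvPolynomial.funext fun c => ?_
  simp only [← coe_aeval_eq_eval]
  change aeval c _ = aeval c _
  rw [aeval_subHom, aeval_subHom, aeval_subHom, ← subCoeffs_mul]
  rfl

theorem subHom_one (g : MvPolynomial (Expo n p) ℚ) : subHom 1 g = g := by
  rw [subHom, show (1 : Matrix (Fin n) (Fin n) ℚ).map (C : ℚ → MvPolynomial (Expo n p) ℚ) = 1 from
    Matrix.map_one _ C_0 C_1, subCoeffs_one, aeval_X_left]; rfl

/-- If `v` is a critical point of a form, then by the chain rule `B⁻¹ v` is one of the form composed
with `B`. -/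
theorem subHom_mem_discIdeal (A : Matrix (Fin n) (Fin n) ℚ) (hA : A.det ≠ 0)
    {g : MvPolynomial (Expo n p) ℚ} (hg : g ∈ discIdeal n p) : subHom A g ∈ discIdeal n p := by
  rintro c ⟨v, hv, hcv⟩
  rw [aeval_subHom]
  set B := A.map (algebraMap ℚ ℝ) with hB
  have hBd : IsUnit B.det := by
    have : B.det = algebraMap ℚ ℝ A.det := ((algebraMap ℚ ℝ).map_det A).symm
    rw [this]
    simpa using hA
  have h1 : B.mulVec (B⁻¹.mulVec v) = v := by
    rw [Matrix.mulVec_mulVec, Matrix.mul_nonsing_inv _ hBd, Matrix.one_mulVec]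
  refine hg _ ⟨B⁻¹.mulVec v, fun h => hv ?_, fun j => ?_⟩
  · rw [← h1, h, Matrix.mulVec_zero]
  · rw [formOf_subCoeffs, eval_pderiv_linSub, h1]
    simp [hcv]

end Discriminant

end

/-! ### Construction of the discriminant -/

section Discriminant

open MvPolynomial

variable {n p : ℕ}

/-- The subsingleton condition makes every ring homomorphism compatible with the two algebra
structures. It is used with coefficients in `ℤ` and `ℚ`, where homomorphisms out of the base are
unique. -/
theorem ringHom_aeval {B S T σ : Type*} [CommRing B] [CommRing S] [CommRing T] [Algebra B S]
    [Algebra B T] [Subsingleton (B →+* T)] (f : S →+* T) (c : σ → S) (g : MvPolynomial σ B) :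
    f (aeval c g) = aeval (fun i => f (c i)) g := by
  induction g using MvPolynomial.induction_on with
  | C a =>
    rw [aeval_C, aeval_C]
    exact DFunLike.congr_fun (Subsingleton.elim (f.comp (algebraMap B S)) (algebraMap B T)) a
  | add g h hg hh => simp [hg, hh]
  | mul_X g i hg => simp [hg]

theorem aeval_self {B σ : Type*} [CommRing B] (c : σ → B) (g : MvPolynomial σ B) :
    aeval c g = eval c g := by
  rw [← coe_aeval_eq_eval]; rfl

/-- The greatest common divisor of a finite set of generators. -/
theorem exists_gcd_of_ideal {A : Type*} [CommRing A] [IsDomain A] [UniqueFactorizationMonoid A]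
    [IsNoetherianRing A] (J : Ideal A) :
    ∃ R : A, (∀ h ∈ J, R ∣ h) ∧ ∀ e, (∀ h ∈ J, e ∣ h) → e ∣ R := by
  classical
  have : NormalizedGCDMonoid A := Classical.choice inferInstance
  obtain ⟨s, rfl⟩ := IsNoetherian.noetherian J
  refine ⟨s.gcd id, fun h hh => ?_, fun e he => Finset.dvd_gcd fun b hb =>
    he b (Submodule.subset_span hb)⟩
  have h1 : Submodule.span A (s : Set A) ≤ Ideal.span {s.gcd id} := Submodule.span_le.2 fun b hb =>
    Ideal.mem_span_singleton.2 (Finset.gcd_dvd (f := id) hb)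
  exact Ideal.mem_span_singleton.1 (h1 hh)

/-- The Fermat form `∑ xᵢ^p` has no critical point other than zero, so elimination yields an element
of the ideal that is nonzero at its coefficients. -/
theorem discIdeal_ne_bot (hp : 2 ≤ p) : discIdeal n p ≠ ⊥ := by
  obtain ⟨p, rfl⟩ := Nat.exists_eq_add_of_le' hp
  let K := AlgebraicClosure ℚ
  let F : MvPolynomial (Fin n) K := ∑ i, X i ^ (p + 2)
  have hF : F.IsHomogeneous (p + 2) := IsHomogeneous.sum _ _ _ fun i _ => isHomogeneous_X_pow _ _
  obtain ⟨g, hg, h0⟩ := exists_mem_discIdeal (p := p + 1) (coeffsOf (p + 2) F) fun v hv => by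
    obtain ⟨i, hi⟩ := Function.ne_iff.1 hv
    refine ⟨i, ?_⟩
    have h2 : ((p : K) + 2) ≠ 0 := by
      have : ((p + 2 : ℕ) : K) ≠ 0 := Nat.cast_ne_zero.2 (by omega)
      simpa using this
    have h1 : eval v (pderiv i F) = (p + 2) * v i ^ (p + 1) := by
      simp only [F, map_sum, Derivation.leibniz_pow, pderiv_X]
      rw [Finset.sum_eq_single i]
      · simp
      · intro j _ hj; simp [Ne.symm hj]
      · simp
    rw [formOf_coeffsOf hF, h1]
    exact mul_ne_zero h2 (pow_ne_zero _ hi)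
  intro h
  rw [h, Ideal.mem_bot] at hg
  rw [hg, map_zero] at h0
  exact h0 rfl

/-- Regard the polynomials as polynomials in the coefficient of one pure power. The ideal then
contains no nonzero constant, hence has a nonunit common factor, which divides the greatest common
divisor. -/
theorem not_isUnit_gcd_discIdeal (i₀ : Fin n) (hp : 2 ≤ p) {R : MvPolynomial (Expo n p) ℚ}
    (hR : ∀ e, (∀ h ∈ discIdeal n p, e ∣ h) → e ∣ R) : ¬ IsUnit R := by
  obtain ⟨p, rfl⟩ := Nat.exists_eq_add_of_le' hp
  classical
  let φ := (renameEquiv ℚ (Equiv.optionSubtypeNe (Expo.pure (p + 2) i₀)).symm).trans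
    (optionEquivLeft ℚ {α : Expo n (p + 2) // α ≠ Expo.pure (p + 2) i₀})
  have hφ : ∀ r : MvPolynomial {α : Expo n (p + 2) // α ≠ Expo.pure (p + 2) i₀} ℚ,
      φ (rename Subtype.val r) = Polynomial.C r := fun r => by
    induction r using MvPolynomial.induction_on with
    | C a => simp [φ, optionEquivLeft_C]
    | add f g hf hg => rw [map_add, map_add, map_add, hf, hg]
    | mul_X f i hf =>
      rw [map_mul, map_mul, hf, map_mul]
      congr 1
      simp only [φ, rename_X, AlgEquiv.trans_apply, renameEquiv_apply]
      rw [Equiv.optionSubtypeNe_symm_of_ne i.2, optionEquivLeft_X_some]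
  have : NormalizedGCDMonoid (MvPolynomial {α : Expo n (p + 2) // α ≠ Expo.pure (p + 2) i₀} ℚ) :=
    Classical.choice inferInstance
  let J := (discIdeal n (p + 2)).comap φ.symm
  have hJ : ∀ h, h ∈ discIdeal n (p + 2) → φ h ∈ J := fun h hh => by
    change φ.symm (φ h) ∈ discIdeal n (p + 2)
    rwa [φ.symm_apply_apply]
  have hJ0 : J ≠ ⊥ := fun h => by
    obtain ⟨y, hy, hy0⟩ := Submodule.exists_mem_ne_zero_of_ne_bot (discIdeal_ne_bot (n := n) hp)
    have h1 := hJ y hy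
    rw [h, Ideal.mem_bot] at h1
    exact hy0 (φ.injective (by rw [h1, map_zero]))
  obtain ⟨g, hg, hdvd⟩ := exists_common_factor J hJ0 fun a ha => by
    refine eq_zero_of_rename_mem_discIdeal i₀ a ?_
    have h1 : φ.symm (Polynomial.C a) ∈ discIdeal n (p + 2) := ha
    rwa [← hφ, φ.symm_apply_apply] at h1
  intro hu
  refine hg ?_
  have h1 : φ.symm g ∣ R := hR _ fun h hh => by
    simpa using map_dvd φ.symm (hdvd _ (hJ h hh))
  have h3 := (isUnit_of_dvd_unit h1 hu).map φ
  rwa [φ.apply_symm_apply] at h3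

theorem exists_integer_multiple_mvPolynomial {σ : Type*} (R : MvPolynomial σ ℚ) :
    ∃ (N : ℤ) (Q : MvPolynomial σ ℤ), N ≠ 0 ∧ MvPolynomial.map (Int.castRingHom ℚ) Q = C (N : ℚ) * R := by
  induction R using MvPolynomial.induction_on with
  | C a =>
    refine ⟨a.den, C a.num, by exact_mod_cast a.den_ne_zero, ?_⟩
    rw [map_C, ← C_mul]
    congr 1
    simp [mul_comm, Rat.mul_den_eq_num]
  | add f g hf hg =>
    obtain ⟨N, Q, hN, hQ⟩ := hf
    obtain ⟨N', Q', hN', hQ'⟩ := hg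
    refine ⟨N * N', C N' * Q + C N * Q', mul_ne_zero hN hN', ?_⟩
    simp only [map_add, map_mul, hQ, hQ', map_C, eq_intCast (Int.castRingHom ℚ), Int.cast_mul]
    ring
  | mul_X f i hf =>
    obtain ⟨N, Q, hN, hQ⟩ := hf
    exact ⟨N, Q * X i, hN, by rw [map_mul, hQ, map_X, mul_assoc]⟩

theorem aeval_of_map_eq {σ S : Type*} [CommRing S] [Algebra ℚ S] {N : ℤ} {Q : MvPolynomial σ ℤ}
    {R : MvPolynomial σ ℚ} (h : MvPolynomial.map (Int.castRingHom ℚ) Q = C (N : ℚ) * R)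
    (c : σ → S) : aeval c Q = algebraMap ℚ S N * aeval c R := by
  rw [← aeval_C c (N : ℚ), ← map_mul, ← h, (aeval_map_algebraMap ℚ c Q).symm]
  rfl

/-- A rational discriminant: a semi-invariant of forms that does not vanish at smooth ones. -/
theorem exists_rational_discriminant (i₀ : Fin n) (hp : 2 ≤ p) :
    ∃ (R : MvPolynomial (Expo n p) ℚ) (D E : ℕ), 0 < D ∧ p * D = n * E ∧ R.IsHomogeneous D ∧
      (∀ (A : Matrix (Fin n) (Fin n) ℚ) (c : Expo n p → ℚ), A.det ≠ 0 →
        eval (subCoeffs A c) R = A.det ^ E * eval c R) ∧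
      ∀ g ∈ discIdeal n p, R ∣ g := by
  obtain ⟨R, hR, hR'⟩ := exists_gcd_of_ideal (discIdeal n p)
  have hnu := not_isUnit_gcd_discIdeal i₀ hp hR'
  have hR0 : R ≠ 0 := by
    rintro rfl
    obtain ⟨y, hy, hy0⟩ := Submodule.exists_mem_ne_zero_of_ne_bot (discIdeal_ne_bot (n := n) hp)
    exact hy0 (zero_dvd_iff.1 (hR y hy))
  -- `R` divides the transform of each element of the ideal by `A⁻¹`. Transforming back, `subHom A
  -- R` is a common divisor of the ideal.
  have hdvd : ∀ A : Matrix (Fin n) (Fin n) ℚ, A.det ≠ 0 → subHom A R ∣ R := fun A hA => by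
    have hu : IsUnit A.det := isUnit_iff_ne_zero.2 hA
    refine hR' _ fun h hh => ?_
    have h1 := hR _ (subHom_mem_discIdeal A⁻¹ (by
      rw [Matrix.det_nonsing_inv, Ring.inverse_eq_inv']; exact inv_ne_zero hA) hh)
    have h2 := map_dvd (subHom A) h1
    rwa [subHom_subHom, Matrix.mul_nonsing_inv _ hu, subHom_one] at h2
  -- By divisibility in both directions `R` and its transform are associated, and the units of the
  -- polynomial ring over `ℚ` are constants.
  have hχ : ∀ A : Matrix (Fin n) (Fin n) ℚ, A.det ≠ 0 → ∃ x : ℚ, ∀ c : Expo n p → ℚ,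
      eval (subCoeffs A c) R = x * eval c R := fun A hA => by
    have hu : IsUnit A.det := isUnit_iff_ne_zero.2 hA
    have h1 := map_dvd (subHom A) (hdvd A⁻¹ (by
      rw [Matrix.det_nonsing_inv, Ring.inverse_eq_inv']; exact inv_ne_zero hA))
    rw [subHom_subHom, Matrix.mul_nonsing_inv _ hu, subHom_one] at h1
    obtain ⟨u, hu⟩ := associated_of_dvd_dvd h1 (hdvd A hA)
    obtain ⟨x, -, hx⟩ := isUnit_iff_eq_C_of_isReduced.1 u.isUnit
    refine ⟨x, fun c => ?_⟩
    have h3 := aeval_subHom A c R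
    rw [show A.map (algebraMap ℚ ℚ) = A from by ext; simp, ← hu, hx, map_mul, aeval_self,
      aeval_self, aeval_self, eval_C] at h3
    rw [← h3, mul_comm]
  obtain ⟨c₀, hc₀⟩ : ∃ c₀, eval c₀ R ≠ 0 := by
    by_contra! h
    exact hR0 (MvPolynomial.funext fun c => by rw [h, map_zero])
  obtain ⟨e, he⟩ := exists_eq_det_pow i₀ (fun A => eval (subCoeffs A c₀) R / eval c₀ R)
    (fun A B hA hB => by
      obtain ⟨x, hx⟩ := hχ B hB
      simp only [subCoeffs_mul]
      rw [hx (subCoeffs A c₀), hx c₀]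
      field_simp) (by simp only [subCoeffs_one]; exact div_self hc₀)
    (fun A => by
      refine ⟨aeval (subCoeffs A fun α => Polynomial.C (c₀ α)) R * Polynomial.C (eval c₀ R)⁻¹,
        fun x => ?_⟩
      rw [Polynomial.eval_mul, Polynomial.eval_C, div_eq_mul_inv]
      congr 1
      have h1 := map_subCoeffs (Polynomial.evalRingHom x) A fun α => Polynomial.C (c₀ α)
      simp only [Polynomial.coe_evalRingHom, Polynomial.eval_C] at h1
      rw [← h1, ← aeval_self, ← Polynomial.coe_evalRingHom, ringHom_aeval])
  have hinv : ∀ (A : Matrix (Fin n) (Fin n) ℚ) (c : Expo n p → ℚ), A.det ≠ 0 →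
        eval (subCoeffs A c) R = A.det ^ e * eval c R := fun A c hA => by
    obtain ⟨x, hx⟩ := hχ A hA
    rw [hx, ← he A hA, hx, mul_div_cancel_right₀ _ hc₀]
  -- Substitution by the scalar matrix `2`: it multiplies the coefficients of forms by `2 ^ p` and
  -- has determinant `2 ^ n`. This gives both the homogeneity of `R` and the relation between degree
  -- and weight.
  have hcoeff : ∀ m : Expo n p →₀ ℕ, coeff m R ≠ 0 → p * m.degree = n * e := fun m hm => by
    have h1 : aeval (fun α => C (2 ^ p) * X α : Expo n p → MvPolynomial (Expo n p) ℚ) R =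
        C (2 ^ (n * e)) * R := by
      refine MvPolynomial.funext fun c => ?_
      have h2 := hinv ((2 : ℚ) • 1) c (by simp)
      rw [subCoeffs_smul_one, Matrix.det_smul, Matrix.det_one, mul_one, Fintype.card_fin,
        ← pow_mul] at h2
      rw [map_mul, eval_C, ← h2, ringHom_aeval, aeval_self]
      simp only [map_mul, eval_C, eval_X]
    have h2 := congrArg (coeff m) h1
    rw [aeval_C_mul_X, coeff_C_mul, ← pow_mul] at h2
    exact Nat.pow_right_injective le_rfl (by exact_mod_cast mul_right_cancel₀ hm h2)
  obtain ⟨m, hm⟩ := ne_zero_iff.1 hR0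
  have hhom : R.IsHomogeneous m.degree := fun d hd => by
    refine (DFunLike.congr_fun (Finsupp.degree_eq_weight_one (R := ℕ)) d).symm.trans ?_
    exact Nat.eq_of_mul_eq_mul_left (by omega) ((hcoeff d hd).trans (hcoeff m hm).symm)
  refine ⟨R, m.degree, e, ?_, hcoeff m hm, hhom, hinv, hR⟩
  rw [Nat.pos_iff_ne_zero]
  intro h
  rw [h] at hhom
  have := (totalDegree_zero_iff_isHomogeneous _).2 hhom
  rw [totalDegree_eq_zero_iff_eq_C] at this
  refine hnu ?_
  rw [this]
  refine (isUnit_iff_ne_zero.2 fun h => ?_).map C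
  rw [this, h, map_zero] at hR0
  exact hR0 rfl

/-- By Euler's identity, in characteristic zero and positive degree a common zero of the partial
derivatives is a zero of the form itself. -/
theorem IsSmoothForm.exists_pderiv_ne_zero {K : Type u} [Field K] [CharZero K]
    {c : Expo n p → K} (hp : 0 < p) (h : IsSmoothForm (formOf c)) (v : Fin n → K) (hv : v ≠ 0) :
    ∃ j, eval v (pderiv j (formOf c)) ≠ 0 := by
  by_contra! h0
  obtain ⟨j, hj⟩ := h.2 v hv (by
    have h1 := congrArg (eval v) (isHomogeneous_formOf c).sum_X_mul_pderiv
    simp only [map_sum, map_mul, h0, mul_zero, Finset.sum_const_zero, map_nsmul] at h1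
    rw [nsmul_eq_mul, eq_comm, mul_eq_zero] at h1
    exact h1.resolve_left (Nat.cast_ne_zero.2 hp.ne'))
  exact hj (h0 j)

/-- The discriminant of forms of degree `p ≥ 2`: an integral polynomial in the coefficients, which
is semi-invariant and does not vanish at smooth forms. -/
theorem exists_discriminant (hn : 0 < n) (hp : 2 ≤ p) :
    ∃ (Δ : MvPolynomial (Expo n p) ℤ) (D E : ℕ), 0 < D ∧ p * D = n * E ∧ Δ.IsHomogeneous D ∧
      (∀ {S : Type u} [CommRing S] (A : Matrix (Fin n) (Fin n) S) (c : Expo n p → S),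
        aeval (subCoeffs A c) Δ = A.det ^ E * aeval c Δ) ∧
      ∀ {K : Type u} [Field K] [IsAlgClosed K] [CharZero K] (c : Expo n p → K),
        IsSmoothForm (formOf c) → aeval c Δ ≠ 0 := by
  obtain ⟨R, D, E, hD, hDE, hhom, hinv, hdvd⟩ := exists_rational_discriminant (⟨0, hn⟩ : Fin n) hp
  obtain ⟨N, Δ, hN, hΔ⟩ := exists_integer_multiple_mvPolynomial R
  have hN' : (N : ℚ) ≠ 0 := Int.cast_ne_zero.2 hN
  refine ⟨Δ, D, E, hD, hDE, ?_, ?_, ?_⟩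
  · refine IsHomogeneous.of_map (f := Int.castRingHom ℚ) Int.cast_injective ?_
    rw [hΔ]
    exact hhom.C_mul _
  · have hZ : ∀ (A : Matrix (Fin n) (Fin n) ℤ) (c : Expo n p → ℤ), A.det ≠ 0 →
        aeval (subCoeffs A c) Δ = A.det ^ E * aeval c Δ := fun A c hA => by
      apply Int.cast_injective (α := ℚ)
      have h1 := hinv (A.map (Int.castRingHom ℚ)) (fun α => Int.castRingHom ℚ (c α)) (by
        rw [← RingHom.mapMatrix_apply, ← RingHom.map_det]
        exact Int.cast_ne_zero.2 hA)
      rw [← RingHom.mapMatrix_apply, ← RingHom.map_det, RingHom.mapMatrix_apply,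
        ← map_subCoeffs] at h1
      rw [Int.cast_mul, Int.cast_pow]
      change Int.castRingHom ℚ _ = _ * Int.castRingHom ℚ _
      rw [ringHom_aeval, ringHom_aeval, aeval_of_map_eq hΔ, aeval_of_map_eq hΔ, aeval_self, aeval_self, h1]
      simp only [eq_intCast]
      ring
    -- The identity is proved for matrices and coefficients with independent integral variables as
    -- entries, and then specialised to `S`.
    intro S _ A c
    let V := (Fin n × Fin n) ⊕ Expo n p
    let AU : Matrix (Fin n) (Fin n) (MvPolynomial V ℤ) := Matrix.of fun i j => X (Sum.inl (i, j))
    let cU : Expo n p → MvPolynomial V ℤ := fun α => X (Sum.inr α)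
    have hU0 : AU.det ≠ 0 := fun h => by
      have h1 := congrArg (eval (Sum.elim (fun ij => (1 : Matrix (Fin n) (Fin n) ℤ) ij.1 ij.2) 0)) h
      rw [RingHom.map_det, map_zero] at h1
      have h2 : (eval (Sum.elim (fun ij => (1 : Matrix (Fin n) (Fin n) ℤ) ij.1 ij.2)
          (0 : Expo n p → ℤ))).mapMatrix AU = 1 := by
        ext i j; simp [AU]
      rw [h2, Matrix.det_one] at h1
      exact one_ne_zero h1
    -- Multiplying by the nonzero generic determinant removes the condition on it, so the identity
    -- can be checked at all integral points.
    have hU : aeval (subCoeffs AU cU) Δ = AU.det ^ E * aeval cU Δ := by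
      refine mul_left_cancel₀ hU0 (MvPolynomial.funext fun x => ?_)
      rw [map_mul, map_mul]
      by_cases h0 : eval x AU.det = 0
      · rw [h0, zero_mul, zero_mul]
      · congr 1
        rw [ringHom_aeval, map_mul, map_pow, ringHom_aeval, map_subCoeffs]
        rw [RingHom.map_det] at h0 ⊢
        exact hZ _ _ h0
    let f : MvPolynomial V ℤ →+* S :=
      (aeval (Sum.elim (fun ij => A ij.1 ij.2) c) : MvPolynomial V ℤ →ₐ[ℤ] S).toRingHom
    have h1 := congrArg f hU
    rw [ringHom_aeval, map_mul, map_pow, ringHom_aeval, map_subCoeffs, RingHom.map_det] at h1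
    have h2 : AU.map f = A := by ext i j; simp [AU, f]
    have h3 : (fun α => f (cU α)) = c := by funext α; simp [cU, f]
    rwa [RingHom.mapMatrix_apply, h2, h3] at h1
  · intro K _ _ _ c hc
    obtain ⟨p, rfl⟩ := Nat.exists_eq_add_of_le' hp
    obtain ⟨g, hg, hg0⟩ := exists_mem_discIdeal (p := p + 1) c
      (hc.exists_pderiv_ne_zero (by omega))
    obtain ⟨h, rfl⟩ := hdvd g hg
    rw [map_mul] at hg0
    rw [aeval_of_map_eq hΔ]
    exact mul_ne_zero ((map_ne_zero _).2 hN') (left_ne_zero_of_mul hg0)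

end Discriminant

section

/-! ### Derivations and coefficients of expansions -/

section LocalAlgebra

open MvPolynomial

variable {n p : ℕ} {O : Type*} [CommRing O]

theorem derivation_mem_pow (D : Derivation ℤ O O) (I : Ideal O) (k : ℕ) {g : O}
    (hg : g ∈ I ^ (k + 1)) : D g ∈ I ^ k := by
  induction k generalizing g with
  | zero => simp
  | succ k ih =>
    rw [pow_succ] at hg
    refine Submodule.mul_induction_on hg (fun a ha b hb => ?_) fun a b ha hb => ?_
    · rw [Derivation.leibniz, smul_eq_mul, smul_eq_mul]
      refine add_mem (Ideal.mul_mem_right _ _ ha) ?_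
      rw [pow_succ, mul_comm]
      exact Ideal.mul_mem_mul hb (ih ha)
    · rw [map_add]; exact add_mem ha hb

theorem eval_mem_pow {F : MvPolynomial (Fin n) O} (hF : F.IsHomogeneous p) (x : Fin n → O) :
    eval x F ∈ Ideal.span (Set.range x) ^ p :=
  (Ideal.mem_span_pow_iff_exists_isHomogeneous x _).2 ⟨F, hF, rfl⟩

theorem derivation_aeval {D : Derivation ℤ O O} {x : Fin n → O} {i : Fin n}
    (hD : ∀ j, D (x j) = if i = j then 1 else 0) (f : MvPolynomial (Fin n) ℤ) :
    D (aeval x f) = aeval x (pderiv i f) := by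
  induction f using MvPolynomial.induction_on with
  | C a => simp
  | add f g hf hg => simp [hf, hg]
  | mul_X f j hf =>
    rw [map_mul, Derivation.leibniz, hf, Derivation.leibniz, aeval_X, hD, pderiv_X]
    by_cases h : i = j
    · subst h; simp
    · simp [h]

theorem eval_monomial_one (x : Fin n → O) (α : Fin n →₀ ℕ) :
    eval x (monomial α 1) = aeval x (monomial α (1 : ℤ)) := by
  simp [eval_monomial, aeval_monomial]

/-- The difference consists of the derivatives of the coefficients, which are multiplied by
monomials of degree `p` in `x`. -/
theorem derivation_eval_sub_mem {D : Derivation ℤ O O} {x : Fin n → O} {i : Fin n}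
    (hD : ∀ j, D (x j) = if i = j then 1 else 0) {F : MvPolynomial (Fin n) O}
    (hF : F.IsHomogeneous p) :
    D (eval x F) - eval x (pderiv i F) ∈ Ideal.span (Set.range x) ^ p := by
  rw [← formOf_coeffsOf hF]
  simp only [formOf, map_sum]
  rw [← Finset.sum_sub_distrib]
  refine Submodule.sum_mem _ fun α _ => ?_
  have h1 : monomial α.1 (coeffsOf p F α) = C (coeffsOf p F α) * monomial α.1 1 := by
    rw [C_mul_monomial, mul_one]
  rw [h1, map_mul, eval_C, eval_monomial_one, Derivation.leibniz, derivation_aeval hD, pderiv_C_mul,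
    map_mul, eval_C, smul_eq_mul, smul_eq_mul, ← eval_monomial_one]
  have h2 : eval x (pderiv i (monomial α.1 1)) = aeval x (pderiv i (monomial α.1 (1 : ℤ))) := by
    simp [pderiv_monomial, eval_monomial, aeval_monomial]
  rw [h2, add_sub_cancel_left]
  exact Ideal.mul_mem_right _ _
    (eval_mem_pow (isHomogeneous_monomial (1 : O) α.degree_eq) x)

/-- In the presence of derivations dual to `x`, a form in `x` determines its coefficients modulo
the ideal of `x`; this is compatible with filtrations shifted by the derivations. -/
theorem coeff_mem_of_eval_mem (hk : ∀ k : ℕ, k ≠ 0 → IsUnit (k : O))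
    {D : Fin n → Derivation ℤ O O} {x : Fin n → O}
    (hD : ∀ i j, D i (x j) = if i = j then 1 else 0) {Q : ℕ → Ideal O}
    (hQ : ∀ i k g, g ∈ Q (k + 1) → D i g ∈ Q k) {F : MvPolynomial (Fin n) O}
    (hF : F.IsHomogeneous p)
    (h : eval x F ∈ Q p ⊔ Ideal.span (Set.range x) ^ (p + 1)) (α : Fin n →₀ ℕ) :
    coeff α F ∈ Q 0 ⊔ Ideal.span (Set.range x) := by
  induction p generalizing F α with
  | zero =>
    rw [zero_add, pow_one] at h
    obtain ⟨a, rfl⟩ : ∃ a, F = C a :=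
      ⟨_, totalDegree_eq_zero_iff_eq_C.1 ((totalDegree_zero_iff_isHomogeneous _).2 hF)⟩
    rw [eval_C] at h
    classical
    rw [coeff_C]
    split_ifs
    exacts [h, zero_mem _]
  | succ p ih =>
    by_cases hα : α.degree = p + 1
    · obtain ⟨i, hi⟩ : ∃ i, α i ≠ 0 := by
        by_contra! h0
        have : α = 0 := Finsupp.ext h0
        simp [this] at hα
      -- Differentiation in a variable that occurs in `α` lowers both the degree and the filtration
      -- by one. It multiplies the coefficient by the integer `α i`, which is a unit.
      have h1 : eval x (pderiv i F) ∈ Q p ⊔ Ideal.span (Set.range x) ^ (p + 1) := by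
        have h2 := derivation_eval_sub_mem (hD i) hF
        have h3 : D i (eval x F) ∈ Q p ⊔ Ideal.span (Set.range x) ^ (p + 1) := by
          obtain ⟨a, ha, b, hb, hab⟩ := Submodule.mem_sup.1 h
          rw [← hab, map_add]
          exact Submodule.add_mem_sup (hQ i p a ha) (derivation_mem_pow (D i) _ _ hb)
        have := sub_mem h3 (Submodule.mem_sup_right (S := Q p) h2)
        rwa [sub_sub_cancel] at this
      have h4 := ih hF.pderiv h1 (α - Finsupp.single i 1)
      rw [coeff_pderiv, tsub_add_cancel_of_le (by
        rw [Finsupp.single_le_iff]; exact Nat.one_le_iff_ne_zero.2 hi)] at h4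
      have h5 : ((α - Finsupp.single i 1 : Fin n →₀ ℕ) i : O) + 1 = (α i : ℕ) := by
        rw [Finsupp.tsub_apply, Finsupp.single_eq_same, ← Nat.cast_succ]
        congr 1
        omega
      rw [h5] at h4
      exact (Ideal.mul_unit_mem_iff_mem _ (hk _ hi)).1 h4
    · rw [hF.coeff_eq_zero hα]
      exact zero_mem _

theorem aeval_mul_of_isHomogeneous {σ : Type*} {Δ : MvPolynomial σ ℤ} {d : ℕ}
    (hΔ : Δ.IsHomogeneous d) (a : O) (c : σ → O) :
    aeval (fun i => a * c i) Δ = a ^ d * aeval c Δ := by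
  rw [Δ.as_sum, map_sum, map_sum, Finset.mul_sum]
  refine Finset.sum_congr rfl fun m hm => ?_
  have h1 : m.degree = d := by
    by_contra h
    exact (mem_support_iff.1 hm) (hΔ.coeff_eq_zero h)
  rw [aeval_monomial, aeval_monomial, Finsupp.prod, Finsupp.prod]
  simp only [mul_pow, Finset.prod_mul_distrib]
  rw [Finset.prod_pow_eq_pow_sum, ← Finsupp.degree_apply, h1]
  ring

theorem aeval_mem_pow_of_isHomogeneous {σ : Type*} {Δ : MvPolynomial σ ℤ} {d : ℕ}
    (hΔ : Δ.IsHomogeneous d) (𝔞 : Ideal O) (c : σ → O) (hc : ∀ i, c i ∈ 𝔞) :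
    aeval c Δ ∈ 𝔞 ^ d := by
  rw [Δ.as_sum, map_sum]
  refine Submodule.sum_mem _ fun m hm => ?_
  have h1 : m.degree = d := by
    by_contra h
    exact (mem_support_iff.1 hm) (hΔ.coeff_eq_zero h)
  rw [aeval_monomial]
  refine Ideal.mul_mem_left _ _ ?_
  rw [← h1, Finsupp.degree_apply, ← Finset.prod_pow_eq_pow_sum]
  exact Ideal.prod_mem_prod fun i _ => Ideal.pow_mem_pow (hc i) _

theorem sup_pow_le (𝔞 I : Ideal O) (d : ℕ) : (𝔞 ⊔ I) ^ d ≤ 𝔞 ^ d ⊔ I := by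
  induction d with
  | zero => simp
  | succ d ih =>
    rw [pow_succ, pow_succ]
    refine (Ideal.mul_mono_left ih).trans ?_
    rw [Ideal.sup_mul, Ideal.mul_sup]
    exact sup_le (sup_le le_sup_left (le_sup_of_le_right (Ideal.mul_le_inf.trans inf_le_right)))
      (le_sup_of_le_right (Ideal.mul_le_inf.trans inf_le_left))

end LocalAlgebra

/-! ### Local coordinates and the discriminant at an ordinary point -/

section Coordinates

open IsLocalRing

variable {n : ℕ} {O : Type*} [CommRing O] [IsLocalRing O]

/-- The local ring has coordinates: elements of the maximal ideal with dual derivations. -/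
def HasCoordinates (N : ℕ) (O : Type*) [CommRing O] [IsLocalRing O] : Prop :=
  ∃ (D : Fin N → Derivation ℤ O O) (y : Fin N → O), (∀ i, y i ∈ maximalIdeal O) ∧
    ∀ i j, D i (y j) - (if i = j then 1 else 0) ∈ maximalIdeal O

theorem isUnit_of_mul_sub_one_mem {a b : O} (h : a * b - 1 ∈ maximalIdeal O) : IsUnit a := by
  by_contra ha
  have h1 : a * b ∈ maximalIdeal O := Ideal.mul_mem_right _ _ ha
  have h2 := sub_mem h1 h
  rw [sub_sub_cancel] at h2
  exact (Ideal.ne_top_iff_one _).1 (maximalIdeal.isMaximal O).ne_top h2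

theorem map_residue_eq_iff {m : Type*} {A B : Matrix m m O} :
    A.map (residue O) = B.map (residue O) ↔ ∀ i j, A i j - B i j ∈ maximalIdeal O := by
  rw [← Matrix.ext_iff]
  refine forall_congr' fun i => forall_congr' fun j => ?_
  rw [Matrix.map_apply, Matrix.map_apply, ← sub_eq_zero, ← map_sub, residue_eq_zero_iff]

/-- Write the given coordinates as combinations of the generators `X`. By the Leibniz rule the
Jacobian matrix of `X` has a right inverse modulo the maximal ideal, so it is invertible, and its
inverse recombines the derivations into dual ones. -/
theorem HasCoordinates.exists_dual {N : ℕ} (h : HasCoordinates N O) (X : Fin N → O)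
    (hX : Ideal.span (Set.range X) = maximalIdeal O) :
    ∃ D : Fin N → Derivation ℤ O O, ∀ i j, D i (X j) = if i = j then 1 else 0 := by
  obtain ⟨D, y, hy, hD⟩ := h
  have hXm : ∀ i, X i ∈ maximalIdeal O := fun i => hX ▸ Ideal.subset_span ⟨i, rfl⟩
  have hB : ∀ k, ∃ b : Fin N → O, ∑ j, b j * X j = y k := fun k => by
    rw [← Ideal.mem_span_range_iff_exists_fun, hX]; exact hy k
  choose B hB using hB
  let J : Matrix (Fin N) (Fin N) O := Matrix.of fun i j => D i (X j)
  have h1 : (J * (Matrix.of B).transpose).map (residue O) = (1 : Matrix _ _ O).map (residue O) := by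
    rw [map_residue_eq_iff]
    intro i k
    have h2 : D i (y k) - ∑ j, J i j * B k j ∈ maximalIdeal O := by
      rw [← hB k, map_sum, ← Finset.sum_sub_distrib]
      refine Submodule.sum_mem _ fun j _ => ?_
      rw [Derivation.leibniz, smul_eq_mul, smul_eq_mul]
      simp only [J, Matrix.of_apply]
      rw [mul_comm (B k j), add_sub_cancel_left]
      exact Ideal.mul_mem_right _ _ (hXm j)
    have h3 := sub_mem (hD i k) h2
    simpa [Matrix.mul_apply, Matrix.one_apply] using h3
  have h2 : IsUnit J.det := by
    have h3 := congrArg Matrix.det h1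
    rw [Matrix.map_one _ (map_zero _) (map_one _), Matrix.det_one, ← RingHom.mapMatrix_apply,
      ← RingHom.map_det, Matrix.det_mul, ← map_one (residue O), ← sub_eq_zero, ← map_sub,
      residue_eq_zero_iff] at h3
    exact isUnit_of_mul_sub_one_mem h3
  refine ⟨fun i => ∑ k, J⁻¹ i k • D k, fun i j => ?_⟩
  have h3 := congrFun (congrFun (Matrix.nonsing_inv_mul J h2) i) j
  rw [Matrix.mul_apply, Matrix.one_apply] at h3
  rw [← h3]
  have h4 : ∀ s : Finset (Fin N), (∑ k ∈ s, J⁻¹ i k • D k) (X j) = ∑ k ∈ s, J⁻¹ i k * J k j := by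
    intro s
    classical
    induction s using Finset.induction_on with
    | empty => simp
    | insert a s ha ih => rw [Finset.sum_insert ha, Finset.sum_insert ha, ← ih]; rfl
  exact h4 _

/-- Take the derivations dual to the system `ℓ, x₁, …, xₙ` and discard the one dual to `ℓ`; the
others annihilate `ℓ` and so respect the restriction to the transversal slice. -/
theorem HasCoordinates.exists_dual_of_sup (h : HasCoordinates (n + 1) O) {x : Fin n → O} {ℓ : O}
    (hx : Ideal.span (Set.range x) ⊔ Ideal.span {ℓ} = maximalIdeal O) :
    ∃ D : Fin n → Derivation ℤ O O, (∀ i j, D i (x j) = if i = j then 1 else 0) ∧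
      ∀ i, D i ℓ = 0 := by
  obtain ⟨D, hD⟩ := h.exists_dual (Fin.cons ℓ x) (by
    rw [Fin.range_cons, Ideal.span_insert, sup_comm, hx])
  refine ⟨fun i => D i.succ, fun i j => ?_, fun i => ?_⟩
  · have := hD i.succ j.succ
    simpa using this
  · have := hD i.succ 0
    simpa using this

open MvPolynomial in
/-- At a point of ordinary transversal type, where the multiplicity is equal to the order along
the curve, the discriminant of the leading form does not vanish. -/
theorem aeval_discriminant_notMem {p D E : ℕ} {O : Type u} [CommRing O] [IsLocalRing O]
    [IsAlgClosed (ResidueField O)] [CharZero (ResidueField O)]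
    (hO : HasCoordinates (n + 1) O) (hk : ∀ k : ℕ, k ≠ 0 → IsUnit (k : O))
    {Δ : MvPolynomial (Expo n p) ℤ} (hΔ : Δ.IsHomogeneous D)
    (hinv : ∀ {S : Type u} [CommRing S] (A : Matrix (Fin n) (Fin n) S) (c : Expo n p → S),
        aeval (subCoeffs A c) Δ = A.det ^ E * aeval c Δ)
    (hsm : ∀ {K : Type u} [Field K] [IsAlgClosed K] [CharZero K] (c : Expo n p → K),
        IsSmoothForm (formOf c) → aeval c Δ ≠ 0)
    {x y : Fin n → O} {ℓ : O}
    (hx : Ideal.span (Set.range x) ⊔ Ideal.span {ℓ} = maximalIdeal O)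
    (hy : Ideal.span (Set.range y) ⊔ Ideal.span {ℓ} = maximalIdeal O)
    {G : MvPolynomial (Fin n) O} (hG : G.IsHomogeneous p)
    (hG1 : eval x G ∉ maximalIdeal O ^ (p + 1))
    {f : O} (hf : Ideal.span {eval x G} = Ideal.span {f}) {q : ℕ} {F : MvPolynomial (Fin n) O}
    (hF : F.IsHomogeneous q)
    (hfF : f - eval y F ∈ maximalIdeal O ^ (q + 1) ⊔ Ideal.span {ℓ})
    (hFs : IsSmoothForm (MvPolynomial.map (residue O) F)) :
    aeval (coeffsOf p G) Δ ∉ maximalIdeal O := by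
  set 𝔪 := maximalIdeal O with h𝔪
  obtain ⟨a, rfl⟩ : ∃ a, f = a * eval x G := by
    have h1 : f ∈ Ideal.span {eval x G} := hf ▸ Ideal.mem_span_singleton_self f
    exact Ideal.mem_span_singleton'.1 h1 |>.imp fun _ h => h.symm
  have ha : IsUnit a := by
    obtain ⟨b, hb⟩ : ∃ b, b * (a * eval x G) = eval x G := by
      have h1 : eval x G ∈ Ideal.span {a * eval x G} := hf ▸ Ideal.mem_span_singleton_self _
      exact Ideal.mem_span_singleton'.1 h1
    by_contra h
    have h1 : a * b ∈ 𝔪 := Ideal.mul_mem_right _ _ h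
    have h2 : IsUnit (1 - a * b) := isUnit_one_sub_self_of_mem_nonunits _ h1
    have h3 : (1 - a * b) * eval x G = 0 := by linear_combination -hb
    rw [h2.mul_right_eq_zero] at h3
    exact hG1 (h3 ▸ zero_mem _)
  obtain ⟨d, hdx, hdℓ⟩ := hO.exists_dual_of_sup hx
  have hxm : Ideal.span (Set.range x) ≤ 𝔪 := hx ▸ le_sup_left
  have hℓm : Ideal.span {ℓ} ≤ 𝔪 := hx ▸ le_sup_right
  -- Restricted to the slice `ℓ = 0`, a form in `x` vanishing beyond its degree has all coefficients
  -- in the maximal ideal.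
  have key : ∀ {r : ℕ} {H : MvPolynomial (Fin n) O}, H.IsHomogeneous r →
      eval x H ∈ 𝔪 ^ (r + 1) ⊔ Ideal.span {ℓ} → ∀ α, coeff α H ∈ 𝔪 := by
    intro r H hH h α
    have h1 := coeff_mem_of_eval_mem hk hdx (Q := fun k => 𝔪 ^ (k + 1) ⊔ Ideal.span {ℓ})
      (fun i k g hg => by
        obtain ⟨u, hu, v, hv, rfl⟩ := Submodule.mem_sup.1 hg
        obtain ⟨w, rfl⟩ := Ideal.mem_span_singleton'.1 hv
        rw [map_add, Derivation.leibniz, hdℓ, smul_zero, zero_add, smul_eq_mul, mul_comm]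
        exact Submodule.add_mem_sup (derivation_mem_pow _ _ _ hu)
          (Ideal.mul_mem_left _ _ (Ideal.mem_span_singleton_self _))) hH
      (Submodule.mem_sup_left h) α
    have h2 : 𝔪 ^ (0 + 1) ⊔ Ideal.span {ℓ} ⊔ Ideal.span (Set.range x) ≤ 𝔪 := by
      rw [zero_add, pow_one]
      exact sup_le (sup_le le_rfl hℓm) hxm
    exact h2 h1
  have hexp : ∀ {u v : Fin n → O}, Ideal.span (Set.range u) ⊔ Ideal.span {ℓ} = 𝔪 →
      Ideal.span (Set.range v) ⊔ Ideal.span {ℓ} = 𝔪 →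
      ∃ (B : Matrix (Fin n) (Fin n) O) (c : Fin n → O), ∀ i, u i = B.mulVec v i + c i * ℓ := by
    intro u v hu hv
    have h1 : ∀ i, ∃ (b : Fin n → O) (c : O), u i = ∑ j, b j * v j + c * ℓ := fun i => by
      have h2 : u i ∈ Ideal.span (Set.range v) ⊔ Ideal.span {ℓ} := by
        rw [hv, ← hu]; exact Submodule.mem_sup_left (Ideal.subset_span ⟨i, rfl⟩)
      obtain ⟨s, hs, t, ht, hst⟩ := Submodule.mem_sup.1 h2
      obtain ⟨b, rfl⟩ := Ideal.mem_span_range_iff_exists_fun.1 hs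
      obtain ⟨c, rfl⟩ := Ideal.mem_span_singleton'.1 ht
      exact ⟨b, c, hst.symm⟩
    choose B c h using h1
    exact ⟨Matrix.of B, c, h⟩
  obtain ⟨B, b, hB⟩ := hexp hy hx
  obtain ⟨C', c', hC⟩ := hexp hx hy
  -- Both `x` and `y` are coordinate systems on the slice. Applying the derivations dual to `x` to
  -- the composite expansion shows that the two transition matrices are inverse to each other modulo
  -- the maximal ideal.
  have hBu : IsUnit (B.map (residue O)).det := by
    have h1 : (C' * B).map (residue O) = (1 : Matrix _ _ O).map (residue O) := by
      rw [map_residue_eq_iff]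
      intro i j
      have h2 : x i - ∑ k, (C' * B) i k * x k ∈ Ideal.span {ℓ} := by
        have h3 : x i - ∑ k, (C' * B) i k * x k = (∑ k, C' i k * b k + c' i) * ℓ := by
          have h4 : (C' * B).mulVec x i = ∑ k, C' i k * (B.mulVec x) k := by
            rw [← Matrix.mulVec_mulVec]; rfl
          have h5 : ∑ k, C' i k * y k = C'.mulVec y i := rfl
          change x i - (C' * B).mulVec x i = _
          rw [h4, hC i, ← h5]
          simp only [hB, mul_add, Finset.sum_add_distrib, add_mul, Finset.sum_mul]
          simp only [mul_assoc]
          ring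
        rw [h3]
        exact Ideal.mul_mem_left _ _ (Ideal.mem_span_singleton_self _)
      obtain ⟨w, hw⟩ := Ideal.mem_span_singleton'.1 h2
      have h3 := congrArg (d j) hw
      rw [Derivation.leibniz, hdℓ, smul_zero, zero_add, map_sub, hdx, map_sum] at h3
      have h4 : ∑ k, d j ((C' * B) i k * x k) - (C' * B) i j ∈ 𝔪 := by
        have h5 : (C' * B) i j = ∑ k, (C' * B) i k * d j (x k) := by
          simp [hdx]
        rw [h5, ← Finset.sum_sub_distrib]
        refine Submodule.sum_mem _ fun k _ => ?_
        rw [Derivation.leibniz, smul_eq_mul, smul_eq_mul, add_sub_cancel_left]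
        exact Ideal.mul_mem_right _ _ (hxm (Ideal.subset_span ⟨k, rfl⟩))
      have h5 : ℓ * d j w ∈ 𝔪 :=
        Ideal.mul_mem_right _ _ (hℓm (Ideal.mem_span_singleton_self _))
      rw [smul_eq_mul] at h3
      rw [h3] at h5
      have h6 := neg_mem (add_mem h5 h4)
      convert! h6 using 1
      rw [Matrix.one_apply]
      simp only [@eq_comm _ j i]
      ring
    refine IsUnit.of_mul_eq_one (C'.map (residue O)).det ?_
    rw [mul_comm, ← Matrix.det_mul, ← Matrix.map_mul, h1, Matrix.map_one _ (map_zero _) (map_one _),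
      Matrix.det_one]
  have hyF : eval y F - eval x (linSub B F) ∈ Ideal.span {ℓ} := by
    rw [eval_linSub, ← Ideal.Quotient.eq, ← eval₂_id, ← eval₂_id, ← coe_eval₂Hom, ← coe_eval₂Hom]
    have h1 : (fun i => Ideal.Quotient.mk (Ideal.span {ℓ}) (y i)) =
        fun i => Ideal.Quotient.mk (Ideal.span {ℓ}) (B.mulVec x i) := by
      funext i
      rw [Ideal.Quotient.eq, hB i, add_sub_cancel_left]
      exact Ideal.mul_mem_left _ _ (Ideal.mem_span_singleton_self _)
    rw [coe_eval₂Hom, coe_eval₂Hom, eval₂_comp_left, eval₂_comp_left]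
    exact congrArg (fun v => eval₂ _ v F) h1
  have hmain : eval x (C a * G) - eval x (linSub B F) ∈ 𝔪 ^ (q + 1) ⊔ Ideal.span {ℓ} := by
    rw [map_mul, eval_C]
    have := add_mem hfF (Submodule.mem_sup_right (S := 𝔪 ^ (q + 1)) hyF)
    rwa [sub_add_sub_cancel] at this
  have hLF := linSub_isHomogeneous B hF
  have haG : (C a * G).IsHomogeneous p := hG.C_mul a
  have hmapF : (MvPolynomial.map (residue O) F) ≠ 0 := hFs.1
  -- If `q < p`, the form `F` would vanish over the residue field. If `p < q`, the coefficients of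
  -- `a G` would lie in the maximal ideal and the multiplicity would exceed `p`.
  have hq : q = p := by
    rcases lt_trichotomy q p with h | h | h
    · exfalso
      have h1 : eval x (linSub B F) ∈ 𝔪 ^ (q + 1) ⊔ Ideal.span {ℓ} := by
        have h2 : eval x (C a * G) ∈ 𝔪 ^ (q + 1) :=
          Ideal.pow_right_mono hxm _ (Ideal.pow_le_pow_right h (eval_mem_pow haG x))
        have := sub_mem (Submodule.mem_sup_left (T := Ideal.span {ℓ}) h2) hmain
        rwa [sub_sub_cancel] at this
      have h3 : MvPolynomial.map (residue O) (linSub B F) = 0 := by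
        ext α
        rw [coeff_map, coeff_zero, residue_eq_zero_iff]
        exact key hLF h1 α
      rw [map_linSub] at h3
      have h4 := congrArg (linSub (B.map (residue O))⁻¹) h3
      rw [← linSub_mul, Matrix.mul_nonsing_inv _ hBu, linSub_one, map_zero] at h4
      exact hmapF h4
    · exact h
    · exfalso
      have h1 : eval x (C a * G) ∈ 𝔪 ^ (p + 1) ⊔ Ideal.span {ℓ} := by
        have h2 : eval x (linSub B F) ∈ 𝔪 ^ (p + 1) :=
          Ideal.pow_right_mono hxm _ (Ideal.pow_le_pow_right h (eval_mem_pow hLF x))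
        have h3 := add_mem (sup_le_sup_right (Ideal.pow_le_pow_right (show p + 1 ≤ q + 1 by omega)) (Ideal.span {ℓ}) hmain)
          (Submodule.mem_sup_left (T := Ideal.span {ℓ}) h2)
        rwa [sub_add_cancel] at h3
      refine hG1 ((Ideal.unit_mul_mem_iff_mem _ ha).1 ?_)
      have h2 : eval x (C a * G) = a * eval x G := by rw [map_mul, eval_C]
      rw [← h2, ← formOf_coeffsOf haG, formOf, map_sum, pow_succ']
      refine Submodule.sum_mem _ fun α _ => ?_
      rw [← mul_one (coeffsOf p (C a * G) α), ← C_mul_monomial, map_mul, eval_C]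
      exact Ideal.mul_mem_mul (key haG h1 α.1)
        (Ideal.pow_right_mono hxm _ (eval_mem_pow (isHomogeneous_monomial 1 α.degree_eq) x))
  subst hq
  have h1 : MvPolynomial.map (residue O) (C a * G) =
      linSub (B.map (residue O)) (MvPolynomial.map (residue O) F) := by
    rw [← map_linSub, ← sub_eq_zero, ← map_sub]
    ext α
    rw [coeff_map, coeff_zero, residue_eq_zero_iff]
    exact key (haG.sub hLF) (by rwa [map_sub]) α
  rw [← residue_eq_zero_iff, ringHom_aeval, ← coeffsOf_map]
  rw [map_mul, map_C] at h1
  intro h0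
  have h2 : aeval (coeffsOf q (C (residue O a) * MvPolynomial.map (residue O) G)) Δ = 0 := by
    have h3 : coeffsOf q (C (residue O a) * MvPolynomial.map (residue O) G) =
        fun α => residue O a * coeffsOf q (MvPolynomial.map (residue O) G) α := by
      funext α; simp [coeffsOf]
    rw [h3]
    refine (aeval_mul_of_isHomogeneous hΔ _ _).trans ?_
    exact (congrArg _ h0).trans (mul_zero _)
  have h3 : coeffsOf q (linSub (B.map (residue O)) (MvPolynomial.map (residue O) F)) =
      subCoeffs (B.map (residue O)) (coeffsOf q (MvPolynomial.map (residue O) F)) := by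
    rw [subCoeffs, formOf_coeffsOf (hF.map _)]
  rw [h1, h3] at h2
  refine mul_ne_zero (pow_ne_zero _ hBu.ne_zero) (hsm _ ?_) ((hinv _ _).symm.trans h2)
  rwa [formOf_coeffsOf (hF.map _)]

end Coordinates

end

section

/-! ### Orders of vanishing as discrete valuations -/

section Order

open IsLocalRing IsDiscreteValuationRing

variable {O : Type*} [CommRing O] [IsLocalRing O] (I : Ideal O)

/-- The ideal `𝔪 ^ j + I` is the preimage of the `j`-th power of the maximal ideal of `O ⧸ I`,
generated by the power of a uniformizer. -/
theorem mem_pow_sup_iff [IsDomain (O ⧸ I)] [IsDiscreteValuationRing (O ⧸ I)] (g : O) (j : ℕ) :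
    g ∈ maximalIdeal O ^ j ⊔ I ↔ (j : ℕ∞) ≤ addVal (O ⧸ I) (Ideal.Quotient.mk I g) := by
  obtain ⟨ϖ, hϖ⟩ := exists_irreducible (O ⧸ I)
  rw [← hϖ.addVal_pow, addVal_le_iff_dvd, ← Ideal.mem_span_singleton, ← Ideal.span_singleton_pow,
    ← hϖ.maximalIdeal_eq, ← map_maximalIdeal_of_surjective _ Ideal.Quotient.mk_surjective,
    ← Ideal.map_pow, ← Ideal.mem_comap,
    Ideal.comap_map_of_surjective _ Ideal.Quotient.mk_surjective, ← RingHom.ker_eq_comap_bot,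
    Ideal.mk_ker]

theorem iSup_mem_pow_sup [IsDomain (O ⧸ I)] [IsDiscreteValuationRing (O ⧸ I)] (g : O) :
    ⨆ (j : ℕ) (_ : g ∈ maximalIdeal O ^ j ⊔ I), (j : ℕ∞) =
      addVal (O ⧸ I) (Ideal.Quotient.mk I g) := by
  simp only [mem_pow_sup_iff]
  refine le_antisymm (iSup₂_le fun j hj => hj) (ENat.forall_natCast_le_iff_le.1 fun j hj => ?_)
  exact le_iSup₂ (f := fun (j : ℕ) (_ : (j : ℕ∞) ≤ addVal (O ⧸ I) (Ideal.Quotient.mk I g)) =>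
    (j : ℕ∞)) j hj

theorem exists_sup_span_eq_maximalIdeal [IsDomain (O ⧸ I)] [IsDiscreteValuationRing (O ⧸ I)] :
    ∃ t : O, I ⊔ Ideal.span {t} = maximalIdeal O ∧ Irreducible (Ideal.Quotient.mk I t) := by
  obtain ⟨ϖ, hϖ⟩ := exists_irreducible (O ⧸ I)
  obtain ⟨t, rfl⟩ := Ideal.Quotient.mk_surjective ϖ
  refine ⟨t, ?_, hϖ⟩
  have hI : I ≤ maximalIdeal O := le_maximalIdeal fun h => by
    exact Ideal.Quotient.nontrivial_iff.1 (inferInstance : Nontrivial (O ⧸ I)) h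
  have h1 : (maximalIdeal O).map (Ideal.Quotient.mk I) = (Ideal.span {t}).map (Ideal.Quotient.mk I) := by
    rw [map_maximalIdeal_of_surjective _ Ideal.Quotient.mk_surjective, hϖ.maximalIdeal_eq,
      Ideal.map_span, Set.image_singleton]
  have h2 := congrArg (Ideal.comap (Ideal.Quotient.mk I)) h1
  rw [Ideal.comap_map_of_surjective _ Ideal.Quotient.mk_surjective,
    Ideal.comap_map_of_surjective _ Ideal.Quotient.mk_surjective, ← RingHom.ker_eq_comap_bot,
    Ideal.mk_ker, sup_eq_left.2 hI] at h2
  rw [h2, sup_comm]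

end Order

/-! ### Germs of functions along the curve -/

section Germs

variable {M : LocallyRingedSpace.{u}} {X Z : Set M}

/-- The germ of a section as a ring homomorphism. -/
abbrev germHom {U : Opens M} (x : M) (hx : x ∈ U) : Sec M U →+* Loc M x :=
  (M.presheaf.germ U x hx).hom

/-- The restriction of a section. -/
abbrev resSec {U V : Opens M} (h : V ≤ U) (s : Sec M U) : Sec M V :=
  (M.presheaf.map (homOfLE h).op).hom s

theorem germAt_resSec {U V : Opens M} (h : V ≤ U) (s : Sec M U) (x : M) (hx : x ∈ V) :
    germAt (resSec h s) x hx = germAt s x (h hx) :=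
  M.presheaf.germ_res_apply (homOfLE h) x hx s

theorem germAt_add {U : Opens M} (s t : Sec M U) (x : M) (hx : x ∈ U) :
    germAt (s + t) x hx = germAt s x hx + germAt t x hx := map_add _ _ _

theorem germAt_sub {U : Opens M} (s t : Sec M U) (x : M) (hx : x ∈ U) :
    germAt (s - t) x hx = germAt s x hx - germAt t x hx := map_sub _ _ _

theorem germAt_mul {U : Opens M} (s t : Sec M U) (x : M) (hx : x ∈ U) :
    germAt (s * t) x hx = germAt s x hx * germAt t x hx := map_mul _ _ _

theorem germAt_pow {U : Opens M} (s : Sec M U) (k : ℕ) (x : M) (hx : x ∈ U) :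
    germAt (s ^ k) x hx = germAt s x hx ^ k := map_pow _ _ _

theorem germAt_one {U : Opens M} (x : M) (hx : x ∈ U) :
    germAt (1 : Sec M U) x hx = 1 := map_one _

theorem exists_sections {ι : Type*} [Finite ι] {z : M} {U : Opens M} (hz : z ∈ U)
    (g : ι → Loc M z) :
    ∃ (V : Opens M) (_ : V ≤ U) (hV : z ∈ V) (s : ι → Sec M V), ∀ i, germAt (s i) z hV = g i := by
  have h0 : ∀ i, ∃ (W : Opens M) (hW : z ∈ W) (s : Sec M W), germAt s z hW = g i :=
    fun i => M.presheaf.exists_germ_eq (g i)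
  choose W hW s hs using h0
  let V : Opens M := ⟨(U : Set M) ∩ ⋂ i, (W i : Set M),
    U.2.inter (isOpen_iInter_of_finite fun i => (W i).2)⟩
  have hV : ∀ i, V ≤ W i := fun i x hx => Set.mem_iInter.1 hx.2 i
  exact ⟨V, fun x hx => hx.1, ⟨hz, Set.mem_iInter.2 hW⟩, fun i => resSec (hV i) (s i),
    fun i => (germAt_resSec _ _ _ _).trans (hs i)⟩

theorem exists_eq_germs {z : M} {U : Opens M} (hz : z ∈ U) {s t : Sec M U}
    (h : germAt s z hz = germAt t z hz) :
    ∃ (V : Opens M) (hV : V ≤ U), z ∈ V ∧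
      ∀ (w : M) (hw : w ∈ V), germAt s w (hV hw) = germAt t w (hV hw) := by
  obtain ⟨V, hzV, i, j, hij⟩ := M.presheaf.germ_eq z hz hz s t h
  refine ⟨V, leOfHom i, hzV, fun w hw => ?_⟩
  have h1 := congrArg (M.presheaf.germ V w hw) hij
  rwa [M.presheaf.germ_res_apply, M.presheaf.germ_res_apply] at h1

theorem exists_isUnit_germs {z : M} {U : Opens M} (hz : z ∈ U) {s : Sec M U}
    (h : IsUnit (germAt s z hz)) :
    ∃ (V : Opens M) (hV : V ≤ U), z ∈ V ∧ ∀ (w : M) (hw : w ∈ V), IsUnit (germAt s w (hV hw)) := by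
  obtain ⟨b, hb⟩ := h.exists_right_inv
  obtain ⟨V, hVU, hzV, t, ht⟩ := exists_sections (ι := Unit) hz fun _ => b
  obtain ⟨W, hWV, hzW, hW⟩ := exists_eq_germs hzV (s := resSec hVU s * t ()) (t := 1) (by
    rw [germAt_mul, germAt_one, germAt_resSec, ht, hb])
  refine ⟨W, hWV.trans hVU, hzW, fun w hw => IsUnit.of_mul_eq_one (germAt (t ()) w (hWV hw)) ?_⟩
  have h1 := hW w hw
  rwa [germAt_mul, germAt_one, germAt_resSec] at h1

theorem le_mult_iff {x : M} {j : ℕ} : (j : ℕ∞) ≤ mult M X x ↔ idealAt M X x ≤ maxI M x ^ j := by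
  refine ⟨fun h => ?_, fun h => le_iSup₂ (f := fun (j : ℕ) (_ : idealAt M X x ≤ maxI M x ^ j) =>
    (j : ℕ∞)) j h⟩
  by_contra h0
  have hj : j ≠ 0 := by rintro rfl; simp at h0
  have h1 : mult M X x ≤ (j - 1 : ℕ) := iSup₂_le fun i hi => by
    have : i < j := by
      by_contra! h2
      exact h0 (hi.trans (Ideal.pow_le_pow_right h2))
    exact_mod_cast Nat.le_sub_one_of_lt this
  have h2 : j ≤ j - 1 := by exact_mod_cast h.trans h1
  omega

theorem mem_idealAt {z : M} {U : Opens M} (hz : z ∈ U) (s : Sec M U)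
    (h : ∀ (w : M) (hw : w ∈ U), w ∈ Z → germAt s w hw ∈ maxI M w) :
    germAt s z hz ∈ idealAt M Z z :=
  ⟨U, hz, s, rfl, h⟩

theorem exists_of_mem_idealAt {z : M} {U : Opens M} (hz : z ∈ U) {s : Sec M U}
    (h : germAt s z hz ∈ idealAt M Z z) :
    ∃ (V : Opens M) (hV : V ≤ U), z ∈ V ∧
      ∀ (w : M) (hw : w ∈ V), w ∈ Z → germAt s w (hV hw) ∈ maxI M w := by
  obtain ⟨W, hW, t, ht, h1⟩ := h
  obtain ⟨V, hV, hzV, h2⟩ := exists_eq_germs (show z ∈ U ⊓ W from ⟨hz, hW⟩)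
    (s := resSec inf_le_left s) (t := resSec inf_le_right t) (by
      rw [germAt_resSec, germAt_resSec]; exact ht.symm)
  refine ⟨V, hV.trans inf_le_left, hzV, fun w hw hwZ => ?_⟩
  have h3 := h2 w hw
  rw [germAt_resSec, germAt_resSec] at h3
  rw [h3]
  exact h1 w _ hwZ

theorem idealAt_le_maxI {z : M} (hz : z ∈ Z) : idealAt M Z z ≤ maxI M z := by
  rintro _ ⟨U, hU, s, rfl, hs⟩
  exact hs z hU hz

/-- The order along `Z` in terms of the valuation of the local ring of `Z`. -/
theorem ordOn_eq {z : M} [IsDomain (Loc M z ⧸ idealAt M Z z)]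
    [IsDiscreteValuationRing (Loc M z ⧸ idealAt M Z z)] (g : Loc M z) :
    ordOn M Z z g = IsDiscreteValuationRing.addVal (Loc M z ⧸ idealAt M Z z)
      (Ideal.Quotient.mk _ g) :=
  iSup_mem_pow_sup _ g

/-- The degree of a principal divisor on `Z` vanishes: if the fractions `a z / b z` agree on `Z`,
then the total order of zero minus pole is zero. -/
def DegreeZero (M : LocallyRingedSpace.{u}) (Z : Set M) : Prop :=
  ∀ (N : {z : M // z ∈ Z ∧ IsClosed {z}} → Opens M) (a b : ∀ z, Sec M (N z)) (D : M →₀ ℤ),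
    (∀ z, z.1 ∈ N z) → (∀ w, D w ≠ 0 → w ∈ Z ∧ IsClosed {w}) →
    (∀ (z) (w : M) (hw : w ∈ N z), w ∈ Z → IsClosed {w} →
      ∃ i j : ℕ, ordOn M Z w (germAt (a z) w hw) = i ∧ ordOn M Z w (germAt (b z) w hw) = j ∧
        D w = (i : ℤ) - (j : ℤ)) →
    (∀ (z z') (w : M) (hw : w ∈ N z) (hw' : w ∈ N z'), w ∈ Z → IsClosed {w} →
      germAt (a z) w hw * germAt (b z') w hw' - germAt (a z') w hw' * germAt (b z) w hw
        ∈ idealAt M Z w) →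
    D.sum (fun _ m => m) = 0

/-- The facts on a smooth space `M` of dimension `N` and a complete curve `Z` in it from which the
bound follows. -/
structure IsSmoothAlong (M : LocallyRingedSpace.{u}) (N : ℕ) (Z : Set M) : Prop where
  isUnit_natCast : ∀ z ∈ Z, IsClosed {z} → ∀ k : ℕ, k ≠ 0 → IsUnit (k : Loc M z)
  isAlgClosed : ∀ z ∈ Z, IsClosed {z} → IsAlgClosed (IsLocalRing.ResidueField (Loc M z))
  coordinates : ∀ z ∈ Z, IsClosed {z} → HasCoordinates N (Loc M z)
  dense : ∀ (U : Opens M) (s : Sec M U),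
    (∀ (w : M) (hw : w ∈ U), w ∈ Z → IsClosed {w} → germAt s w hw ∈ maxI M w) →
    ∀ (w : M) (hw : w ∈ U), w ∈ Z → germAt s w hw ∈ maxI M w

/-- A function vanishing at all but finitely many points of the curve near `z` vanishes on it. -/
theorem germAt_mem_idealAt {N : ℕ} (hM : IsSmoothAlong M N Z) {z : M} (hz : z ∈ Z)
    (hzc : IsClosed {z}) [IsDomain (Loc M z ⧸ idealAt M Z z)]
    [IsDiscreteValuationRing (Loc M z ⧸ idealAt M Z z)] {B : Set M} (hB : B.Finite)
    (hBc : ∀ w ∈ B, IsClosed {w}) {U : Opens M} (hzU : z ∈ U) (g : Sec M U)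
    (hg : ∀ (w : M) (hw : w ∈ U), w ∈ Z → IsClosed {w} → w ∉ B → w ≠ z →
      germAt g w hw ∈ maxI M w) :
    germAt g z hzU ∈ idealAt M Z z := by
  set I := idealAt M Z z
  obtain ⟨t, htm, ht⟩ := exists_sup_span_eq_maximalIdeal I
  by_contra hgI
  have hg0 : Ideal.Quotient.mk I (germAt g z hzU) ≠ 0 := by
    rwa [Ne, Ideal.Quotient.eq_zero_iff_mem]
  obtain ⟨k, ⟨ū, hu⟩⟩ := IsDiscreteValuationRing.associated_pow_irreducible hg0 ht
  obtain ⟨u, huū⟩ := Ideal.Quotient.mk_surjective (ū : Loc M z ⧸ I)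
  have hI : I ≤ maxI M z := idealAt_le_maxI hz
  have hu' : IsUnit u := by
    by_contra h
    have h1 : u ∈ I ⊔ Ideal.span {t} := htm ▸ h
    have h2 : (I ⊔ Ideal.span {t}).map (Ideal.Quotient.mk I) = Ideal.span {Ideal.Quotient.mk I t} := by
      rw [Ideal.map_sup, Ideal.map_quotient_self, bot_sup_eq, Ideal.map_span, Set.image_singleton]
    have h3 := Ideal.mem_map_of_mem (Ideal.Quotient.mk I) h1
    rw [h2, huū, Ideal.mem_span_singleton] at h3
    exact ht.not_isUnit (isUnit_of_dvd_unit h3 ū.isUnit)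
  -- If `g` were nonzero on the curve at `z`, it would be a unit times a power of a parameter `t`
  -- modulo the ideal of the curve.
  let r : Loc M z := germAt g z hzU * u - t ^ k
  have hr : r ∈ I := by
    rw [← Ideal.Quotient.eq_zero_iff_mem, map_sub, map_mul, huū, hu, map_pow, sub_self]
  obtain ⟨V, hVU, hzV, s, hs⟩ := exists_sections (ι := Fin 3) hzU ![u, t, r]
  obtain ⟨V₁, hV₁, hz₁, h₁⟩ := exists_isUnit_germs hzV (s := s 0) (by rw [hs]; exact hu')
  obtain ⟨V₂, hV₂, hz₂, h₂⟩ := exists_of_mem_idealAt (Z := Z) hzV (s := s 2) (by rw [hs]; exact hr)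
  obtain ⟨V₃, hV₃, hz₃, h₃⟩ := exists_eq_germs hzV (s := s 2)
    (t := resSec hVU g * s 0 - s 1 ^ k) (by
      rw [germAt_sub, germAt_mul, germAt_pow, germAt_resSec, hs, hs, hs]; rfl)
  have hBo : IsClosed (B \ {z}) := by
    rw [← Set.biUnion_of_singleton (B \ {z})]
    exact (hB.subset Set.sdiff_subset).isClosed_biUnion fun w hw => hBc w hw.1
  let W : Opens M := V₁ ⊓ V₂ ⊓ V₃ ⊓ ⟨(B \ {z})ᶜ, hBo.isOpen_compl⟩
  have hzW : z ∈ W := ⟨⟨⟨hz₁, hz₂⟩, hz₃⟩, fun h => h.2 rfl⟩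
  have hWV : W ≤ V := fun w hw => hV₁ hw.1.1.1
  -- After the remaining points of `B` are removed, `g` vanishes at the closed points of the curve
  -- near `z` other than `z`, hence so does a power of `t`, hence `t`. As `t` also vanishes at `z`,
  -- it lies in `I`, although it is a uniformizer.
  have htI : germAt (resSec hWV (s 1)) z hzW ∈ I := by
    refine mem_idealAt hzW _ (hM.dense _ _ fun w hw hwZ hwc => ?_)
    rw [germAt_resSec]
    by_cases hwz : w = z
    · subst hwz
      rw [hs]
      exact htm.le (Submodule.mem_sup_right (Ideal.mem_span_singleton_self t))
    · have hwB : w ∉ B := fun h => hw.2 ⟨h, hwz⟩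
      have h4 := hg w (hVU (hWV hw)) hwZ hwc hwB hwz
      have h5 := h₂ w hw.1.1.2 hwZ
      have h6 := h₃ w hw.1.2
      rw [germAt_sub, germAt_mul, germAt_pow, germAt_resSec] at h6
      have h7 : germAt (s 1) w (hWV hw) ^ k ∈ maxI M w := by
        have h8 := sub_mem (Ideal.mul_mem_right (germAt (s 0) w (hWV hw)) _ h4) h5
        rw [h6, sub_sub_cancel] at h8
        exact h8
      exact Ideal.IsPrime.mem_of_pow_mem inferInstance _ h7
  rw [germAt_resSec, hs] at htI
  exact ht.ne_zero (Ideal.Quotient.eq_zero_iff_mem.2 htI)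

end Germs

end

section

open MvPolynomial

/-! ### Rules for the order along the curve -/

section OrdOn

variable {M : LocallyRingedSpace.{u}} {Z : Set M} {w : M}
  [IsDomain (Loc M w ⧸ idealAt M Z w)] [IsDiscreteValuationRing (Loc M w ⧸ idealAt M Z w)]

theorem ordOn_mul (g h : Loc M w) : ordOn M Z w (g * h) = ordOn M Z w g + ordOn M Z w h := by
  rw [ordOn_eq, ordOn_eq, ordOn_eq, map_mul, IsDiscreteValuationRing.addVal_mul]

theorem ordOn_pow (g : Loc M w) (k : ℕ) : ordOn M Z w (g ^ k) = k • ordOn M Z w g := by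
  rw [ordOn_eq, ordOn_eq, map_pow, IsDiscreteValuationRing.addVal_pow]

theorem ordOn_eq_top_iff {g : Loc M w} : ordOn M Z w g = ⊤ ↔ g ∈ idealAt M Z w := by
  rw [ordOn_eq, IsDiscreteValuationRing.addVal_eq_top_iff, Ideal.Quotient.eq_zero_iff_mem]

theorem ordOn_congr {g h : Loc M w} (hgh : g - h ∈ idealAt M Z w) :
    ordOn M Z w g = ordOn M Z w h := by
  rw [ordOn_eq, ordOn_eq, Ideal.Quotient.eq.2 hgh]

theorem le_ordOn_iff {g : Loc M w} {j : ℕ} :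
    (j : ℕ∞) ≤ ordOn M Z w g ↔ g ∈ maxI M w ^ j ⊔ idealAt M Z w := by
  rw [ordOn_eq, mem_pow_sup_iff]

theorem ordOn_eq_zero_of_notMem (hw : w ∈ Z) {g : Loc M w} (hg : g ∉ maxI M w) :
    ordOn M Z w g = 0 := by
  by_contra h
  refine hg ?_
  have h1 : ((1 : ℕ) : ℕ∞) ≤ ordOn M Z w g := by
    rw [Nat.cast_one]; exact Order.one_le_iff_ne_zero.2 h
  rw [le_ordOn_iff, pow_one, sup_eq_left.2 (idealAt_le_maxI hw)] at h1
  exact h1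

end OrdOn

theorem eval_mem_mul_pow {O : Type*} [CommRing O] {n p : ℕ} {F : MvPolynomial (Fin n) O}
    (hF : F.IsHomogeneous p) (x : Fin n → O) {J : Ideal O} (hJ : ∀ α, coeff α F ∈ J) :
    eval x F ∈ J * Ideal.span (Set.range x) ^ p := by
  rw [F.as_sum, map_sum]
  refine Submodule.sum_mem _ fun α hα => ?_
  have h1 : α.degree = p := by
    by_contra h
    exact (mem_support_iff.1 hα) (hF.coeff_eq_zero h)
  have h2 : eval x (monomial α (coeff α F)) = coeff α F * eval x (monomial α (1 : O)) := by
    rw [eval_monomial, eval_monomial, one_mul]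
  rw [h2]
  exact Ideal.mul_mem_mul (hJ α) (eval_mem_pow (isHomogeneous_monomial (1 : O) h1) x)

/-! ### Expansion of an equation in the equations of the curve -/

section Curve

variable {M : LocallyRingedSpace.{u}} {X Z : Set M} {n p : ℕ}

/-- Expansion of a function in a power of the ideal of `Z` as a form in equations of `Z`. -/
theorem exists_form_expansion {z : M} {U : Opens M} (hz : z ∈ U) (f : Sec M U)
    (x : Fin n → Sec M U)
    (hf : germAt f z hz ∈ Ideal.span (Set.range fun i => germAt (x i) z hz) ^ p) :
    ∃ (V : Opens M) (hV : V ≤ U) (_ : z ∈ V) (c : Expo n p → Sec M V),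
      ∀ (w : M) (hw : w ∈ V), germAt f w (hV hw) =
        eval (fun i => germAt (x i) w (hV hw)) (formOf fun α => germAt (c α) w hw) := by
  obtain ⟨F, hF, hFf⟩ := (Ideal.mem_span_pow_iff_exists_isHomogeneous _ _).1 hf
  obtain ⟨V, hVU, hzV, c, hc⟩ := exists_sections hz (coeffsOf p F)
  have key : ∀ (w : M) (hw : w ∈ V), germAt (eval (fun i => resSec hVU (x i)) (formOf c)) w hw =
      eval (fun i => germAt (x i) w (hVU hw)) (formOf fun α => germAt (c α) w hw) := by
    intro w hw
    have h1 := MvPolynomial.map_eval (germHom w hw) (fun i => resSec hVU (x i)) (formOf c)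
    rw [map_formOf] at h1
    refine h1.trans ?_
    congr 1
    congr 1
    funext i
    exact germAt_resSec hVU (x i) w hw
  obtain ⟨W, hWV, hzW, hW⟩ := exists_eq_germs hzV (s := resSec hVU f)
    (t := eval (fun i => resSec hVU (x i)) (formOf c)) (by
      rw [germAt_resSec, key, ← hFf]
      congr 1
      simp only [hc]
      rw [← formOf_coeffsOf hF, coeffsOf_formOf])
  refine ⟨W, hWV.trans hVU, hzW, fun α => resSec hWV (c α), fun w hw => ?_⟩
  have h2 := hW w hw
  rw [germAt_resSec, key] at h2
  rw [h2]
  simp only [germAt_resSec]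

theorem IsSmoothAlong.exists_dual (hM : IsSmoothAlong M (n + 1) Z) {w : M} (hw : w ∈ Z)
    (hc : IsClosed {w}) [IsDomain (Loc M w ⧸ idealAt M Z w)]
    [IsDiscreteValuationRing (Loc M w ⧸ idealAt M Z w)] {x : Fin n → Loc M w}
    (hx : idealAt M Z w = Ideal.span (Set.range x)) :
    ∃ D : Fin n → Derivation ℤ (Loc M w) (Loc M w), ∀ i j, D i (x j) = if i = j then 1 else 0 := by
  obtain ⟨t, ht, -⟩ := exists_sup_span_eq_maximalIdeal (idealAt M Z w)
  rw [hx] at ht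
  obtain ⟨D, hD, -⟩ := (hM.coordinates w hw hc).exists_dual_of_sup ht
  exact ⟨D, hD⟩

/-- A function of order at least `p` at almost all points of the curve lies in the `p`-th power
of its ideal. -/
theorem germAt_mem_pow (hM : IsSmoothAlong M (n + 1) Z) (hZ : IsSmoothCurve M Z) {z : M}
    (hz : z ∈ Z) (hzc : IsClosed {z}) {B : Set M} (hB : B.Finite) (hBc : ∀ w ∈ B, IsClosed {w})
    {U : Opens M} (hzU : z ∈ U) (f : Sec M U) (x : Fin n → Sec M U)
    (hx : ∀ (w : M) (hw : w ∈ U),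
      idealAt M Z w = Ideal.span (Set.range fun i => germAt (x i) w hw))
    (hf : ∀ (w : M) (hw : w ∈ U), w ∈ Z → IsClosed {w} → w ∉ B →
      germAt f w hw ∈ maxI M w ^ p) :
    germAt f z hzU ∈ idealAt M Z z ^ p := by
  obtain ⟨i1, i2⟩ := hZ.2 z hz hzc
  suffices H : ∀ j ≤ p, germAt f z hzU ∈ idealAt M Z z ^ j from H p le_rfl
  intro j
  induction j with
  | zero => intro; simp
  | succ j ih =>
    intro hj
    have h1 := ih (by omega)
    rw [hx z hzU] at h1
    obtain ⟨V, hVU, hzV, c, hc⟩ := exists_form_expansion hzU f x h1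
    -- At a generic point `w` the function has order at least `p`, hence more than the degree `j` of
    -- the form, so the coefficients vanish at `w`. Vanishing at all but finitely many closed
    -- points, they vanish on the curve.
    have h2 : ∀ α, germAt (c α) z hzV ∈ idealAt M Z z := by
      intro α
      refine germAt_mem_idealAt hM hz hzc hB hBc hzV (c α) fun w hw hwZ hwc hwB _ => ?_
      obtain ⟨i3, i4⟩ := hZ.2 w hwZ hwc
      obtain ⟨D, hD⟩ := hM.exists_dual hwZ hwc (hx w (hVU hw))
      have h3 := coeff_mem_of_eval_mem (hM.isUnit_natCast w hwZ hwc) hD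
        (Q := fun k => maxI M w ^ (k + 1)) (fun i k g hg => derivation_mem_pow (D i) _ _ hg)
        (isHomogeneous_formOf fun α => germAt (c α) w hw)
        (Submodule.mem_sup_left (by
          rw [← hc w hw]
          exact Ideal.pow_le_pow_right hj (hf w (hVU hw) hwZ hwc hwB))) α.1
      rw [← hx w (hVU hw), zero_add, pow_one, sup_eq_left.2 (idealAt_le_maxI hwZ)] at h3
      have h4 := congrFun (coeffsOf_formOf fun α => germAt (c α) w hw) α
      rw [← h4]
      exact h3
    rw [hc z hzV, pow_succ', hx z hzU]
    refine eval_mem_mul_pow (isHomogeneous_formOf _) _ fun α => ?_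
    rw [← hx z hzU]
    by_cases hα : α.degree = j
    · have h4 := congrFun (coeffsOf_formOf fun α => germAt (c α) z hzV)
        ⟨α, mem_finsuppAntidiag_univ_iff.2 hα⟩
      change coeff α _ = _ at h4
      rw [h4]
      exact h2 _
    · rw [(isHomogeneous_formOf _).coeff_eq_zero hα]
      exact zero_mem _

/-- Otherwise the condition on the function `1` at the points outside `B` would be void, and `1`
would lie in the ideal of the curve. -/
theorem exists_isClosed_notMem (hM : IsSmoothAlong M (n + 1) Z) (hZ : IsSmoothCurve M Z) {z : M}
    (hz : z ∈ Z) (hzc : IsClosed {z}) {B : Set M} (hB : B.Finite) (hBc : ∀ w ∈ B, IsClosed {w})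
    {U : Opens M} (hzU : z ∈ U) : ∃ w ∈ U, w ∈ Z ∧ IsClosed {w} ∧ w ∉ B := by
  obtain ⟨i1, i2⟩ := hZ.2 z hz hzc
  by_contra! h
  have h1 := germAt_mem_idealAt hM hz hzc hB hBc hzU 1 fun w hw hwZ hwc hwB _ =>
    (hwB (h w hw hwZ hwc)).elim
  rw [germAt_one] at h1
  exact (Ideal.ne_top_iff_one _).1 (IsLocalRing.maximalIdeal.isMaximal _).ne_top
    (idealAt_le_maxI hz h1)

end Curve

end

section

open MvPolynomial

/-! ### The discriminant section and the bound -/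

section Bound

variable {M : LocallyRingedSpace.{u}} {X Z : Set M} {n p : ℕ}

/-- The finitely many closed points of the curve which are not generic. -/
def badSet (M : LocallyRingedSpace.{u}) (n p : ℕ) (X Z : Set M) : Set M :=
  {x | x ∈ Z ∧ IsClosed {x} ∧ mult M X x ≠ p} ∪
    {x | x ∈ Z ∧ IsClosed {x} ∧ ¬ IsOrdinaryAt M n X Z x}

theorem IsOrdinaryAlongCurve.badSet_finite (h : IsOrdinaryAlongCurve M n p X Z) :
    (badSet M n p X Z).Finite :=
  h.generic_mult.union h.generic_ordinary

theorem isClosed_of_mem_badSet {w : M} (hw : w ∈ badSet M n p X Z) : IsClosed {w} :=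
  hw.elim (fun h => h.2.1) fun h => h.2.1

theorem mult_eq_of_notMem_badSet {w : M} (hw : w ∉ badSet M n p X Z) (hwZ : w ∈ Z)
    (hwc : IsClosed {w}) : mult M X w = p := by
  by_contra h
  exact hw (Or.inl ⟨hwZ, hwc, h⟩)

theorem isOrdinaryAt_of_notMem_badSet {w : M} (hw : w ∉ badSet M n p X Z) (hwZ : w ∈ Z)
    (hwc : IsClosed {w}) : IsOrdinaryAt M n X Z w := by
  by_contra h
  exact hw (Or.inr ⟨hwZ, hwc, h⟩)

theorem exists_isClosed_mem (hM : IsSmoothAlong M (n + 1) Z) (hZ : Z.Nonempty) :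
    ∃ z ∈ Z, IsClosed {z} := by
  by_contra! h
  obtain ⟨z, hz⟩ := hZ
  have h1 := hM.dense ⊤ 1 (fun w _ hwZ hwc => (h w hwZ hwc).elim) z trivial hz
  replace h1 : (1 : Loc M z) ∈ maxI M z := germAt_one (U := (⊤ : Opens M)) z trivial ▸ h1
  exact (Ideal.ne_top_iff_one _).1 (IsLocalRing.maximalIdeal.isMaximal _).ne_top h1

theorem IsOrdinaryAlongCurve.two_le (hM : IsSmoothAlong M (n + 1) Z)
    (h : IsOrdinaryAlongCurve M n p X Z) : 2 ≤ p := by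
  obtain ⟨z, hz, hzc⟩ := exists_isClosed_mem hM h.connected.nonempty
  obtain ⟨w, -, hwZ, hwc, hwB⟩ := exists_isClosed_notMem hM h.smoothCurve hz hzc h.badSet_finite
    (fun w => isClosed_of_mem_badSet) (U := ⊤) trivial
  have h1 : w ∈ singularLocus M X := h.eq_singularLocus ▸ hwZ
  have h2 := h1.2
  rw [mult_eq_of_notMem_badSet hwB hwZ hwc] at h2
  exact_mod_cast h2

/-- The equation has order `p` at every closed point of the curve outside the finite bad set, which
determines its order along the curve even at the bad points. -/
theorem IsOrdinaryAlongCurve.germAt_equation_mem (hM : IsSmoothAlong M (n + 1) Z)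
    (h : IsOrdinaryAlongCurve M n p X Z) {z : M} (hz : z ∈ Z) (hzc : IsClosed {z}) {U : Opens M}
    (hzU : z ∈ U) {f : Sec M U} (hf : IsEquation M X U f) {x : Fin n → Sec M U}
    (hx : ∀ (w : M) (hw : w ∈ U),
      idealAt M Z w = Ideal.span (Set.range fun i => germAt (x i) w hw)) :
    germAt f z hzU ∈ idealAt M Z z ^ p := by
  refine germAt_mem_pow hM h.smoothCurve hz hzc h.badSet_finite
    (fun w => isClosed_of_mem_badSet) hzU f x hx fun w hw hwZ hwc hwB => ?_
  have h1 := le_mult_iff.1 (mult_eq_of_notMem_badSet hwB hwZ hwc).ge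
  rw [hf w hw] at h1
  exact h1 (Ideal.mem_span_singleton_self _)

theorem germAt_equation_ne_zero (h : IsHypersurface M X) {z : M} {U : Opens M}
    (hzU : z ∈ U) {f : Sec M U} (hf : IsEquation M X U f) : germAt f z hzU ≠ 0 := by
  intro h0
  obtain ⟨V, hV, g, hg, hg0⟩ := h.2 z
  have h1 := hf z hzU
  rw [h0, Ideal.span_singleton_eq_bot.2 rfl, hg z hV, Ideal.span_singleton_eq_bot] at h1
  exact hg0 z hV h1

theorem charZero_residueField {O : Type*} [CommRing O] [IsLocalRing O]
    (hk : ∀ k : ℕ, k ≠ 0 → IsUnit (k : O)) : CharZero (IsLocalRing.ResidueField O) :=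
  charZero_of_inj_zero fun k h => by
    by_contra h0
    refine ((hk k h0).map (IsLocalRing.residue O)).ne_zero ?_
    rw [map_natCast, h]

/-- The value of the discriminant of the leading form along `Z` of an equation of `X`. -/
structure IsExpansion (M : LocallyRingedSpace.{u}) (n p : ℕ) (X Z : Set M) {w : M}
    (f : Loc M w) (x : Fin n → Loc M w) (c : Expo n p → Loc M w) : Prop where
  equation : idealAt M X w = Ideal.span {f}
  frame : idealAt M Z w = Ideal.span (Set.range x)
  eval_eq : f = eval x (formOf c)

variable {w : M} {f f' : Loc M w} {x x' : Fin n → Loc M w} {c c' : Expo n p → Loc M w}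

theorem IsExpansion.discriminant_notMem (hM : IsSmoothAlong M (n + 1) Z)
    (hwZ : w ∈ Z) (hwc : IsClosed {w}) (hwB : w ∉ badSet M n p X Z)
    (he : IsExpansion M n p X Z f x c) {Δ : MvPolynomial (Expo n p) ℤ} {D E : ℕ}
    (hΔ : Δ.IsHomogeneous D)
    (hinv : ∀ {S : Type u} [CommRing S] (A : Matrix (Fin n) (Fin n) S) (c : Expo n p → S),
        aeval (subCoeffs A c) Δ = A.det ^ E * aeval c Δ)
    (hsm : ∀ {K : Type u} [Field K] [IsAlgClosed K] [CharZero K] (c : Expo n p → K),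
        IsSmoothForm (formOf c) → aeval c Δ ≠ 0) :
    aeval c Δ ∉ maxI M w := by
  obtain ⟨-, ℓ, g, y, q, F, h1, h2, h3, h4, h5, h6⟩ := isOrdinaryAt_of_notMem_badSet hwB hwZ hwc
  have := hM.isAlgClosed w hwZ hwc
  have hk := hM.isUnit_natCast w hwZ hwc
  have := charZero_residueField hk
  have h7 := aeval_discriminant_notMem (hM.coordinates w hwZ hwc) hk hΔ hinv hsm (x := x) (y := y)
    (ℓ := ℓ) (by rw [← he.frame]; exact h1) h3 (isHomogeneous_formOf c) (by
      rw [← he.eval_eq]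
      intro h8
      have h9 : ((p + 1 : ℕ) : ℕ∞) ≤ mult M X w := by
        rw [le_mult_iff, he.equation, Ideal.span_singleton_le_iff_mem]; exact h8
      rw [mult_eq_of_notMem_badSet hwB hwZ hwc] at h9
      have : p + 1 ≤ p := by exact_mod_cast h9
      omega) (f := g) (by rw [← he.eval_eq, ← he.equation, h2]) h4 h5 h6
  rwa [coeffsOf_formOf] at h7

/-- The leading forms in two frames are related by the linear change of coordinates on `Z`. -/
theorem IsExpansion.subCoeffs_sub_mem (hM : IsSmoothAlong M (n + 1) Z) (hZ : IsSmoothCurve M Z)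
    (hwZ : w ∈ Z) (hwc : IsClosed {w}) (he : IsExpansion M n p X Z f x c)
    (he' : IsExpansion M n p X Z f' x' c') {u : Loc M w} (hu : f' = u * f)
    {A : Matrix (Fin n) (Fin n) (Loc M w)} (hA : x' = A.mulVec x) (α : Expo n p) :
    subCoeffs A c' α - u * c α ∈ idealAt M Z w := by
  obtain ⟨i3, i4⟩ := hZ.2 w hwZ hwc
  obtain ⟨D, hD⟩ := hM.exists_dual hwZ hwc he.frame
  have h0 : formOf (fun α => subCoeffs A c' α - u * c α) =
      formOf (subCoeffs A c') - C u * formOf c := by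
    simp only [formOf, Finset.mul_sum, C_mul_monomial, ← Finset.sum_sub_distrib, map_sub]
  have h3 := coeff_mem_of_eval_mem (hM.isUnit_natCast w hwZ hwc) hD
    (Q := fun _ => ⊥) (fun i k g hg => by rw [Ideal.mem_bot] at hg ⊢; rw [hg, map_zero])
    (isHomogeneous_formOf fun α => subCoeffs A c' α - u * c α)
    (by
      have h4 : eval x (formOf fun α => subCoeffs A c' α - u * c α) = 0 := by
        rw [h0, map_sub, map_mul, eval_C, formOf_subCoeffs, eval_linSub, ← he.eval_eq, ← hA,
          ← he'.eval_eq, hu, sub_self]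
      rw [h4]
      exact zero_mem _) α.1
  rw [bot_sup_eq, ← he.frame] at h3
  have h4 := congrFun (coeffsOf_formOf fun α => subCoeffs A c' α - u * c α) α
  rw [← h4]
  exact h3

/-- Modulo the ideal of `Z` the form `c'` after the substitution `A` is `u` times `c`. This is the
cocycle of `[X]^D ⊗ (det N)^(-E)`. -/
theorem IsExpansion.discriminant_transition (hM : IsSmoothAlong M (n + 1) Z)
    (hZ : IsSmoothCurve M Z) (hwZ : w ∈ Z) (hwc : IsClosed {w})
    (he : IsExpansion M n p X Z f x c) (he' : IsExpansion M n p X Z f' x' c') {u : Loc M w}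
    (hu : f' = u * f) {A : Matrix (Fin n) (Fin n) (Loc M w)} (hA : x' = A.mulVec x)
    {Δ : MvPolynomial (Expo n p) ℤ} {D E : ℕ} (hΔ : Δ.IsHomogeneous D)
    (hinv : ∀ {S : Type u} [CommRing S] (A : Matrix (Fin n) (Fin n) S) (c : Expo n p → S),
        aeval (subCoeffs A c) Δ = A.det ^ E * aeval c Δ) :
    A.det ^ E * aeval c' Δ - u ^ D * aeval c Δ ∈ idealAt M Z w := by
  rw [← hinv, ← aeval_mul_of_isHomogeneous hΔ, ← Ideal.Quotient.eq_zero_iff_mem, map_sub]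
  rw [sub_eq_zero]
  refine (ringHom_aeval _ _ _).trans (Eq.trans ?_ (ringHom_aeval _ _ _).symm)
  congr 2
  funext α
  rw [Ideal.Quotient.eq]
  exact he.subCoeffs_sub_mem hM hZ hwZ hwc he' hu hA α

/-- The equation lies in `𝔪 ^ (p + r)`, and `p` differentiations cost at most `p` in the order, so
the coefficients lie in `𝔪 ^ r` modulo the ideal of `Z`; the discriminant has degree `D` in them. -/
theorem IsExpansion.le_ordOn_discriminant (hM : IsSmoothAlong M (n + 1) Z)
    (hZ : IsSmoothCurve M Z) (hwZ : w ∈ Z) (hwc : IsClosed {w})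
    (he : IsExpansion M n p X Z f x c) {r : ℕ} (hr : mult M X w = (p + r : ℕ))
    {Δ : MvPolynomial (Expo n p) ℤ} {D : ℕ} (hΔ : Δ.IsHomogeneous D) :
    ((D * r : ℕ) : ℕ∞) ≤ ordOn M Z w (aeval c Δ) := by
  obtain ⟨i3, i4⟩ := hZ.2 w hwZ hwc
  obtain ⟨d, hd⟩ := hM.exists_dual hwZ hwc he.frame
  rw [le_ordOn_iff]
  have h1 : ∀ α, c α ∈ maxI M w ^ r ⊔ idealAt M Z w := fun α => by
    have h3 := coeff_mem_of_eval_mem (hM.isUnit_natCast w hwZ hwc) hd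
      (Q := fun k => maxI M w ^ (k + r)) (fun i k g hg => derivation_mem_pow (d i) _ _ (by
        rw [add_right_comm] at hg; exact hg))
      (isHomogeneous_formOf c) (Submodule.mem_sup_left (by
        rw [← he.eval_eq]
        have h2 := le_mult_iff.1 hr.ge
        rw [he.equation] at h2
        exact h2 (Ideal.mem_span_singleton_self _))) α.1
    rw [← he.frame, zero_add] at h3
    have h4 := congrFun (coeffsOf_formOf c) α
    rw [← h4]
    exact h3
  have h2 := sup_pow_le _ _ _ (aeval_mem_pow_of_isHomogeneous hΔ _ c h1)
  rwa [← pow_mul, mul_comm] at h2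

/-- A finite sum bound extracted from the vanishing of the degree of `m - D * DX + E * DN`. -/
theorem sum_le_of_degree_eq_zero {ι : Type*} {D E n p : ℕ} (hD : 0 < D) (hn : 0 < n)
    (hDE : p * D = n * E) (DX DN ρ : ι →₀ ℤ) (m : ι → ℕ)
    (hρ : ∀ w, ρ w = m w - D * DX w + E * DN w) (h0 : ρ.sum (fun _ k => k) = 0)
    (S : Finset ι) (r : ι → ℕ) (hr : ∀ o ∈ S, D * r o ≤ m o) :
    ∑ o ∈ S, (r o : ℚ) ≤ ((DX.sum fun _ k => k : ℤ) : ℚ) -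
      (p : ℚ) / (n : ℚ) * ((DN.sum fun _ k => k : ℤ) : ℚ) := by
  classical
  let T := S ∪ DX.support ∪ DN.support ∪ ρ.support
  have e : ∀ d : ι →₀ ℤ, d.support ⊆ T → d.sum (fun _ k => k) = ∑ w ∈ T, d w := fun d hd =>
    Finsupp.sum_of_support_subset _ hd _ fun _ _ => rfl
  have hX := e DX fun w hw => by simp only [T, Finset.mem_union]; tauto
  have hN := e DN fun w hw => by simp only [T, Finset.mem_union]; tauto
  have hR := e ρ fun w hw => by simp only [T, Finset.mem_union]; tauto
  rw [h0] at hR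
  simp only [hρ, Finset.sum_add_distrib, Finset.sum_sub_distrib, ← Finset.mul_sum] at hR
  rw [← hX, ← hN] at hR
  have h1 : ∑ o ∈ S, D * r o ≤ ∑ o ∈ T, m o := (Finset.sum_le_sum hr).trans
    (Finset.sum_le_sum_of_subset fun w hw => by simp only [T, Finset.mem_union]; tauto)
  rw [← Finset.mul_sum] at h1
  have h2 : (D : ℚ) * ∑ o ∈ S, (r o : ℚ) ≤ ∑ o ∈ T, (m o : ℚ) := by exact_mod_cast h1
  have h3 : (0 : ℚ) = ∑ o ∈ T, (m o : ℚ) - D * ((DX.sum fun _ k => k : ℤ) : ℚ) +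
      E * ((DN.sum fun _ k => k : ℤ) : ℚ) := by exact_mod_cast hR
  have hD' : (0 : ℚ) < D := by exact_mod_cast hD
  have hn' : (0 : ℚ) < n := by exact_mod_cast hn
  have hDE' : (p : ℚ) * D = n * E := by exact_mod_cast hDE
  have h4 : (p : ℚ) / n = E / D := by
    rw [div_eq_div_iff hn'.ne' hD'.ne', hDE', mul_comm]
  rw [h4]
  refine le_of_mul_le_mul_left ?_ hD'
  rw [mul_sub, ← mul_assoc, mul_div_cancel₀ _ hD'.ne']
  linarith

/-- Multiplying the discriminant section by the `(-D)`-th power of the given section of `[X]` and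
the `E`-th power of the given section of `det N` yields a rational function on `Z`, whose divisor
has degree zero. -/
theorem IsOrdinaryAlongCurve.jumpBound (hM : IsSmoothAlong M (n + 1) Z) (hdeg : DegreeZero M Z)
    (h : IsOrdinaryAlongCurve M n p X Z) : JumpBound M n p X Z := by
  rintro _ _ ⟨DX, ⟨hDX0, UX, eX, a, b, hUX, hab, hX⟩, rfl⟩ ⟨DN, ⟨hDN0, UN, eN, c, d, hUN, hcd, hN⟩, rfl⟩
    S r hS
  have hp := h.two_le hM
  have hZ := h.smoothCurve
  have hn : 0 < n := by
    obtain ⟨z, hz, hzc⟩ := exists_isClosed_mem hM h.connected.nonempty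
    -- For `n = 0` a frame consists of no equations, so the ideal of `Z` would be zero, and with it
    -- the equation of `X`, which lies in a positive power of that ideal.
    rcases Nat.eq_zero_or_pos n with rfl | hn
    · exfalso
      obtain ⟨V, hVU, hzV⟩ : ∃ (V : Opens M) (_ : V ≤ UX ⟨z, hz⟩ ⊓ UN ⟨z, hz⟩), z ∈ V :=
        ⟨_, le_rfl, hUX _, hUN _⟩
      have h1 := h.germAt_equation_mem hM hz hzc (U := V) hzV
        (f := resSec (hVU.trans inf_le_left) (eX ⟨z, hz⟩).1)
        (x := fun i => resSec (hVU.trans inf_le_right) ((eN ⟨z, hz⟩).1 i))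
        (fun w hw => by rw [germAt_resSec]; exact (eX ⟨z, hz⟩).2 w _)
        (fun w hw => by simp only [germAt_resSec]; exact (eN ⟨z, hz⟩).2 w _)
      rw [(eN ⟨z, hz⟩).2 z (hUN ⟨z, hz⟩), Set.range_eq_empty, Ideal.span_empty,
        ← Ideal.zero_eq_bot, zero_pow (by omega), Ideal.zero_eq_bot, Ideal.mem_bot,
        germAt_resSec] at h1
      exact germAt_equation_ne_zero h.hypersurface (hUX ⟨z, hz⟩) (eX ⟨z, hz⟩).2 h1
    · exact hn
  obtain ⟨Δ, D, E, hD, hDE, hΔ, hinv, hsm⟩ := exists_discriminant.{u} hn hp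
  have hdata : ∀ z : {z : M // z ∈ Z ∧ IsClosed {z}},
      ∃ (W : Opens M) (h1 : W ≤ UX ⟨z.1, z.2.1⟩) (h2 : W ≤ UN ⟨z.1, z.2.1⟩) (_ : z.1 ∈ W)
        (κ : Expo n p → Sec M W), ∀ (w : M) (hw : w ∈ W),
        IsExpansion M n p X Z (germAt (eX ⟨z.1, z.2.1⟩).1 w (h1 hw))
          (fun i => germAt ((eN ⟨z.1, z.2.1⟩).1 i) w (h2 hw)) fun α => germAt (κ α) w hw := by
    rintro ⟨z, hz, hzc⟩
    let V := UX ⟨z, hz⟩ ⊓ UN ⟨z, hz⟩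
    have hzV : z ∈ V := ⟨hUX _, hUN _⟩
    have hx : ∀ (w : M) (hw : w ∈ V), idealAt M Z w =
        Ideal.span (Set.range fun i => germAt (resSec (V := V) inf_le_right ((eN ⟨z, hz⟩).1 i)) w hw) :=
      fun w hw => by simp only [germAt_resSec]; exact (eN ⟨z, hz⟩).2 w _
    have h1 := h.germAt_equation_mem hM hz hzc (U := V) hzV
      (f := resSec inf_le_left (eX ⟨z, hz⟩).1)
      (fun w hw => by rw [germAt_resSec]; exact (eX ⟨z, hz⟩).2 w _) hx
    rw [hx z hzV] at h1
    obtain ⟨W, hWV, hzW, κ, hκ⟩ := exists_form_expansion hzV _ _ h1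
    refine ⟨W, hWV.trans inf_le_left, hWV.trans inf_le_right, hzW, κ, fun w hw =>
      ⟨(eX ⟨z, hz⟩).2 w _, (eN ⟨z, hz⟩).2 w _, ?_⟩⟩
    have h2 := hκ w hw
    simp only [germAt_resSec] at h2
    exact h2
  choose W hWX hWN hzW κ hκ using hdata
  let δ : ∀ z, Sec M (W z) := fun z => aeval (κ z) Δ
  have hδ : ∀ (z) (w : M) (hw : w ∈ W z),
      germAt (δ z) w hw = aeval (fun α => germAt (κ z α) w hw) Δ :=
    fun z w hw => ringHom_aeval (germHom w hw) _ _
  -- The given sections are `a / b` of `[X]` and `c / d` of `det N`, so `num / den` is `δ (b / a) ^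
  -- D (c / d) ^ E`, where the transition factors cancel.
  let num : ∀ z, Sec M (W z) := fun z => δ z * resSec (hWX z) (b ⟨z.1, z.2.1⟩) ^ D *
    resSec (hWN z) (c ⟨z.1, z.2.1⟩) ^ E
  let den : ∀ z, Sec M (W z) := fun z => resSec (hWX z) (a ⟨z.1, z.2.1⟩) ^ D *
    resSec (hWN z) (d ⟨z.1, z.2.1⟩) ^ E
  have hnum : ∀ (z) (w : M) (hw : w ∈ W z), germAt (num z) w hw = germAt (δ z) w hw *
      germAt (b ⟨z.1, z.2.1⟩) w (hWX z hw) ^ D * germAt (c ⟨z.1, z.2.1⟩) w (hWN z hw) ^ E :=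
    fun z w hw => by
      simp only [num, germAt_mul, germAt_pow, germAt_resSec]
  have hden : ∀ (z) (w : M) (hw : w ∈ W z), germAt (den z) w hw =
      germAt (a ⟨z.1, z.2.1⟩) w (hWX z hw) ^ D * germAt (d ⟨z.1, z.2.1⟩) w (hWN z hw) ^ E :=
    fun z w hw => by
      simp only [den, germAt_mul, germAt_pow, germAt_resSec]
  have hgen : ∀ (z) (w : M) (hw : w ∈ W z), w ∈ Z → IsClosed {w} → w ∉ badSet M n p X Z →
      germAt (δ z) w hw ∉ maxI M w := fun z w hw hwZ hwc hwB => by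
    rw [hδ]
    exact (hκ z w hw).discriminant_notMem hM hwZ hwc hwB hΔ hinv hsm
  -- Every neighbourhood of `w` contains a generic closed point of the curve, at which the
  -- discriminant is nonzero.
  have hfin : ∀ (z) (w : M) (hw : w ∈ W z), w ∈ Z → IsClosed {w} →
      germAt (δ z) w hw ∉ idealAt M Z w := fun z w hw hwZ hwc hmem => by
    obtain ⟨V, hV, hwV, h1⟩ := exists_of_mem_idealAt hw hmem
    obtain ⟨v, hvV, hvZ, hvc, hvB⟩ := exists_isClosed_notMem hM hZ hwZ hwc h.badSet_finite
      (fun w => isClosed_of_mem_badSet) hwV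
    exact hgen z v (hV hvV) hvZ hvc hvB (h1 v hvV hvZ)
  have hcompat : ∀ (z z') (w : M) (hw : w ∈ W z) (hw' : w ∈ W z'), w ∈ Z → IsClosed {w} →
      germAt (num z) w hw * germAt (den z') w hw' - germAt (num z') w hw' * germAt (den z) w hw
        ∈ idealAt M Z w := by
    intro z z' w hw hw' hwZ hwc
    have h1 := hκ z w hw
    have h2 := hκ z' w hw'
    obtain ⟨v, hv⟩ : ∃ v, v * germAt (eX ⟨z.1, z.2.1⟩).1 w (hWX z hw) =
        germAt (eX ⟨z'.1, z'.2.1⟩).1 w (hWX z' hw') := by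
      rw [← Ideal.mem_span_singleton', ← h1.equation, h2.equation]
      exact Ideal.mem_span_singleton_self _
    have hA : ∀ i, ∃ A : Fin n → Loc M w,
        ∑ j, A j * germAt ((eN ⟨z.1, z.2.1⟩).1 j) w (hWN z hw) =
        germAt ((eN ⟨z'.1, z'.2.1⟩).1 i) w (hWN z' hw') := fun i => by
      rw [← Ideal.mem_span_range_iff_exists_fun, ← h1.frame, h2.frame]
      exact Ideal.subset_span ⟨i, rfl⟩
    choose A hA using hA
    have h3 := h1.discriminant_transition hM hZ hwZ hwc h2 hv.symm (A := A)
      (funext fun i => (hA i).symm) hΔ hinv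
    have h4 := hX ⟨z.1, z.2.1⟩ ⟨z'.1, z'.2.1⟩ w (hWX z hw) (hWX z' hw') v hwZ hv.symm
    have h5 := hN ⟨z.1, z.2.1⟩ ⟨z'.1, z'.2.1⟩ w (hWN z hw) (hWN z' hw') (Matrix.det A) hwZ
      ⟨A, fun i => (hA i).symm, rfl⟩
    rw [hnum, hnum, hden, hden, hδ, hδ]
    rw [← Ideal.Quotient.eq] at h3 h4 h5 ⊢
    simp only [map_mul, map_pow] at h3 h4 h5 ⊢
    generalize Ideal.Quotient.mk (idealAt M Z w) (aeval (fun α => germAt (κ z α) w hw) Δ) = t at *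
    generalize Ideal.Quotient.mk (idealAt M Z w) (aeval (fun α => germAt (κ z' α) w hw') Δ) = t' at *
    generalize Ideal.Quotient.mk (idealAt M Z w) (Matrix.det A) = δA at *
    generalize Ideal.Quotient.mk (idealAt M Z w) v = v' at *
    have h6 := congrArg (· ^ D) h4
    have h7 := congrArg (· ^ E) h5
    simp only [mul_pow] at h6 h7
    linear_combination t * Ideal.Quotient.mk _ (germAt (c ⟨z.1, z.2.1⟩) w (hWN z hw)) ^ E *
        Ideal.Quotient.mk _ (germAt (d ⟨z'.1, z'.2.1⟩) w (hWN z' hw')) ^ E * h6 -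
      t' * Ideal.Quotient.mk _ (germAt (a ⟨z.1, z.2.1⟩) w (hWX z hw)) ^ D *
        Ideal.Quotient.mk _ (germAt (b ⟨z'.1, z'.2.1⟩) w (hWX z' hw')) ^ D * h7 -
      Ideal.Quotient.mk _ (germAt (a ⟨z.1, z.2.1⟩) w (hWX z hw)) ^ D *
        Ideal.Quotient.mk _ (germAt (b ⟨z'.1, z'.2.1⟩) w (hWX z' hw')) ^ D *
        Ideal.Quotient.mk _ (germAt (c ⟨z.1, z.2.1⟩) w (hWN z hw)) ^ E *
        Ideal.Quotient.mk _ (germAt (d ⟨z'.1, z'.2.1⟩) w (hWN z' hw')) ^ E * h3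
  classical
  -- The order of the discriminant section, computed at each point in the chart chosen for that
  -- point; by `hfin` it is finite.
  let m : M → ℕ := fun w =>
    if hw : w ∈ Z ∧ IsClosed {w} then (ordOn M Z w (germAt (δ ⟨w, hw⟩) w (hzW _))).toNat else 0
  have hm : ∀ (w : M) (hw : w ∈ Z ∧ IsClosed {w}),
      ordOn M Z w (germAt (δ ⟨w, hw⟩) w (hzW _)) = m w := fun w hw => by
    obtain ⟨i1, i2⟩ := hZ.2 w hw.1 hw.2
    simp only [m, dif_pos hw]
    exact (ENat.natCast_toNat fun h0 => hfin _ _ _ hw.1 hw.2 (ordOn_eq_top_iff.1 h0)).symm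
  have hm0 : ∀ w, m w ≠ 0 → w ∈ badSet M n p X Z ∧ w ∈ Z ∧ IsClosed {w} := fun w hw => by
    have hwZ : w ∈ Z ∧ IsClosed {w} := by
      by_contra h0
      exact hw (dif_neg h0)
    obtain ⟨i1, i2⟩ := hZ.2 w hwZ.1 hwZ.2
    refine ⟨?_, hwZ⟩
    by_contra h0
    have h1 := hm w hwZ
    rw [ordOn_eq_zero_of_notMem hwZ.1 (hgen _ _ _ hwZ.1 hwZ.2 h0)] at h1
    exact hw (by exact_mod_cast h1.symm)
  -- The divisor of `num / den`. Its support is finite because the discriminant vanishes only at bad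
  -- points.
  let ρ : M →₀ ℤ := Finsupp.ofSupportFinite (fun w => m w - D * DX w + E * DN w) (by
    refine (h.badSet_finite.union (DX.support ∪ DN.support).finite_toSet).subset fun w hw => ?_
    by_contra h0
    simp only [Set.mem_union, Finset.mem_coe, Finset.mem_union, Finsupp.mem_support_iff,
      not_or, not_not] at h0
    refine hw ?_
    have h1 : m w = 0 := by
      by_contra h1
      exact h0.1 (hm0 w h1).1
    simp [h1, h0.2.1, h0.2.2])
  have hρ : ∀ w, ρ w = m w - D * DX w + E * DN w := fun w => rfl
  have hord : ∀ (z) (w : M) (hw : w ∈ W z) (hwZ : w ∈ Z ∧ IsClosed {w}), ∃ i j k : ℕ,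
      ordOn M Z w (germAt (δ z) w hw) = k ∧ ordOn M Z w (germAt (num z) w hw) = i ∧
      ordOn M Z w (germAt (den z) w hw) = j ∧ (k : ℤ) - D * DX w + E * DN w = i - j := by
    intro z w hw hwZ
    obtain ⟨i1, i2⟩ := hZ.2 w hwZ.1 hwZ.2
    obtain ⟨ia, ib, ha, hb, hab'⟩ := hab ⟨z.1, z.2.1⟩ w (hWX z hw) hwZ.1 hwZ.2
    obtain ⟨ic, id', hc, hd, hcd'⟩ := hcd ⟨z.1, z.2.1⟩ w (hWN z hw) hwZ.1 hwZ.2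
    obtain ⟨k, hk⟩ := ENat.ne_top_iff_exists.1 fun h0 =>
      hfin z w hw hwZ.1 hwZ.2 (ordOn_eq_top_iff.1 h0)
    refine ⟨k + D * ib + E * ic, D * ia + E * id', k, hk.symm, ?_, ?_, ?_⟩
    · rw [hnum, ordOn_mul, ordOn_mul, ordOn_pow, ordOn_pow, hb, hc, ← hk]
      push_cast
      simp only [nsmul_eq_mul]
    · rw [hden, ordOn_mul, ordOn_pow, ordOn_pow, ha, hd]
      push_cast
      simp only [nsmul_eq_mul]
    · rw [hab', hcd']
      push_cast
      ring
  have hsum := hdeg W num den ρ hzW (fun w hw => by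
    by_contra h0
    have h1 : m w = 0 := by
      by_contra h1
      exact h0 (hm0 w h1).2
    have h2 : DX w = 0 := by
      by_contra h2
      exact h0 (hDX0 w h2)
    have h3 : DN w = 0 := by
      by_contra h3
      exact h0 (hDN0 w h3)
    exact hw (by rw [hρ, h1, h2, h3]; simp)) (fun z w hw hwZ hwc => by
    obtain ⟨i1, i2⟩ := hZ.2 w hwZ hwc
    obtain ⟨i, j, k, hk, hi, hj, hij⟩ := hord z w hw ⟨hwZ, hwc⟩
    obtain ⟨i', j', k', hk', hi', hj', hij'⟩ := hord ⟨w, hwZ, hwc⟩ w (hzW _) ⟨hwZ, hwc⟩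
    refine ⟨i, j, hi, hj, ?_⟩
    have h1 := ordOn_congr (hcompat z ⟨w, hwZ, hwc⟩ w hw (hzW _) hwZ hwc)
    rw [ordOn_mul, ordOn_mul, hi, hj, hi', hj'] at h1
    have h2 : i + j' = i' + j := by exact_mod_cast h1
    have h3 : k' = m w := by
      have h4 := hm w ⟨hwZ, hwc⟩
      rw [hk'] at h4
      exact_mod_cast h4
    rw [hρ, ← h3, hij']
    omega) hcompat
  refine sum_le_of_degree_eq_zero hD hn hDE DX DN ρ m hρ hsum S r fun o ho => ?_
  obtain ⟨hoZ, hoc, hor⟩ := hS o ho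
  have h1 := (hκ ⟨o, hoZ, hoc⟩ o (hzW _)).le_ordOn_discriminant hM hZ hoZ hoc hor hΔ
  rw [← hδ, hm o ⟨hoZ, hoc⟩] at h1
  exact_mod_cast h1

end Bound

end

section

/-! ### Coordinates from standard smooth algebras -/

section SmoothAlgebra

open IsLocalRing

open Classical in
-- A basis of differentials of coordinate functions localizes to the local ring, and its dual
-- functionals give the derivations. Subtracting constants moves the coordinates into the maximal
-- ideal without changing their differentials.
theorem hasCoordinates_of_isStandardSmooth {B A O : Type*} [CommRing B] [CommRing A] [CommRing O]
    [IsLocalRing O] [Algebra B A] [Algebra A O] [Algebra B O] [IsScalarTower B A O] {N : ℕ}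
    [Algebra.IsStandardSmoothOfRelativeDimension N B A] (𝔭 : Ideal A) [𝔭.IsPrime]
    [IsLocalization.AtPrime O 𝔭] (h : ∀ a : O, ∃ b : B, a - algebraMap B O b ∈ maximalIdeal O) :
    HasCoordinates N O := by
  obtain ⟨ι, σ, _, _, P, hP⟩ := Algebra.IsStandardSmoothOfRelativeDimension.out (n := N)
    (R := B) (S := A)
  have : Nontrivial A := ⟨0, 1, fun h0 => Ideal.IsPrime.ne_top ‹_›
    ((Ideal.eq_top_iff_one 𝔭).2 (h0 ▸ 𝔭.zero_mem))⟩
  have : Fintype ((Set.range P.map)ᶜ : Set ι) := Fintype.ofFinite _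
  have hcard : Fintype.card ((Set.range P.map)ᶜ : Set ι) = N := by
    have h1 := P.rank_kaehlerDifferential
    rw [rank_eq_card_basis P.basisKaehler, hP] at h1
    exact_mod_cast h1
  let e := (Fintype.equivFinOfCardEq hcard).symm
  let b := P.basisKaehler.ofIsLocalizedModule O 𝔭.primeCompl
    (KaehlerDifferential.map B B A O)
  have hb : ∀ i, b i = KaehlerDifferential.D B O (algebraMap A O (P.val i)) := fun i => by
    rw [Module.Basis.ofIsLocalizedModule_apply, P.basisKaehler_apply, KaehlerDifferential.map_D]
  choose c hc using fun i => h (algebraMap A O (P.val (e i)))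
  refine ⟨fun i => ((b.coord (e i)).compDer (KaehlerDifferential.D B O)).restrictScalars ℤ,
    fun j => algebraMap A O (P.val (e j)) - algebraMap B O (c j), hc, fun i j => ?_⟩
  rw [Derivation.coe_restrictScalars, map_sub, Derivation.map_algebraMap, sub_zero]
  have h1 : (b.coord (e i)).compDer (KaehlerDifferential.D B O) (algebraMap A O (P.val (e j))) =
      b.coord (e i) (b (e j)) := by rw [hb]; rfl
  rw [h1, Module.Basis.coord_apply, b.repr_self, Finsupp.single_apply]
  simp [eq_comm]

end SmoothAlgebra

/-! ### Smooth varieties: local rings at closed points -/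

section Scheme

variable {k : Type u} [Field k] {M : Scheme.{u}}
  (π : M ⟶ Spec (CommRingCat.of k))

/-- The structure of an algebra over the base field on the local rings. -/
def constHom (z : M) : CommRingCat.of k ⟶ M.presheaf.stalk z :=
  Spec.preimage (M.fromSpecStalk z ≫ π)

theorem specMap_constHom (z : M) : Spec.map (constHom π z) = M.fromSpecStalk z ≫ π :=
  Spec.map_preimage _

theorem constHom_eq (z : M) :
    constHom π z = (Scheme.ΓSpecIso (.of k)).inv ≫ π.appTop ≫ M.presheaf.germ ⊤ z trivial := by
  refine Spec.map_injective ?_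
  rw [specMap_constHom, Spec.map_comp, Spec.map_comp, ← Scheme.fromSpecStalk_toSpecΓ]
  simp [← Scheme.toSpecΓ_naturality_assoc]

/-- By the Nullstellensatz the residue field at a closed point is the base field. -/
theorem exists_sub_constHom_mem [IsAlgClosed k] [LocallyOfFiniteType π] {z : M} (hz : IsClosed {z})
    (a : Loc M.toLocallyRingedSpace z) :
    ∃ c : k, a - (constHom π z).hom c ∈ maxI M.toLocallyRingedSpace z := by
  have h1 : constHom π z ≫ M.residue z = (residueFieldIsoBase π z hz).inv := by
    refine Spec.map_injective ?_
    rw [Spec.map_comp, specMap_constHom, SpecMap_residueFieldIsoBase_inv,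
      Scheme.fromSpecResidueField, Category.assoc]
  refine ⟨(residueFieldIsoBase π z hz).hom.hom (M.residue z a), ?_⟩
  rw [← IsLocalRing.residue_eq_zero_iff, map_sub, sub_eq_zero]
  have h2 := congrArg (fun f => f.hom ((residueFieldIsoBase π z hz).hom.hom (M.residue z a))) h1
  have h3 : (residueFieldIsoBase π z hz).inv.hom
    ((residueFieldIsoBase π z hz).hom.hom (M.residue z a)) = M.residue z a :=
    (residueFieldIsoBase π z hz).hom_inv_id_apply _
  exact (h2.trans h3).symm

theorem isAlgClosed_of_surjective [IsAlgClosed k] {K : Type u} [Field K] (f : k →+* K)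
    (hf : Function.Surjective f) : IsAlgClosed K :=
  IsAlgClosed.of_ringEquiv k K (RingEquiv.ofBijective f ⟨f.injective, hf⟩)

theorem isAlgClosed_residueField [IsAlgClosed k] [LocallyOfFiniteType π] {z : M} (hz : IsClosed {z}) :
    IsAlgClosed (IsLocalRing.ResidueField (Loc M.toLocallyRingedSpace z)) :=
  isAlgClosed_of_surjective ((IsLocalRing.residue (Loc M.toLocallyRingedSpace z)).comp
    (constHom π z).hom) fun x => by
    obtain ⟨a, rfl⟩ := IsLocalRing.residue_surjective x
    obtain ⟨c, hc⟩ := exists_sub_constHom_mem π hz a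
    refine ⟨c, ?_⟩
    rw [← IsLocalRing.residue_eq_zero_iff, map_sub, sub_eq_zero] at hc
    exact hc.symm

theorem hasCoordinates_of_smooth [IsAlgClosed k] {N : ℕ} [SmoothOfRelativeDimension N π] {z : M}
    (hz : IsClosed {z}) : HasCoordinates N (Loc M.toLocallyRingedSpace z) := by
  have : Smooth π := SmoothOfRelativeDimension.smooth N π
  obtain ⟨U, hU, V, hV, hzV, e, h⟩ :=
    SmoothOfRelativeDimension.exists_isStandardSmoothOfRelativeDimension (n := N) (f := π) z
  algebraize [(π.appLE U V e).hom, (M.presheaf.germ V z hzV).hom,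
    (M.presheaf.germ V z hzV).hom.comp (π.appLE U V e).hom]
  have := hV.isLocalization_stalk ⟨z, hzV⟩
  refine hasCoordinates_of_isStandardSmooth (B := Γ(Spec (CommRingCat.of k), U)) (A := Γ(M, V))
    (hV.primeIdealOf ⟨z, hzV⟩).asIdeal fun a => ?_
  obtain ⟨c, hc⟩ := exists_sub_constHom_mem π hz a
  refine ⟨((Scheme.ΓSpecIso (.of k)).inv ≫ (Spec (.of k)).presheaf.map (homOfLE le_top).op).hom c, ?_⟩
  have h1 : (Scheme.ΓSpecIso (.of k)).inv ≫ (Spec (.of k)).presheaf.map (homOfLE le_top).op ≫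
      π.appLE U V e ≫ M.presheaf.germ V z hzV = constHom π z := by
    rw [constHom_eq, Scheme.Hom.map_appLE_assoc, Scheme.Hom.appLE, Category.assoc,
      M.presheaf.germ_res]
    rfl
  rw [← h1] at hc
  exact hc

/-- The nonvanishing locus on `Z` is locally closed, and in a Jacobson space a nonempty locally
closed subset contains a closed point. -/
theorem mem_maxI_of_closedPoints [LocallyOfFiniteType π] {Z : Set M} (hZ : IsClosed Z)
    (U : Opens M) (s : Sec M.toLocallyRingedSpace U)
    (h : ∀ (w : M) (hw : w ∈ U), w ∈ Z → IsClosed {w} →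
      germAt s w hw ∈ maxI M.toLocallyRingedSpace w) (w : M) (hw : w ∈ U) (hwZ : w ∈ Z) :
    germAt s w hw ∈ maxI M.toLocallyRingedSpace w := by
  have : JacobsonSpace M := LocallyOfFiniteType.jacobsonSpace π
  by_contra h0
  have h1 : ∀ v, v ∈ M.basicOpen (U := U) s ↔
      ∃ hv : v ∈ U, germAt s v hv ∉ maxI M.toLocallyRingedSpace v := fun v => by
    rw [Scheme.mem_basicOpen'']
    simp
  obtain ⟨v, ⟨hv1, hv2⟩, hv3⟩ := nonempty_inter_closedPoints (Z := (M.basicOpen (U := U) s : Set M) ∩ Z)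
    ⟨w, (h1 w).2 ⟨hw, h0⟩, hwZ⟩ ((M.basicOpen (U := U) s).2.isLocallyClosed.inter hZ.isLocallyClosed)
  obtain ⟨h4, h5⟩ := (h1 v).1 hv1
  exact h5 (h v h4 hv2 hv3)

theorem isSmoothAlong_of_smooth [IsAlgClosed k] [CharZero k] {N : ℕ} [SmoothOfRelativeDimension N π] {Z : Set M}
    (hZ : IsClosed Z) : IsSmoothAlong M.toLocallyRingedSpace N Z := by
  have : Smooth π := SmoothOfRelativeDimension.smooth N π
  refine ⟨fun z hz hzc j hj => ?_, fun z hz hzc => isAlgClosed_residueField π hzc,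
    fun z hz hzc => hasCoordinates_of_smooth π hzc, mem_maxI_of_closedPoints π hZ⟩
  have h1 : IsUnit (j : k) := IsUnit.mk0 _ (Nat.cast_ne_zero.2 hj)
  have h2 := h1.map (constHom π z).hom
  rwa [map_natCast] at h2

end Scheme

end

section

open IsDedekindDomain WithZero

/-! ### Normalised valuations and ramification indices -/

section Valuations

variable {S K : Type*} [CommRing S] [IsDedekindDomain S] [Field K] [Algebra S K]
  [IsFractionRing S K]

/-- A uniformizer `ϖ` of `A` is not a unit, so its valuation is below one. It divides every element
of valuation `exp (-1)`, so its valuation is at least `exp (-1)`. -/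
theorem valuation_eq_exp (v : HeightOneSpectrum S) {A : ValuationSubring K}
    [IsDiscreteValuationRing A] (hA : (v.valuation K).valuationSubring = A) {ϖ : A}
    (hϖ : Irreducible ϖ) (u : Aˣ) (d : ℤ) :
    v.valuation K ((u : A) * (ϖ : K) ^ d) = exp (-d) := by
  have hle : ∀ x : A, v.valuation K x ≤ 1 := fun x =>
    (Valuation.mem_valuationSubring_iff _ _).1 (hA.symm ▸ x.2)
  have hu : v.valuation K (u : A) = 1 := by
    refine le_antisymm (hle _) ?_
    have h1 : ((u : A) : K) * ((u⁻¹ : Aˣ) : A) = 1 := by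
      exact_mod_cast congrArg (Subtype.val) u.mul_inv
    have h2 := congrArg (v.valuation K) h1
    rw [map_mul, map_one] at h2
    calc (1 : ℤᵐ⁰) = v.valuation K (u : A) * v.valuation K ((u⁻¹ : Aˣ) : A) := h2.symm
      _ ≤ v.valuation K (u : A) * 1 := by gcongr; exact hle _
      _ = _ := mul_one _
  have hϖ0 : (ϖ : K) ≠ 0 := fun h => hϖ.ne_zero (Subtype.ext h)
  have hlt : v.valuation K ϖ < 1 := by
    by_contra! h
    refine hϖ.not_isUnit (IsUnit.of_mul_eq_one ⟨(ϖ : K)⁻¹, ?_⟩ (Subtype.ext (mul_inv_cancel₀ hϖ0)))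
    have h1 : (ϖ : K)⁻¹ ∈ (v.valuation K).valuationSubring := by
      rw [Valuation.mem_valuationSubring_iff, map_inv₀]
      exact inv_le_one_of_one_le₀ h
    exact hA.le h1
  have hge : exp (-1 : ℤ) ≤ v.valuation K ϖ := by
    obtain ⟨π, hπ⟩ := v.valuation_exists_uniformizer K
    have hπA : π ∈ A := by
      rw [← hA, Valuation.mem_valuationSubring_iff, hπ]
      rw [← exp_zero, exp_le_exp]; norm_num
    have h1 : ϖ ∣ ⟨π, hπA⟩ := by
      rw [← Ideal.mem_span_singleton, ← hϖ.maximalIdeal_eq, IsLocalRing.mem_maximalIdeal]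
      intro h2
      obtain ⟨b, hb⟩ := h2.exists_right_inv
      have h3 : π * (b : K) = 1 := congrArg Subtype.val hb
      have h4 := congrArg (v.valuation K) h3
      rw [map_mul, map_one, hπ] at h4
      have h5 : exp (-1 : ℤ) * v.valuation K b ≤ exp (-1 : ℤ) * 1 := by gcongr; exact hle b
      rw [h4, mul_one] at h5
      exact absurd h5 (not_le.2 (by rw [← exp_zero, exp_lt_exp]; norm_num))
    obtain ⟨b, hb⟩ := h1
    have h3 : π = (ϖ : K) * b := congrArg Subtype.val hb
    rw [← hπ, h3, map_mul]
    calc _ ≤ v.valuation K ϖ * 1 := by gcongr; exact hle b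
      _ = _ := mul_one _
  have hϖv : v.valuation K ϖ = exp (-1 : ℤ) := by
    refine le_antisymm ?_ hge
    obtain ⟨m, hm⟩ : ∃ m : ℤ, v.valuation K ϖ = exp m :=
      ⟨_, (exp_log ((Valuation.ne_zero_iff _).2 hϖ0)).symm⟩
    rw [hm] at hlt ⊢
    rw [← exp_zero, exp_lt_exp] at hlt
    exact exp_le_exp.2 (by omega)
  rw [map_mul, map_zpow₀, hu, one_mul, hϖv, ← exp_zsmul]
  simp

theorem ramificationIdx_eq_of_valuation {R : Type*} [CommRing R] [IsDomain R] [Algebra R S]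
    [Module.IsTorsionFree R S] (v : HeightOneSpectrum S) {a : R} (ha : a ≠ 0)
    [v.asIdeal.LiesOver (Ideal.span {a})] {e : ℕ}
    (he : v.intValuation (algebraMap R S a) = exp (-(e : ℤ))) :
    v.asIdeal.ramificationIdx R = e := by
  have := v.isPrime
  rw [← Ideal.ramificationIdx'_eq_ramificationIdx (Ideal.span {a}) v.asIdeal
    (by rwa [Ne, Ideal.span_singleton_eq_bot])]
  refine Ideal.ramificationIdx'_spec ?_ ?_ <;>
    rw [Ideal.map_span, Set.image_singleton, Ideal.span_singleton_le_iff_mem,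
      ← v.intValuation_le_pow_iff_mem, he, exp_le_exp]
  push_cast
  omega

end Valuations

/-! ### Counting zeros in a function field of one variable -/

section FunctionField

open Polynomial IntermediateField

variable {k K : Type*} [Field k] [Field K] [Algebra k K]

theorem mem_nonunits_iff_inv_notMem {A : ValuationSubring K} {x : K} :
    x ∈ A.nonunits ↔ x = 0 ∨ x⁻¹ ∉ A := by
  rw [ValuationSubring.mem_nonunits_iff, ← ValuationSubring.valuation_le_one_iff, map_inv₀]
  by_cases hx : x = 0
  · simp [hx]
  · rw [inv_le_one₀ (zero_lt_iff.2 ((Valuation.ne_zero_iff _).2 hx)), not_le]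
    simp [hx]

theorem Valuation.mem_nonunits_valuationSubring_iff {Γ : Type*} [LinearOrderedCommGroupWithZero Γ]
    (w : Valuation K Γ) {x : K} : x ∈ w.valuationSubring.nonunits ↔ w x < 1 := by
  rw [mem_nonunits_iff_inv_notMem, Valuation.mem_valuationSubring_iff, map_inv₀]
  by_cases hx : x = 0
  · simp [hx]
  · rw [inv_le_one₀ (zero_lt_iff.2 ((Valuation.ne_zero_iff _).2 hx)), not_le]
    simp [hx]

theorem isFractionRing_polynomial_adjoin {Φ : K} [Algebra k[X] k⟮Φ⟯]
    (h : ∀ q, algebraMap k[X] k⟮Φ⟯ q = aeval (AdjoinSimple.gen k Φ) q)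
    (hΦ : Transcendental k Φ) : IsFractionRing k[X] k⟮Φ⟯ := by
  have h0 : ∀ q, (algebraMap k[X] k⟮Φ⟯ q : K) = aeval Φ q := fun q => by
    rw [h, ← IntermediateField.algebraMap_apply, ← aeval_algebraMap_apply]; rfl
  have : FaithfulSMul k[X] k⟮Φ⟯ := by
    rw [faithfulSMul_iff_algebraMap_injective]
    intro a b hab
    have h1 := congrArg (Subtype.val) hab
    rw [h0, h0] at h1
    exact transcendental_iff_injective.1 hΦ h1
  refine IsFractionRing.of_field _ _ fun x => ?_
  obtain ⟨r, s, hrs⟩ := (mem_adjoin_simple_iff k (x : K)).1 x.2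
  refine ⟨r, s, Subtype.ext ?_⟩
  rw [hrs, ← h0, ← h0]
  rfl

open Classical in
/-- The number of zeros of a nonconstant function of one variable, counted with multiplicity, is
the degree of the function field over the field generated by it. -/
theorem sum_zeros_eq_finrank [IsAlgClosed k] [CharZero k] {ι : Type*} (O : ι → ValuationSubring K)
    (hinj : Function.Injective O) (hdvr : ∀ i, IsDiscreteValuationRing (O i))
    (hk : ∀ i c, algebraMap k K c ∈ O i)
    (hres : ∀ i, ∀ a ∈ O i, ∃ c, a - algebraMap k K c ∈ (O i).nonunits)
    (hall : ∀ V : ValuationSubring K, (∀ c, algebraMap k K c ∈ V) → V ≠ ⊤ → ∃ i, O i = V)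
    {Φ : K} (hΦ : Transcendental k Φ) [FiniteDimensional k⟮Φ⟯ K] (D : ι → ℤ)
    (hD : ∀ i, ∃ (ϖ : O i) (u : (O i)ˣ), Irreducible ϖ ∧ Φ = (u : O i) * (ϖ : K) ^ D i) :
    ∃ T : Finset ι, (∀ i, i ∈ T ↔ 0 < D i) ∧ ∑ i ∈ T, D i = Module.finrank k⟮Φ⟯ K := by
  let : Algebra k[X] K := (aeval Φ).toRingHom.toAlgebra
  let : Algebra k[X] k⟮Φ⟯ := (aeval (AdjoinSimple.gen k Φ)).toRingHom.toAlgebra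
  have hK : ∀ q, algebraMap k[X] K q = aeval Φ q := fun q => rfl
  have := isFractionRing_polynomial_adjoin (Φ := Φ) (fun q => rfl) hΦ
  have : IsScalarTower k[X] k⟮Φ⟯ K := IsScalarTower.of_algebraMap_eq fun q => by
    rw [hK]
    change _ = algebraMap k⟮Φ⟯ K (aeval (AdjoinSimple.gen k Φ) q)
    rw [← aeval_algebraMap_apply]; rfl
  -- The points where `Φ` vanishes correspond to the primes of this Dedekind ring over `X ↦ Φ`. The
  -- result is the identity `∑ e f = [K : k(Φ)]`, with `e` the order of the zero and `f = 1`.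
  let S := integralClosure k[X] K
  have : IsDedekindDomain S := integralClosure.isDedekindDomain k[X] k⟮Φ⟯ K
  have : IsFractionRing S K := integralClosure.isFractionRing_of_finite_extension k⟮Φ⟯ K
  have : Module.Finite k[X] S := IsIntegralClosure.finite k[X] k⟮Φ⟯ K S
  have : FaithfulSMul k[X] K := by
    rw [faithfulSMul_iff_algebraMap_injective]
    exact transcendental_iff_injective.1 hΦ
  have : Module.IsTorsionFree k[X] S := inferInstance
  have : Module.Free k[X] S := Module.free_of_finite_type_torsion_free'
  let p : Ideal k[X] := Ideal.span {X}
  have hp : p.IsMaximal := PrincipalIdealRing.isMaximal_of_irreducible irreducible_X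
  have hp0 : p ≠ ⊥ := by rw [Ne, Ideal.span_singleton_eq_bot]; exact X_ne_zero
  let : Fintype (p.primesOver S) := Fintype.ofFinite _
  have hsum := Ideal.sum_ramification_inertia_eq_finrank p S
  rw [← IsFractionRing.finrank_eq k[X] k⟮Φ⟯ S K] at hsum
  let v : p.primesOver S → HeightOneSpectrum S := fun P =>
    ⟨P.1, P.2.1, by
      have := P.2.2
      exact Ideal.ne_bot_of_liesOver_of_ne_bot hp0 P.1⟩
  have hΦS : algebraMap S K (algebraMap k[X] S X) = Φ := by
    rw [← IsScalarTower.algebraMap_apply, hK, aeval_X]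
  have hvΦ : ∀ P, (v P).valuation K Φ < 1 := fun P => by
    have := P.2.2
    rw [← hΦS, HeightOneSpectrum.valuation_lt_one_iff_mem]
    have h1 : (X : k[X]) ∈ p := Ideal.mem_span_singleton_self _
    rw [Ideal.over_def P.1 p] at h1
    exact h1
  have hcS : ∀ c : k, algebraMap S K (algebraMap k[X] S (C c)) = algebraMap k K c := fun c => by
    rw [← IsScalarTower.algebraMap_apply, hK, aeval_C]
  have hV : ∀ P, ∃ i, O i = ((v P).valuation K).valuationSubring := fun P => by
    refine hall _ (fun c => ?_) fun h => ?_
    · rw [Valuation.mem_valuationSubring_iff, ← hcS]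
      exact HeightOneSpectrum.valuation_le_one _ _
    · have h1 : Φ⁻¹ ∈ ((v P).valuation K).valuationSubring := h ▸ trivial
      rw [Valuation.mem_valuationSubring_iff, map_inv₀] at h1
      have h2 : (v P).valuation K Φ ≠ 0 := (Valuation.ne_zero_iff _).2 fun h => hΦ (h ▸ isAlgebraic_zero)
      exact absurd (hvΦ P) (not_lt.2 ((inv_le_one₀ (zero_lt_iff.2 h2)).1 h1))
  choose i hi using hV
  have hDi : ∀ P, (v P).valuation K Φ = exp (-D (i P)) := fun P => by
    obtain ⟨ϖ, u, hϖ, h1⟩ := hD (i P)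
    have := hdvr (i P)
    conv_lhs => rw [h1]
    exact valuation_eq_exp (v P) (hi P).symm hϖ u _
  have hpos : ∀ P, 0 < D (i P) := fun P => by
    have h1 := hvΦ P
    rw [hDi, ← exp_zero, exp_lt_exp] at h1
    omega
  have hPmem : ∀ P (s : S), s ∈ P.1 ↔ algebraMap S K s ∈ (O (i P)).nonunits := fun P s => by
    rw [hi, Valuation.mem_nonunits_valuationSubring_iff,
      HeightOneSpectrum.valuation_lt_one_iff_mem]
  have hiinj : Function.Injective i := fun P P' h => by
    refine Subtype.ext (Ideal.ext fun s => ?_)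
    rw [hPmem, hPmem, h]
  -- Since `O j` contains `k` and `Φ` and is integrally closed, it contains `S`; its maximal ideal
  -- contracts to a prime over `X`. The valuation ring of that prime is contained in `O j`, and a
  -- discrete valuation ring has no larger proper valuation ring in `K`.
  have hisurj : ∀ j, 0 < D j → ∃ P, i P = j := fun j hj => by
    have := hdvr j
    have hΦj : Φ ∈ (O j).nonunits := by
      obtain ⟨ϖ, u, hϖ, h1⟩ := hD j
      obtain ⟨d, hd⟩ := Int.eq_ofNat_of_zero_le hj.le
      have h2 : Φ = ((u * ϖ ^ d : O j) : K) := by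
        rw [h1, hd]; push_cast; rw [zpow_natCast]
      rw [h2, ValuationSubring.coe_mem_nonunits_iff]
      refine Ideal.mul_mem_left _ _ (Ideal.pow_mem_of_mem _ ?_ _ (by omega))
      rw [hϖ.maximalIdeal_eq]
      exact Ideal.mem_span_singleton_self _
    have hΦO : Φ ∈ O j := (O j).nonunits_le hΦj
    have hpoly : ∀ q : k[X], aeval Φ q ∈ O j := fun q => by
      induction q using Polynomial.induction_on' with
      | add a b ha hb => rw [map_add]; exact add_mem ha hb
      | monomial n a =>
        rw [aeval_monomial]
        exact mul_mem (hk j a) (pow_mem hΦO n)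
    let φ₀ : k[X] →+* O j := (algebraMap k[X] K).codRestrict (O j).toSubring hpoly
    have hS : ∀ s : S, algebraMap S K s ∈ O j := fun s => by
      have h1 : ((algebraMap (O j) K).comp φ₀).IsIntegralElem (s : K) := s.2
      have h2 : IsIntegral (O j) (s : K) := h1.of_comp
      obtain ⟨y, hy⟩ := IsIntegrallyClosed.isIntegral_iff.1 h2
      rw [show algebraMap S K s = (s : K) from rfl, ← hy]
      exact y.2
    let φ : S →+* O j := (algebraMap S K).codRestrict (O j).toSubring hS
    have hφ : ∀ s, s ∈ (IsLocalRing.maximalIdeal (O j)).comap φ ↔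
        algebraMap S K s ∈ (O j).nonunits := fun s => by
      rw [Ideal.mem_comap, ← ValuationSubring.coe_mem_nonunits_iff]; rfl
    let P : p.primesOver S := ⟨(IsLocalRing.maximalIdeal (O j)).comap φ, inferInstance, ⟨by
      refine hp.eq_of_le (Ideal.IsPrime.ne_top inferInstance) ?_
      rw [Ideal.span_singleton_le_iff_mem, Ideal.mem_comap, hφ, hΦS]
      exact hΦj⟩⟩
    refine ⟨P, hinj ?_⟩
    have := hdvr (i P)
    refine ValuationSubring.eq_of_le_of_ne_top _ (fun x hx => ?_) fun h => ?_
    · rw [hi, Valuation.mem_valuationSubring_iff] at hx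
      obtain ⟨n, d, hnd⟩ := (v P).exists_primeCompl_mul_eq_of_integer x hx
      have h1 : algebraMap S K d ∉ (O j).nonunits := fun h => d.2 ((hφ d).2 h)
      rw [mem_nonunits_iff_inv_notMem, not_or, not_not] at h1
      rw [(eq_mul_inv_iff_mul_eq₀ h1.1).2 hnd]
      exact mul_mem (hS n) h1.2
    · rw [h, mem_nonunits_iff_inv_notMem] at hΦj
      exact hΦj.elim (fun h => hΦ (h ▸ isAlgebraic_zero)) fun h => h trivial
  refine ⟨Finset.univ.image i, fun j => ?_, ?_⟩
  · simp only [Finset.mem_image, Finset.mem_univ, true_and]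
    exact ⟨fun ⟨P, hP⟩ => hP ▸ hpos P, hisurj j⟩
  · rw [Finset.sum_image hiinj.injOn, ← hsum]
    push_cast
    refine Finset.sum_congr rfl fun P _ => ?_
    have hPp := P.2.2
    have hPm : P.1.IsMaximal := (v P).isMaximal
    have h1 : P.1.ramificationIdx k[X] = (D (i P)).toNat := by
      have : (v P).asIdeal.LiesOver (Ideal.span {(X : k[X])}) := hPp
      refine ramificationIdx_eq_of_valuation (v P) (X_ne_zero (R := k)) ?_
      rw [← HeightOneSpectrum.valuation_of_algebraMap (K := K)]
      refine (congrArg ((v P).valuation K) hΦS).trans ?_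
      rw [hDi, Int.toNat_of_nonneg (hpos P).le]
    -- By `hres` every residue class is represented by a constant.
    have h2 : P.1.inertiaDeg k[X] = 1 := by
      rw [Ideal.inertiaDeg_eq_of_isMaximal p P.1]
      let : Field (k[X] ⧸ p) := Ideal.Quotient.field p
      refine finrank_eq_one_iff'.2 ⟨1, one_ne_zero, fun w => ?_⟩
      obtain ⟨s, rfl⟩ := Ideal.Quotient.mk_surjective w
      obtain ⟨c, hc⟩ := hres (i P) (algebraMap S K s) (by
        rw [hi, Valuation.mem_valuationSubring_iff]
        exact HeightOneSpectrum.valuation_le_one _ _)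
      refine ⟨Ideal.Quotient.mk p (C c), ?_⟩
      rw [← hcS, ← map_sub, ← hPmem] at hc
      rw [Algebra.smul_def, mul_one]
      exact ((Ideal.Quotient.eq).2 hc).symm
    rw [h1, h2, Nat.cast_one, mul_one, Int.toNat_of_nonneg (hpos P).le]

end FunctionField

end

section

/-! ### Transcendence degree of the function field of a curve -/

section TranscendenceDegree

open IntermediateField

variable {k A K : Type u} [Field k] [CommRing A] [IsDomain A] [Algebra k A]
  [Algebra.FiniteType k A] [Ring.DimensionLEOne A]

open MvPolynomial in
-- Evaluations at the origin and at the second unit vector both kill the first variable but have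
-- different kernels.
theorem not_isMaximal_span_X {s : ℕ} (hs : 2 ≤ s) :
    ¬ (Ideal.span {X ⟨0, by omega⟩} : Ideal (MvPolynomial (Fin s) k)).IsMaximal := by
  intro h
  have key : ∀ v : Fin s → k, v ⟨0, by omega⟩ = 0 →
      Ideal.span {X ⟨0, by omega⟩} = RingHom.ker (eval v) := fun v hv => by
    refine h.eq_of_le (RingHom.ker_ne_top _) ?_
    rw [Ideal.span_singleton_le_iff_mem, RingHom.mem_ker, eval_X, hv]
  have h0 := key 0 rfl
  rw [key (Pi.single ⟨1, by omega⟩ 1) (by simp)] at h0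
  have h1 : (X ⟨1, by omega⟩ : MvPolynomial (Fin s) k) ∈ RingHom.ker (eval 0) := by
    simp [RingHom.mem_ker]
  rw [← h0, RingHom.mem_ker, eval_X, Pi.single_eq_same] at h1
  exact one_ne_zero h1

/-- Noether normalization: with two or more variables, a prime of `A` over the ideal of one variable
is nonzero, hence maximal, and by integrality its contraction would be maximal. -/
theorem trdeg_le_one : Algebra.trdeg k A ≤ 1 := by
  obtain ⟨s, g, hg, hint⟩ := exists_integral_inj_algHom_of_fg k A
  have hs : s ≤ 1 := by
    by_contra! hs
    let p : Ideal (MvPolynomial (Fin s) k) := Ideal.span {MvPolynomial.X ⟨0, by omega⟩}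
    have hp : p.IsPrime := (Ideal.span_singleton_prime (MvPolynomial.X_ne_zero _)).2
      (MvPolynomial.X_prime)
    algebraize [g.toRingHom]
    have : Algebra.IsIntegral (MvPolynomial (Fin s) k) A := ⟨hint⟩
    have : FaithfulSMul (MvPolynomial (Fin s) k) A :=
      (faithfulSMul_iff_algebraMap_injective _ _).2 hg
    obtain ⟨P, hP, hPp⟩ := Ideal.exists_ideal_over_prime_of_isIntegral_of_isDomain (S := A) p (by
      rw [(RingHom.injective_iff_ker_eq_bot _).1
        (FaithfulSMul.algebraMap_injective (MvPolynomial (Fin s) k) A)]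
      exact bot_le)
    have hP0 : P ≠ ⊥ := by
      rintro rfl
      rw [← RingHom.ker_eq_comap_bot, (RingHom.injective_iff_ker_eq_bot _).1
        (FaithfulSMul.algebraMap_injective (MvPolynomial (Fin s) k) A)] at hPp
      exact MvPolynomial.X_ne_zero _ (Ideal.span_singleton_eq_bot.1 hPp.symm)
    have hPm := Ring.DimensionLEOne.maximalOfPrime hP0 hP
    have := Ideal.isMaximal_comap_of_isIntegral_of_isMaximal (R := MvPolynomial (Fin s) k) P
    rw [hPp] at this
    exact not_isMaximal_span_X hs this
  algebraize [g.toRingHom]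
  have : Algebra.IsIntegral (MvPolynomial (Fin s) k) A := ⟨hint⟩
  have : FaithfulSMul (MvPolynomial (Fin s) k) A :=
    (faithfulSMul_iff_algebraMap_injective _ _).2 hg
  have : IsScalarTower k (MvPolynomial (Fin s) k) A :=
    IsScalarTower.of_algebraMap_eq fun c => (g.commutes c).symm
  rw [← trdeg_add_eq (A := A) k (MvPolynomial (Fin s) k),
    trdeg_eq_zero (R := MvPolynomial (Fin s) k) (A := A), add_zero,
    MvPolynomial.trdeg_of_isDomain]
  simpa using hs

/-- In transcendence degree at most one, `K` is algebraic over `k(Φ)`; being finitely generated as a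
field, it is finite. -/
theorem finiteDimensional_of_transcendental (A : Type u) [CommRing A] [IsDomain A] [Algebra k A]
    [Algebra.FiniteType k A] [Ring.DimensionLEOne A] [Field K] [Algebra k K] [Algebra A K]
    [IsScalarTower k A K] [IsFractionRing A K] {Φ : K} (hΦ : Transcendental k Φ) :
    FiniteDimensional k⟮Φ⟯ K := by
  have h1 : Algebra.trdeg k K ≤ 1 := by
    have : Algebra.IsAlgebraic A K := IsLocalization.isAlgebraic K (nonZeroDivisors A)
    have h2 := trdeg_add_eq (A := K) k A
    rw [trdeg_eq_zero (R := A) (A := K), add_zero] at h2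
    exact h2 ▸ trdeg_le_one
  have h2 : AlgebraicIndependent k (fun _ : Unit => Φ) :=
    algebraicIndependent_unique_type_iff.2 hΦ
  have h3 := (h2.isTranscendenceBasis_of_lift_trdeg_le_of_finite (by simpa using h1)).isAlgebraic_field
  rw [Set.range_const] at h3
  have : Algebra.EssFiniteType A K := Algebra.EssFiniteType.of_isLocalization K (nonZeroDivisors A)
  have : Algebra.EssFiniteType k K := Algebra.EssFiniteType.comp k A K
  have : Algebra.EssFiniteType k⟮Φ⟯ K := Algebra.EssFiniteType.of_comp k k⟮Φ⟯ K
  obtain ⟨t, ht⟩ := IntermediateField.fg_top k⟮Φ⟯ K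
  have h4 := finiteDimensional_adjoin (K := k⟮Φ⟯) (S := (t : Set K))
    fun x _ => (Algebra.IsAlgebraic.isAlgebraic x).isIntegral
  rw [ht] at h4
  exact Module.Finite.equiv (topEquiv (F := k⟮Φ⟯) (E := K)).toLinearEquiv

end TranscendenceDegree

/-! ### Principal divisors in a function field -/

section DegreeOfPrincipal

open IntermediateField

variable {k K : Type*} [Field k] [Field K] [Algebra k K]

theorem zpow_exponent_eq_zero {A : ValuationSubring K} {ϖ : A} (hϖ : Irreducible ϖ) (u : Aˣ)
    {d : ℤ} (h : (u : A) * (ϖ : K) ^ d ∈ A) (h' : ((u : A) * (ϖ : K) ^ d)⁻¹ ∈ A) : d = 0 := by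
  have hu : ((u : A) : K) ≠ 0 := fun h0 => u.ne_zero (Subtype.ext h0)
  have hu' : (((u : A) : K))⁻¹ ∈ A := by
    have h1 : ((u : A) : K) * ((u⁻¹ : Aˣ) : A) = 1 := by
      exact_mod_cast congrArg Subtype.val u.mul_inv
    rw [inv_eq_of_mul_eq_one_right h1]
    exact Subtype.property _
  have hϖ0 : (ϖ : K) ≠ 0 := fun h0 => hϖ.ne_zero (Subtype.ext h0)
  have key : ∀ m : ℕ, ((ϖ : K) ^ m)⁻¹ ∈ A → m = 0 := fun m hm => by
    by_contra h0
    refine hϖ.not_isUnit (isUnit_of_dvd_unit (dvd_pow_self ϖ h0)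
      (IsUnit.of_mul_eq_one ⟨_, hm⟩ (Subtype.ext ?_)))
    exact mul_inv_cancel₀ (pow_ne_zero _ hϖ0)
  obtain ⟨m, rfl | rfl⟩ := d.eq_nat_or_neg
  · rw [mul_inv, zpow_natCast] at h'
    have h1 := mul_mem (u : A).2 h'
    rw [mul_inv_cancel_left₀ hu] at h1
    rw [key m h1, Nat.cast_zero]
  · rw [zpow_neg, zpow_natCast] at h
    have h1 := mul_mem hu' h
    rw [inv_mul_cancel_left₀ hu] at h1
    rw [key m h1, Nat.cast_zero, neg_zero]

open Classical in
/-- The degree of the divisor of a nonzero rational function on a complete curve vanishes. -/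
theorem sum_ord_eq_zero [IsAlgClosed k] [CharZero k] {ι : Type*} (O : ι → ValuationSubring K)
    (hinj : Function.Injective O) (hdvr : ∀ i, IsDiscreteValuationRing (O i))
    (hk : ∀ i c, algebraMap k K c ∈ O i)
    (hres : ∀ i, ∀ a ∈ O i, ∃ c, a - algebraMap k K c ∈ (O i).nonunits)
    (hall : ∀ V : ValuationSubring K, (∀ c, algebraMap k K c ∈ V) → V ≠ ⊤ → ∃ i, O i = V)
    (hfin : ∀ Φ : K, Transcendental k Φ → FiniteDimensional k⟮Φ⟯ K) {Φ : K} (D : ι →₀ ℤ)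
    (hD : ∀ i, ∃ (ϖ : O i) (u : (O i)ˣ), Irreducible ϖ ∧ Φ = (u : O i) * (ϖ : K) ^ D i) :
    D.sum (fun _ m => m) = 0 := by
  by_cases hΦ : Transcendental k Φ
  · have hΦ' : Transcendental k Φ⁻¹ := fun h => hΦ (by simpa using h.inv)
    have := hfin Φ hΦ
    have := hfin Φ⁻¹ hΦ'
    obtain ⟨T, hT, h1⟩ := sum_zeros_eq_finrank O hinj hdvr hk hres hall hΦ D hD
    obtain ⟨T', hT', h2⟩ := sum_zeros_eq_finrank O hinj hdvr hk hres hall hΦ' (fun i => -D i)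
      fun i => by
        obtain ⟨ϖ, u, hϖ, h⟩ := hD i
        refine ⟨ϖ, u⁻¹, hϖ, ?_⟩
        have h3 : ((u : O i) : K) * ((u⁻¹ : (O i)ˣ) : O i) = 1 := by
          exact_mod_cast congrArg Subtype.val u.mul_inv
        rw [h, mul_inv, zpow_neg, inv_eq_of_mul_eq_one_right h3]
    -- The zeros of `Φ⁻¹` are the poles of `Φ`, and both counts are degrees over the same field.
    have h3 : k⟮Φ⁻¹⟯ = k⟮Φ⟯ := by
      refine le_antisymm ?_ ?_ <;> rw [adjoin_simple_le_iff]
      · exact inv_mem (mem_adjoin_simple_self k Φ)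
      · simpa using inv_mem (mem_adjoin_simple_self k Φ⁻¹)
    rw [h3, ← h1, Finset.sum_neg_distrib] at h2
    have h4 : D.support = T ∪ T' := by
      ext i
      rw [Finset.mem_union, hT, hT', Finsupp.mem_support_iff]
      omega
    have h5 : Disjoint T T' := by
      rw [Finset.disjoint_left]
      intro i hi hi'
      rw [hT] at hi
      rw [hT'] at hi'
      omega
    rw [Finsupp.sum, h4, Finset.sum_union h5]
    linarith
  · have halg : IsAlgebraic k Φ := not_not.1 hΦ
    obtain ⟨c, rfl⟩ : ∃ c, algebraMap k K c = Φ := by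
      have := adjoin.finiteDimensional halg.isIntegral
      obtain ⟨c, hc⟩ := (IsAlgClosed.algebraMap_bijective_of_isIntegral (k := k) (K := k⟮Φ⟯)).2
        (AdjoinSimple.gen k Φ)
      exact ⟨c, congrArg Subtype.val hc⟩
    have h0 : D = 0 := by
      ext i
      obtain ⟨ϖ, u, hϖ, h⟩ := hD i
      refine zpow_exponent_eq_zero hϖ u (h ▸ hk i c) ?_
      rw [← h, ← map_inv₀]
      exact hk i c⁻¹
    rw [h0]
    simp

end DegreeOfPrincipal

end

/-! ### The curve as a reduced closed subscheme -/

section ReducedSubscheme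

variable {M : Scheme.{u}} (Z : Closeds M)

/-- The reduced closed subscheme on a closed subset. -/
abbrev redSub : Scheme.{u} := (Scheme.IdealSheafData.vanishingIdeal Z).subscheme

/-- The inclusion of the reduced closed subscheme. -/
abbrev redSubι : redSub Z ⟶ M := (Scheme.IdealSheafData.vanishingIdeal Z).subschemeι

theorem range_redSubι : Set.range (redSubι Z) = Z := by
  rw [Scheme.IdealSheafData.range_subschemeι, Scheme.IdealSheafData.coe_support_vanishingIdeal]

theorem redSubι_mem (c : redSub Z) : redSubι Z c ∈ (Z : Set M) := by
  rw [← range_redSubι]; exact ⟨c, rfl⟩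

theorem mem_vanishingIdeal_iff (U : M.affineOpens) (s : Γ(M, U)) :
    s ∈ (Scheme.IdealSheafData.vanishingIdeal Z).ideal U ↔
      ∀ (w : M) (hw : w ∈ U.1), w ∈ (Z : Set M) →
        germAt (M := M.toLocallyRingedSpace) s w hw ∈ maxI M.toLocallyRingedSpace w := by
  have h1 : ∀ (w : M) (hw : w ∈ U.1),
      germAt (M := M.toLocallyRingedSpace) s w hw ∈ maxI M.toLocallyRingedSpace w ↔
        w ∉ M.basicOpen (U := U.1) s := fun w hw => by
    rw [Scheme.mem_basicOpen _ _ _ hw, IsLocalRing.mem_maximalIdeal, mem_nonunits_iff]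
  have h2 : ∀ p : Spec Γ(M, U), s ∈ p.asIdeal ↔ U.2.fromSpec p ∉ M.basicOpen (U := U.1) s := fun p => by
    have h3 := congrArg (fun V : (Spec Γ(M, U)).Opens => p ∈ V) (U.2.fromSpec_preimage_basicOpen s)
    have h4 : (U.2.fromSpec p ∈ M.basicOpen (U := U.1) s) = (s ∉ p.asIdeal) := h3
    rw [h4, not_not]
  rw [Scheme.IdealSheafData.vanishingIdeal_ideal, PrimeSpectrum.mem_vanishingIdeal]
  constructor
  · intro h w hw hwZ
    have h5 := U.2.fromSpec_primeIdealOf ⟨w, hw⟩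
    rw [h1 w hw]
    have h6 := (h2 _).1 (h (U.2.primeIdealOf ⟨w, hw⟩) (by
      change U.2.fromSpec _ ∈ (Z : Set M)
      rw [h5]; exact hwZ))
    rwa [h5] at h6
  · intro h p hp
    have h3 : U.2.fromSpec p ∈ U.1 := by
      rw [← SetLike.mem_coe, ← U.2.range_fromSpec]; exact ⟨p, rfl⟩
    exact (h2 p).2 ((h1 _ h3).1 (h _ h3 hp))

/-- A germ that dies on the subscheme is represented on an affine neighbourhood by a section of the
vanishing ideal. This identifies the local rings of the subscheme with the quotients by `idealAt`.
-/
theorem ker_stalkMap_redSubι (c : redSub Z) :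
    RingHom.ker ((redSubι Z).stalkMap c).hom =
      idealAt M.toLocallyRingedSpace (Z : Set M) (redSubι Z c) := by
  ext g
  rw [RingHom.mem_ker]
  constructor
  · intro h
    obtain ⟨U, hU, s, rfl⟩ := M.presheaf.exists_germ_eq g
    rw [Scheme.Hom.germ_stalkMap_apply,
      ← map_zero ((redSub Z).presheaf.germ (redSubι Z ⁻¹ᵁ U) c hU).hom] at h
    obtain ⟨V, hcV, i, j, hij⟩ := (redSub Z).presheaf.germ_eq c hU hU _ _ h
    obtain ⟨V', hV', hVV'⟩ := (redSubι Z).isEmbedding.isInducing.isOpen_iff.1 V.2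
    obtain ⟨_, ⟨W, hW, rfl⟩, hcW, hWU⟩ := M.isBasis_affineOpens.exists_subset_of_mem_open
      (show redSubι Z c ∈ (U : Set M) ∩ V' from ⟨hU, by
        have : c ∈ redSubι Z ⁻¹' V' := hVV' ▸ hcV
        exact this⟩) (U.2.inter hV')
    have hWU' : W ≤ U := fun x hx => (hWU hx).1
    have hWV : redSubι Z ⁻¹ᵁ W ≤ V := fun x hx => by
      have : x ∈ redSubι Z ⁻¹' V' := (hWU hx).2
      rw [hVV'] at this; exact this
    have h1 : (redSubι Z).app W (M.presheaf.map (homOfLE hWU').op s) = 0 := by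
      have h2 := congrArg ((redSub Z).presheaf.map (homOfLE hWV).op) hij
      rw [map_zero, map_zero, ← ConcreteCategory.comp_apply, ← Functor.map_comp] at h2
      rw [← ConcreteCategory.comp_apply, Scheme.Hom.naturality]
      exact h2
    have h3 : M.presheaf.map (homOfLE hWU').op s ∈
        (Scheme.IdealSheafData.vanishingIdeal Z).ideal ⟨W, hW⟩ := by
      rw [← Scheme.IdealSheafData.ker_subschemeι_app]; exact h1
    refine ⟨W, hcW, M.presheaf.map (homOfLE hWU').op s, ?_, (mem_vanishingIdeal_iff Z ⟨W, hW⟩ _).1 h3⟩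
    exact M.presheaf.germ_res_apply (homOfLE hWU') _ hcW s
  · rintro ⟨U, hU, s, rfl, hs⟩
    obtain ⟨_, ⟨W, hW, rfl⟩, hcW, hWU⟩ := M.isBasis_affineOpens.exists_subset_of_mem_open hU U.2
    have hWU' : W ≤ U := hWU
    have h3 : M.presheaf.map (homOfLE hWU').op s ∈
        (Scheme.IdealSheafData.vanishingIdeal Z).ideal ⟨W, hW⟩ :=
      (mem_vanishingIdeal_iff Z ⟨W, hW⟩ _).2 fun w hw hwZ => by
        have := hs w (hWU hw) hwZ
        rw [← germAt_resSec (M := M.toLocallyRingedSpace) hWU' s w hw] at this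
        exact this
    rw [← Scheme.IdealSheafData.ker_subschemeι_app, RingHom.mem_ker] at h3
    have h4 := congrArg ((redSub Z).presheaf.germ (redSubι Z ⁻¹ᵁ W) c hcW) h3
    rw [map_zero] at h4
    have h5 := Scheme.Hom.germ_stalkMap_apply (redSubι Z) W c hcW (M.presheaf.map (homOfLE hWU').op s)
    rw [M.presheaf.germ_res_apply] at h5
    exact h5.trans h4

/-- The local rings of the reduced closed subscheme. -/
def stalkRedSub (c : redSub Z) :
    (Loc M.toLocallyRingedSpace (redSubι Z c) ⧸ idealAt M.toLocallyRingedSpace (Z : Set M) (redSubι Z c)) ≃+*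
      (redSub Z).presheaf.stalk c :=
  (Ideal.quotEquivOfEq (ker_stalkMap_redSubι Z c).symm).trans
    (RingHom.quotientKerEquivOfSurjective ((redSubι Z).stalkMap_surjective c))

theorem stalkRedSub_mk (c : redSub Z) (g : Loc M.toLocallyRingedSpace (redSubι Z c)) :
    stalkRedSub Z c (Ideal.Quotient.mk _ g) = (redSubι Z).stalkMap c g := rfl

theorem isClosed_redSubι (c : redSub Z) : IsClosed {redSubι Z c} ↔ IsClosed {c} := by
  rw [← Set.image_singleton, ← (redSubι Z).isClosedEmbedding.isClosed_iff_image_isClosed]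

theorem isReduced_redSub : IsReduced (redSub Z) := by
  have : ∀ c : redSub Z, _root_.IsReduced ((redSub Z).presheaf.stalk c) := fun c => by
    refine ⟨fun a ha => ?_⟩
    obtain ⟨m, hm⟩ := ha
    obtain ⟨g, rfl⟩ := (redSubι Z).stalkMap_surjective c a
    rw [← map_pow] at hm
    have h1 : g ^ m ∈ idealAt M.toLocallyRingedSpace (Z : Set M) (redSubι Z c) := by
      rw [← ker_stalkMap_redSubι]; exact hm
    have h2 : g ∈ idealAt M.toLocallyRingedSpace (Z : Set M) (redSubι Z c) := by
      obtain ⟨U, hU, s, rfl⟩ := M.presheaf.exists_germ_eq g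
      change germAt (M := M.toLocallyRingedSpace) s _ hU ^ m ∈ _ at h1
      rw [← germAt_pow] at h1
      obtain ⟨V, hV, hcV, hs⟩ := exists_of_mem_idealAt hU h1
      refine ⟨V, hcV, resSec hV s, germAt_resSec _ _ _ _, fun w hw hwZ => ?_⟩
      have h3 := hs w hw hwZ
      rw [germAt_pow] at h3
      rw [germAt_resSec]
      exact Ideal.IsPrime.mem_of_pow_mem inferInstance _ h3
    rw [← ker_stalkMap_redSubι] at h2
    exact h2
  exact isReduced_of_isReduced_stalk _

theorem isDiscreteValuationRing_stalk_redSub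
    (hZ : IsSmoothCurve M.toLocallyRingedSpace (Z : Set M)) {c : redSub Z} (hc : IsClosed {c}) :
    ∃ _ : IsDomain ((redSub Z).presheaf.stalk c),
      IsDiscreteValuationRing ((redSub Z).presheaf.stalk c) := by
  obtain ⟨h1, h2⟩ := hZ.2 _ (redSubι_mem Z c) ((isClosed_redSubι Z c).2 hc)
  have : IsDomain ((redSub Z).presheaf.stalk c) :=
    (stalkRedSub Z c).symm.injective.isDomain (stalkRedSub Z c).symm.toRingHom
  exact ⟨this, IsDiscreteValuationRing.RingEquivClass.isDiscreteValuationRing (stalkRedSub Z c)⟩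

theorem associated_stalkMap_redSubι (hZ : IsSmoothCurve M.toLocallyRingedSpace (Z : Set M))
    {c : redSub Z} (hc : IsClosed {c}) {g : Loc M.toLocallyRingedSpace (redSubι Z c)} {j : ℕ}
    (hg : ordOn M.toLocallyRingedSpace (Z : Set M) (redSubι Z c) g = j)
    {ϖ : (redSub Z).presheaf.stalk c} (hϖ : Irreducible ϖ) :
    Associated ((redSubι Z).stalkMap c g) (ϖ ^ j) := by
  obtain ⟨h1, h2⟩ := hZ.2 _ (redSubι_mem Z c) ((isClosed_redSubι Z c).2 hc)
  have hϖ' : Irreducible ((stalkRedSub Z c).symm ϖ) :=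
    (MulEquiv.irreducible_iff (stalkRedSub Z c).symm).2 hϖ
  rw [ordOn_eq, ← hϖ'.addVal_pow] at hg
  have h3 := ((IsDiscreteValuationRing.addVal_eq_iff_associated _ _).1 hg).map (stalkRedSub Z c)
  rwa [stalkRedSub_mk, map_pow, RingEquiv.apply_symm_apply] at h3

end ReducedSubscheme

/-! ### Points of a complete curve -/

section CompleteCurve

variable {k : Type u} [Field k] {C : Scheme.{u}} (ρ : C ⟶ Spec (CommRingCat.of k))

theorem exists_isClosed_specializes [LocallyOfFiniteType ρ] (x : C) : ∃ c : C, IsClosed {c} ∧ x ⤳ c := by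
  have : JacobsonSpace C := LocallyOfFiniteType.jacobsonSpace ρ
  obtain ⟨c, hc, hc'⟩ := nonempty_inter_closedPoints (X := C) (Z := closure {x})
    ⟨x, subset_closure rfl⟩ isClosed_closure.isLocallyClosed
  exact ⟨c, hc', specializes_iff_mem_closure.2 hc⟩

/-- The points specializing to `c` are the primes of its local ring, and the zero ideal is the most
general of them. -/
theorem exists_generization {c : C} [IsDomain (C.presheaf.stalk c)] :
    ∃ η : C, ∀ y, y ⤳ c → η ⤳ y := by
  refine ⟨C.fromSpecStalk c (⊥ : PrimeSpectrum (C.presheaf.stalk c)), fun y hy => ?_⟩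
  have h1 : y ∈ Set.range (C.fromSpecStalk c) := by rw [Scheme.range_fromSpecStalk]; exact hy
  obtain ⟨p, rfl⟩ := h1
  exact ((PrimeSpectrum.le_iff_specializes _ _).1 bot_le).map (C.fromSpecStalk c).continuous

/-- Two components with a common point pass through a common closed point, whose local ring is a
domain, so they share a generic point and coincide. Finitely many disjoint closed components are
also open, so connectedness leaves only one. -/
theorem irreducibleSpace_of_isDomain_stalk [IsProper ρ] [ConnectedSpace C]
    (h : ∀ c : C, IsClosed {c} → IsDomain (C.presheaf.stalk c)) : IrreducibleSpace C := by
  have : IsLocallyNoetherian C := LocallyOfFiniteType.isLocallyNoetherian ρ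
  have : CompactSpace C := by
    have := (quasiCompact_iff_compactSpace (f := ρ)).1 inferInstance
    exact this
  have : IsNoetherian C := {}
  have hfin := finite_irreducibleComponents_of_isNoetherian (X := C)
  obtain ⟨x₀⟩ : Nonempty C := inferInstance
  have hW := irreducibleComponent_mem_irreducibleComponents x₀
  set W := irreducibleComponent x₀
  have hdisj : ∀ W' ∈ irreducibleComponents C, (W' ∩ W).Nonempty → W' = W := by
    rintro W' hW' ⟨x, hx', hx⟩
    obtain ⟨c, hc, hxc⟩ := exists_isClosed_specializes ρ x
    have := h c hc
    obtain ⟨η, hη⟩ := exists_generization (c := c)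
    have key : ∀ V ∈ irreducibleComponents C, x ∈ V → V = closure {η} := fun V hV hxV => by
      obtain ⟨ξ, hξ⟩ := QuasiSober.sober hV.1 (isClosed_of_mem_irreducibleComponents V hV)
      have h1 : η ⤳ ξ := hη ξ ((hξ.specializes hxV).trans hxc)
      have h2 : V ⊆ closure {η} := by
        rw [← hξ.def]; exact h1.closure_subset
      exact h2.antisymm (hV.2 isIrreducible_singleton.closure h2)
    rw [key W' hW' hx', key W hW hx]
  have hcl : IsClopen W := by
    refine ⟨isClosed_of_mem_irreducibleComponents W hW, ?_⟩
    have h1 : Wᶜ = ⋃ V ∈ irreducibleComponents C \ {W}, V := by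
      ext x
      simp only [Set.mem_compl_iff, Set.mem_iUnion, exists_prop]
      constructor
      · intro hx
        exact ⟨irreducibleComponent x, ⟨irreducibleComponent_mem_irreducibleComponents x,
          fun h0 => hx (h0 ▸ mem_irreducibleComponent)⟩, mem_irreducibleComponent⟩
      · rintro ⟨V, ⟨hV, hVW⟩, hxV⟩ hx
        exact hVW (hdisj V hV ⟨x, hxV, hx⟩)
    rw [← isClosed_compl_iff, h1]
    exact hfin.sdiff.isClosed_biUnion fun V hV => isClosed_of_mem_irreducibleComponents V hV.1
  have h2 : W = Set.univ := hcl.eq_univ ⟨x₀, mem_irreducibleComponent⟩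
  have h3 : IsIrreducible (Set.univ : Set C) := h2 ▸ hW.1
  exact { isPreirreducible_univ := h3.2, toNonempty := ⟨x₀⟩ }

variable [IsIntegral C]

/-- The point specializes to a closed point, and the local ring there, a discrete valuation ring,
has only one nonmaximal prime. -/
theorem eq_genericPoint_of_not_isClosed [LocallyOfFiniteType ρ]
    (hdvr : ∀ c : C, IsClosed {c} → IsDiscreteValuationRing (C.presheaf.stalk c)) {c : C}
    (hc : ¬ IsClosed {c}) : c = genericPoint C := by
  obtain ⟨d, hd, hcd⟩ := exists_isClosed_specializes ρ c
  have := hdvr d hd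
  have h1 : ∀ y, y ⤳ d → y ≠ d → y = C.fromSpecStalk d (⊥ : PrimeSpectrum (C.presheaf.stalk d)) := by
    intro y hy hyd
    have h1 : y ∈ Set.range (C.fromSpecStalk d) := by rw [Scheme.range_fromSpecStalk]; exact hy
    obtain ⟨p, rfl⟩ := h1
    by_cases hp : p.asIdeal = ⊥
    · congr 1
      exact PrimeSpectrum.ext hp
    · refine absurd ?_ hyd
      have h2 : p = IsLocalRing.closedPoint _ :=
        PrimeSpectrum.ext (IsLocalRing.eq_maximalIdeal (Ring.DimensionLEOne.maximalOfPrime hp p.2))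
      rw [h2, Scheme.fromSpecStalk_closedPoint]
  have hg : ∀ y : C, genericPoint C ⤳ y := fun y => (genericPoint_spec C).specializes trivial
  rw [h1 c hcd (by rintro rfl; exact hc hd)]
  refine (h1 _ (hg d) ?_).symm
  rintro h0
  have h2 := hg c
  rw [h0] at h2
  have h3 : c = d := h2.mem_closed hd rfl
  exact hc (h3 ▸ hd)

/-- The local ring at a point as a valuation ring of the function field. -/
def stalkSubring (c : C) [ValuationRing (C.presheaf.stalk c)] : ValuationSubring C.functionField :=
  ValuationSubring.ofSubring (algebraMap (C.presheaf.stalk c) C.functionField).range fun x => by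
    rcases ValuationRing.isInteger_or_isInteger (C.presheaf.stalk c) x with ⟨a, ha⟩ | ⟨a, ha⟩
    · exact Or.inl ⟨a, ha⟩
    · exact Or.inr ⟨a, ha⟩

/-- The local ring at a point is isomorphic to its image in the function field. -/
def stalkSubringEquiv (c : C) [ValuationRing (C.presheaf.stalk c)] :
    C.presheaf.stalk c ≃+* stalkSubring c :=
  RingEquiv.ofBijective (algebraMap (C.presheaf.stalk c) C.functionField).rangeRestrict
    ⟨fun _ _ h => IsFractionRing.injective (C.presheaf.stalk c) C.functionField
      (congrArg Subtype.val h), fun ⟨_, a, h⟩ => ⟨a, Subtype.ext h⟩⟩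

theorem dimensionLEOne_of_isAffineOpen [LocallyOfFiniteType ρ]
    (hdvr : ∀ c : C, IsClosed {c} → IsDiscreteValuationRing (C.presheaf.stalk c))
    {U : C.Opens} (hU : IsAffineOpen U) [Nonempty U] : Ring.DimensionLEOne Γ(C, U) := by
  refine ⟨fun {P} hP0 hP => ?_⟩
  let p : Spec Γ(C, U) := ⟨P, hP⟩
  have h1 : hU.fromSpec p ≠ genericPoint C := fun h0 => by
    rw [← genericPoint_eq_of_isOpenImmersion hU.fromSpec] at h0
    have h2 := hU.fromSpec.isOpenEmbedding.injective h0
    rw [genericPoint_eq_bot_of_affine] at h2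
    exact hP0 (congrArg PrimeSpectrum.asIdeal h2)
  have h2 : IsClosed {hU.fromSpec p} := by
    by_contra h0
    exact h1 (eq_genericPoint_of_not_isClosed ρ hdvr h0)
  have h3 : IsClosed {p} := by
    have := h2.preimage hU.fromSpec.continuous
    rwa [← Set.image_singleton, Set.preimage_image_eq _ hU.fromSpec.isOpenEmbedding.injective] at this
  exact (PrimeSpectrum.isClosed_singleton_iff_isMaximal p).1 h3

end CompleteCurve

/-! ### Valuation rings of the function field and the valuative criterion -/

section CompleteCurve

variable {k : Type u} [Field k] {C : Scheme.{u}} (ρ : C ⟶ Spec (CommRingCat.of k)) [IsIntegral C]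

/-- The function field as an algebra over the base field. -/
@[reducible]
def functionFieldAlgebra : Algebra k C.functionField := (constHom ρ (genericPoint C)).hom.toAlgebra

theorem algebraMap_constHom (c : C) (a : k) :
    algebraMap (C.presheaf.stalk c) C.functionField ((constHom ρ c).hom a) =
      (constHom ρ (genericPoint C)).hom a := by
  have h1 : constHom ρ c ≫ C.presheaf.stalkSpecializes
      ((genericPoint_spec C).specializes (trivial : c ∈ Set.univ)) = constHom ρ (genericPoint C) := by
    refine Spec.map_injective ?_
    rw [Spec.map_comp, specMap_constHom, specMap_constHom, 
      Scheme.SpecMap_stalkSpecializes_fromSpecStalk_assoc]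
  exact congrArg (fun f => f.hom a) h1

section Valuation

variable (V : ValuationSubring C.functionField)
  (hV : ∀ a, (constHom ρ (genericPoint C)).hom a ∈ V)

/-- A valuation ring of the function field as a valuative square. -/
def valuativeSquare : ValuativeCommSq ρ where
  R := V
  K := C.functionField
  i₁ := C.fromSpecStalk (genericPoint C)
  i₂ := Spec.map (CommRingCat.ofHom ((constHom ρ (genericPoint C)).hom.codRestrict V.toSubring hV))
  commSq := ⟨by
    rw [← Spec.map_comp, ← specMap_constHom]
    rfl⟩

/-- The morphism to the curve from a valuation ring that contains a local ring. -/
def centerLift {c : C} (hc : ∀ a, algebraMap (C.presheaf.stalk c) C.functionField a ∈ V) :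
    Spec (CommRingCat.of V) ⟶ C :=
  Spec.map (CommRingCat.ofHom ((algebraMap (C.presheaf.stalk c) C.functionField).codRestrict
    V.toSubring hc)) ≫ C.fromSpecStalk c

/-- If `V` dominates both local rings, its closed point is mapped to `c` and to `d` by two lifts of
the same valuative square; lifts are unique by separatedness. -/
theorem eq_of_dominates [IsProper ρ] {c d : C}
    (hc : ∀ a, algebraMap (C.presheaf.stalk c) C.functionField a ∈ V)
    (hd : ∀ a, algebraMap (C.presheaf.stalk d) C.functionField a ∈ V)
    (hc' : ∀ a, (algebraMap (C.presheaf.stalk c) C.functionField a)⁻¹ ∈ V → a ≠ 0 → IsUnit a)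
    (hd' : ∀ a, (algebraMap (C.presheaf.stalk d) C.functionField a)⁻¹ ∈ V → a ≠ 0 → IsUnit a) : c = d := by
  have hV : ∀ a, (constHom ρ (genericPoint C)).hom a ∈ V := fun a => by
    rw [← algebraMap_constHom ρ c]; exact hc _
  have key : ∀ (e : C) (he : ∀ a, algebraMap (C.presheaf.stalk e) C.functionField a ∈ V),
      Spec.map (CommRingCat.ofHom (algebraMap V C.functionField)) ≫ centerLift V he =
        C.fromSpecStalk (genericPoint C) ∧
      centerLift V he ≫ ρ = (valuativeSquare ρ V hV).i₂ := fun e he => by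
    constructor
    · rw [centerLift, ← Spec.map_comp_assoc, ← Scheme.SpecMap_stalkSpecializes_fromSpecStalk
        ((genericPoint_spec C).specializes (trivial : e ∈ Set.univ))]
      rfl
    · rw [centerLift, Category.assoc, ← specMap_constHom, ← Spec.map_comp]
      refine congrArg Spec.map (CommRingCat.hom_ext (RingHom.ext fun a => Subtype.ext ?_))
      exact algebraMap_constHom ρ e a
  have key2 : ∀ (e : C) (he : ∀ a, algebraMap (C.presheaf.stalk e) C.functionField a ∈ V),
      (∀ a, (algebraMap (C.presheaf.stalk e) C.functionField a)⁻¹ ∈ V → a ≠ 0 → IsUnit a) →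
      centerLift V he (IsLocalRing.closedPoint V) = e := fun e he he' => by
    have : IsLocalHom (S := V) ((algebraMap (C.presheaf.stalk e)
        C.functionField).codRestrict V.toSubring he) := ⟨fun a ha => he' a (by
      obtain ⟨b, hb⟩ := ha.exists_right_inv
      have h1 : algebraMap (C.presheaf.stalk e) C.functionField a * b = 1 := congrArg Subtype.val hb
      rw [inv_eq_of_mul_eq_one_right h1]
      exact b.2) (by
        rintro rfl
        rw [map_zero] at ha
        exact not_isUnit_zero ha)⟩
    have h2 : (Spec.map (CommRingCat.ofHom ((algebraMap (C.presheaf.stalk e)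
        C.functionField).codRestrict V.toSubring he))) (IsLocalRing.closedPoint V) =
        IsLocalRing.closedPoint (C.presheaf.stalk e) :=
      IsLocalRing.comap_closedPoint (S := V) ((algebraMap (C.presheaf.stalk e)
        C.functionField).codRestrict V.toSubring he)
    refine (Scheme.Hom.comp_apply _ _ _).trans ?_
    rw [h2, Scheme.fromSpecStalk_closedPoint]
  have h1 : ValuativeCriterion ρ := by
    have : IsProper ρ := inferInstance
    rw [IsProper.eq_valuativeCriterion] at this
    exact this.1.1.1
  have h2 := h1.uniqueness (valuativeSquare ρ V hV)
  have h3 : centerLift V hc = centerLift V hd := congrArg CommSq.LiftStruct.l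
    (Subsingleton.elim (⟨_, (key c hc).1, (key c hc).2⟩ : (valuativeSquare ρ V hV).commSq.LiftStruct)
      ⟨_, (key d hd).1, (key d hd).2⟩)
  rw [← key2 c hc hc', ← key2 d hd hd', h3]

/-- Existence in the valuative criterion of properness; the centre is the image of the closed point
of `V`. -/
theorem exists_center [IsProper ρ] (hV : ∀ a, (constHom ρ (genericPoint C)).hom a ∈ V) :
    ∃ c : C, ∀ a, algebraMap (C.presheaf.stalk c) C.functionField a ∈ V := by
  have h1 : ValuativeCriterion ρ := by
    have : IsProper ρ := inferInstance
    rw [IsProper.eq_valuativeCriterion] at this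
    exact this.1.1.1
  obtain ⟨l, hl, -⟩ := (h1.existence (valuativeSquare ρ V hV)).exists_lift
  let l' : Spec (CommRingCat.of V) ⟶ C := l
  have hl' : Spec.map (CommRingCat.ofHom (algebraMap V C.functionField)) ≫ l' =
    C.fromSpecStalk (genericPoint C) := hl
  refine ⟨l' (IsLocalRing.closedPoint V), fun a => ?_⟩
  have h2 := Scheme.Spec_stalkClosedPointTo_fromSpecStalk l'
  rw [← h2, ← Spec.map_comp_assoc, ← Scheme.SpecMap_stalkSpecializes_fromSpecStalk
        ((genericPoint_spec C).specializes (trivial : l' (IsLocalRing.closedPoint V) ∈ Set.univ)),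
    cancel_mono] at hl'
  have h3 := congrArg (fun f => f.hom a) (Spec.map_injective hl')
  have h4 : algebraMap (C.presheaf.stalk (l' (IsLocalRing.closedPoint V))) C.functionField a =
    algebraMap V C.functionField ((Scheme.stalkClosedPointTo l').hom a) := h3.symm
  rw [h4]
  exact Subtype.property _

end Valuation

theorem sum_ord_functionField_eq_zero [IsAlgClosed k] [CharZero k] [IsProper ρ]
    [hdvr : ∀ c : {c : C // IsClosed {c}}, IsDiscreteValuationRing (C.presheaf.stalk c.1)]
    {Φ : C.functionField} (D : {c : C // IsClosed {c}} →₀ ℤ)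
    (hD : ∀ c, ∃ (ϖ : C.presheaf.stalk c.1) (u : (C.presheaf.stalk c.1)ˣ), Irreducible ϖ ∧
      Φ = algebraMap _ C.functionField u.1 * algebraMap _ C.functionField ϖ ^ D c) :
    D.sum (fun _ m => m) = 0 := by
  let := functionFieldAlgebra ρ
  have hdvr' : ∀ c : C, IsClosed {c} → IsDiscreteValuationRing (C.presheaf.stalk c) :=
    fun c hc => hdvr ⟨c, hc⟩
  have hunit : ∀ (c : {c : C // IsClosed {c}}) (a : C.presheaf.stalk c.1),
      (algebraMap _ C.functionField a)⁻¹ ∈ stalkSubring c.1 → a ≠ 0 → IsUnit a := fun c a h h0 => by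
    obtain ⟨b, hb⟩ := h
    refine IsUnit.of_mul_eq_one b (IsFractionRing.injective (C.presheaf.stalk c.1) C.functionField ?_)
    rw [map_mul, hb, map_one, mul_inv_cancel₀]
    rwa [Ne, IsFractionRing.to_map_eq_zero_iff]
  have hnon : ∀ (c : {c : C // IsClosed {c}}) (a : C.presheaf.stalk c.1),
      a ∈ IsLocalRing.maximalIdeal _ →
      algebraMap _ C.functionField a ∈ (stalkSubring c.1).nonunits := fun c a ha => by
    rw [ValuationSubring.mem_nonunits_iff_or, or_iff_not_imp_left]
    intro h0 h
    exact ha (hunit c a h (by rintro rfl; exact h0 (map_zero _)))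
  have hle : ∀ (c : {c : C // IsClosed {c}}) (a : C.presheaf.stalk c.1),
      algebraMap _ C.functionField a ∈ stalkSubring c.1 := fun c a => ⟨a, rfl⟩
  have hDVR : ∀ c : {c : C // IsClosed {c}}, IsDiscreteValuationRing (stalkSubring c.1) :=
    fun c => IsDiscreteValuationRing.RingEquivClass.isDiscreteValuationRing (stalkSubringEquiv c.1)
  refine sum_ord_eq_zero (k := k) (Φ := Φ) (fun c : {c : C // IsClosed {c}} => stalkSubring c.1)
    (fun c d hcd => ?_) hDVR (fun c a => ?_) (fun c a ha => ?_) (fun V hV hV1 => ?_)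
    (fun Φ hΦ => ?_) D fun c => ?_
  · have hcd : stalkSubring c.1 = stalkSubring d.1 := hcd
    exact Subtype.ext (eq_of_dominates ρ (stalkSubring c.1) (hle c) (hcd ▸ hle d) (hunit c)
      (hcd ▸ hunit d))
  · exact ⟨_, algebraMap_constHom ρ c.1 a⟩
  · obtain ⟨b, rfl⟩ := ha
    obtain ⟨t, ht⟩ := exists_sub_constHom_mem ρ c.2 b
    refine ⟨t, ?_⟩
    have h1 := hnon c _ ht
    rw [map_sub] at h1
    have h2 := algebraMap_constHom ρ c.1 t
    rw [h2] at h1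
    exact h1
  · obtain ⟨c, hc⟩ := exists_center ρ V hV
    have hcl : IsClosed {c} := by
      by_contra h0
      obtain rfl := eq_genericPoint_of_not_isClosed ρ hdvr' h0
      refine hV1 (eq_top_iff.2 fun x _ => ?_)
      have h1 : (C.presheaf.stalkSpecializes ((genericPoint_spec C).specializes
        (trivial : genericPoint C ∈ Set.univ))).hom x ∈ V := hc x
      rw [TopCat.Presheaf.stalkSpecializes_refl] at h1
      exact h1
    refine ⟨⟨c, hcl⟩, ?_⟩
    have := hDVR ⟨c, hcl⟩
    refine ValuationSubring.eq_of_le_of_ne_top _ ?_ hV1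
    rintro _ ⟨a, rfl⟩
    exact hc a
  · obtain ⟨_, ⟨U, hU, rfl⟩, hxU, -⟩ := C.isBasis_affineOpens.exists_subset_of_mem_open
      (Set.mem_univ (genericPoint C)) isOpen_univ
    have hne : Nonempty U := ⟨⟨_, hxU⟩⟩
    have := functionField_isFractionRing_of_isAffineOpen C U hU
    have := dimensionLEOne_of_isAffineOpen ρ hdvr' hU
    let φ : k →+* Γ(C, U) := ((Scheme.ΓSpecIso (.of k)).inv ≫ ρ.appTop ≫
      C.presheaf.map (homOfLE le_top).op).hom
    let := φ.toAlgebra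
    have : IsScalarTower k Γ(C, U) C.functionField := IsScalarTower.of_algebraMap_eq' (by
      have h1 := congrArg CommRingCat.Hom.hom (constHom_eq ρ (genericPoint C))
      rw [← C.presheaf.germ_res (homOfLE le_top) _ hxU] at h1
      exact h1)
    have : Algebra.FiniteType k Γ(C, U) := by
      refine (RingHom.FiniteType.comp (ρ.finiteType_appLE (isAffineOpen_top _) hU le_top)
        (RingHom.FiniteType.of_surjective (Scheme.ΓSpecIso (.of k)).inv.hom
          (Scheme.ΓSpecIso (.of k)).commRingCatIsoToRingEquiv.symm.surjective) :)
    exact finiteDimensional_of_transcendental Γ(C, U) hΦ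
  · obtain ⟨ϖ, u, hϖ, h⟩ := hD c
    refine ⟨stalkSubringEquiv c.1 ϖ, Units.map (stalkSubringEquiv c.1).toMonoidHom u,
      (MulEquiv.irreducible_iff (stalkSubringEquiv c.1)).2 hϖ, h⟩

end CompleteCurve

/-! ### Degree zero on a complete curve in a variety -/

section DegreeZeroScheme

variable {k : Type u} [Field k] [IsAlgClosed k] [CharZero k] {M : Scheme.{u}}
  (π : M ⟶ Spec (CommRingCat.of k)) (Z : Closeds M)

theorem connectedSpace_redSub (hconn : _root_.IsConnected (Z : Set M)) : ConnectedSpace (redSub Z) := by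
  have h1 : redSubι Z '' Set.univ = Z := by rw [Set.image_univ, range_redSubι]
  rw [connectedSpace_iff_univ]
  rw [← h1] at hconn
  exact ⟨Set.image_nonempty.1 hconn.1,
    (redSubι Z).isEmbedding.isInducing.isPreconnected_image.1 hconn.2⟩

theorem degreeZero_of_isProper [IsProper (redSubι Z ≫ π)]
    (hZ : IsSmoothCurve M.toLocallyRingedSpace (Z : Set M)) (hconn : _root_.IsConnected (Z : Set M)) :
    DegreeZero M.toLocallyRingedSpace (Z : Set M) := by
  intro N a b D hN hD hord hcompat
  have := isReduced_redSub Z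
  have := connectedSpace_redSub Z hconn
  have := irreducibleSpace_of_isDomain_stalk (redSubι Z ≫ π) fun c hc =>
    (isDiscreteValuationRing_stalk_redSub Z hZ hc).1
  have : IsIntegral (redSub Z) := isIntegral_of_irreducibleSpace_of_isReduced _
  have hdvr : ∀ c : {c : redSub Z // IsClosed {c}},
      IsDiscreteValuationRing ((redSub Z).presheaf.stalk c.1) := fun c =>
    (isDiscreteValuationRing_stalk_redSub Z hZ c.2).2
  have hmem : ∀ c : {c : redSub Z // IsClosed {c}}, redSubι Z c.1 ∈ (Z : Set M) ∧
      IsClosed {redSubι Z c.1} := fun c => ⟨redSubι_mem Z c.1, (isClosed_redSubι Z c.1).2 c.2⟩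
  let pt : {c : redSub Z // IsClosed {c}} → {z : M // z ∈ (Z : Set M) ∧ IsClosed {z}} :=
    fun c => ⟨redSubι Z c.1, hmem c⟩
  let W : {c : redSub Z // IsClosed {c}} → (redSub Z).Opens := fun c => redSubι Z ⁻¹ᵁ N (pt c)
  have hW : ∀ c, c.1 ∈ W c := fun c => hN (pt c)
  have hWne : ∀ c, Nonempty (W c) := fun c => ⟨⟨_, hW c⟩⟩
  let R : ∀ c, Sec M.toLocallyRingedSpace (N (pt c)) → (redSub Z).functionField := fun c s =>
    (redSub Z).germToFunctionField (W c) ((redSubι Z).app (N (pt c)) s)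
  have hR : ∀ (c : {c : redSub Z // IsClosed {c}}) (s : Sec M.toLocallyRingedSpace (N (pt c)))
      (d : redSub Z) (hd : redSubι Z d ∈ N (pt c)), R c s =
        algebraMap ((redSub Z).presheaf.stalk d) _
          ((redSubι Z).stalkMap d (germAt (M := M.toLocallyRingedSpace) s _ hd)) :=
    fun c s d hd => by
      refine ((redSub Z).algebraMap_germ_eq_germToFunctionField (show d ∈ W c from hd) _).symm.trans
        (congrArg _ ?_)
      exact (Scheme.Hom.germ_stalkMap_apply (redSubι Z) (N (pt c)) d hd s).symm
  have hassoc : ∀ c : {c : redSub Z // IsClosed {c}}, ∃ (ϖ : (redSub Z).presheaf.stalk c.1)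
      (u : ((redSub Z).presheaf.stalk c.1)ˣ), Irreducible ϖ ∧ R c (b (pt c)) ≠ 0 ∧
      R c (a (pt c)) / R c (b (pt c)) = algebraMap _ (redSub Z).functionField u.1 *
        algebraMap _ (redSub Z).functionField ϖ ^ D (redSubι Z c.1) := fun c => by
    obtain ⟨ϖ, hϖ⟩ := IsDiscreteValuationRing.exists_irreducible ((redSub Z).presheaf.stalk c.1)
    obtain ⟨i, j, hi, hj, hij⟩ := hord (pt c) _ (hN (pt c)) (hmem c).1 (hmem c).2
    obtain ⟨u, hu⟩ := (associated_stalkMap_redSubι Z hZ c.2 hi hϖ).symm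
    obtain ⟨v, hv⟩ := (associated_stalkMap_redSubι Z hZ c.2 hj hϖ).symm
    have hϖ0 : algebraMap _ (redSub Z).functionField ϖ ≠ 0 := by
      rw [Ne, IsFractionRing.to_map_eq_zero_iff]; exact hϖ.ne_zero
    have hv0 : algebraMap _ (redSub Z).functionField v.1 ≠ 0 := by
      rw [Ne, IsFractionRing.to_map_eq_zero_iff]; exact v.ne_zero
    have hvv : algebraMap _ (redSub Z).functionField (v⁻¹).1 =
        (algebraMap _ (redSub Z).functionField v.1)⁻¹ := by
      refine (inv_eq_of_mul_eq_one_right ?_).symm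
      rw [← map_mul, Units.mul_inv, map_one]
    have ha := hR c (a (pt c)) c.1 (hN (pt c))
    have hb := hR c (b (pt c)) c.1 (hN (pt c))
    rw [← hu, map_mul, map_pow] at ha
    rw [← hv, map_mul, map_pow] at hb
    refine ⟨ϖ, u * v⁻¹, hϖ, ?_, ?_⟩
    · rw [hb]; exact mul_ne_zero (pow_ne_zero _ hϖ0) hv0
    · rw [ha, hb, hij, Units.val_mul, map_mul, hvv, zpow_sub₀ hϖ0, zpow_natCast, zpow_natCast]
      field_simp
  -- Two nonempty open subsets of the irreducible curve meet in a closed point, where compatibility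
  -- of the local fractions applies. The fractions thus define one rational function.
  have hindep : ∀ c d, R c (a (pt c)) / R c (b (pt c)) = R d (a (pt d)) / R d (b (pt d)) := by
    intro c d
    obtain ⟨-, -, -, hc0, -⟩ := hassoc c
    obtain ⟨-, -, -, hd0, -⟩ := hassoc d
    rw [div_eq_div_iff hc0 hd0]
    have : JacobsonSpace (redSub Z) := LocallyOfFiniteType.jacobsonSpace (redSubι Z ≫ π)
    obtain ⟨e, ⟨he1, he2⟩, he⟩ := nonempty_inter_closedPoints (Z := (W c : Set (redSub Z)) ∩ W d)
      (nonempty_preirreducible_inter (W c).2 (W d).2 ⟨_, hW c⟩ ⟨_, hW d⟩)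
      ((W c).2.inter (W d).2).isLocallyClosed
    have h1 := hcompat (pt c) (pt d) _ he1 he2 (redSubι_mem Z e) ((isClosed_redSubι Z e).2 he)
    rw [← ker_stalkMap_redSubι, RingHom.mem_ker, map_sub, map_mul, map_mul, sub_eq_zero] at h1
    have h2 := congrArg (algebraMap ((redSub Z).presheaf.stalk e) (redSub Z).functionField) h1
    rw [map_mul, map_mul] at h2
    rw [hR c _ e he1, hR c _ e he1, hR d _ e he2, hR d _ e he2]
    exact h2
  obtain ⟨c₀⟩ : Nonempty {c : redSub Z // IsClosed {c}} := by
    obtain ⟨x⟩ : Nonempty (redSub Z) := inferInstance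
    obtain ⟨c, hc, -⟩ := exists_isClosed_specializes (redSubι Z ≫ π) x
    exact ⟨⟨c, hc⟩⟩
  have hinj : Function.Injective fun c : {c : redSub Z // IsClosed {c}} => redSubι Z c.1 :=
    fun c d h => Subtype.ext ((redSubι Z).isEmbedding.injective h)
  have h0 := sum_ord_functionField_eq_zero (redSubι Z ≫ π) (Φ := R c₀ (a (pt c₀)) / R c₀ (b (pt c₀)))
    (D.comapDomain (fun c : {c : redSub Z // IsClosed {c}} => redSubι Z c.1) hinj.injOn) fun c => by
      obtain ⟨ϖ, u, hϖ, -, h⟩ := hassoc c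
      exact ⟨ϖ, u, hϖ, (hindep c₀ c).trans h⟩
  rw [← h0]
  refine (Finsupp.sum_comapDomain _ D (fun _ m => m) ⟨fun x hx => ?_, hinj.injOn, fun x hx => ?_⟩).symm
  · exact hx
  · obtain ⟨h1, h2⟩ := hD x (Finsupp.mem_support_iff.1 hx)
    rw [← range_redSubι] at h1
    obtain ⟨c, rfl⟩ := h1
    exact ⟨⟨c, (isClosed_redSubι Z c).1 h2⟩, hx, rfl⟩

end DegreeZeroScheme

/-! ### Counting solutions of analytic equations near a point -/

section FibreCount

open Filter Topology Set

theorem encard_setOf_pow_eq {m : ℕ} (hm : m ≠ 0) {ε : ℂ} (hε : ε ≠ 0) :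
    {w : ℂ | w ^ m = ε}.encard = m := by
  classical
  have hζ := Complex.isPrimitiveRoot_exp m hm
  have h1 : {w : ℂ | w ^ m = ε} = ((Polynomial.nthRoots m ε).toFinset : Set ℂ) := by
    ext w
    simp [Polynomial.mem_nthRoots (Nat.pos_of_ne_zero hm)]
  rw [h1, encard_coe_eq_coe_finsetCard, Multiset.toFinset_card_of_nodup (hζ.nthRoots_nodup hε),
    hζ.card_nthRoots, if_pos (IsAlgClosed.exists_pow_nat_eq ε (Nat.pos_of_ne_zero hm))]

/-- The quotient `h / h 0` is near one, where the principal logarithm is analytic. -/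
theorem exists_analytic_root {m : ℕ} (hm : m ≠ 0) {h : ℂ → ℂ} (hh : AnalyticAt ℂ h 0) (h0 : h 0 ≠ 0) :
    ∃ r : ℂ → ℂ, AnalyticAt ℂ r 0 ∧ r 0 ≠ 0 ∧ ∀ᶠ τ in 𝓝 0, r τ ^ m = h τ := by
  obtain ⟨c, hc⟩ := IsAlgClosed.exists_pow_nat_eq (h 0) (Nat.pos_of_ne_zero hm)
  have hc0 : c ≠ 0 := by rintro rfl; exact h0 (by rw [← hc, zero_pow hm])
  refine ⟨fun τ => c * Complex.exp (Complex.log (h τ / h 0) / m), ?_, ?_, ?_⟩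
  · refine analyticAt_const.mul (AnalyticAt.cexp (AnalyticAt.div_const (AnalyticAt.clog
      hh.div_const ?_)))
    rw [div_self h0]; exact Complex.one_mem_slitPlane
  · exact mul_ne_zero hc0 (Complex.exp_ne_zero _)
  · filter_upwards [hh.continuousAt.eventually_ne h0] with τ hτ
    rw [mul_pow, ← Complex.exp_nat_mul, mul_div_cancel₀ _ (Nat.cast_ne_zero.2 hm),
      Complex.exp_log (div_ne_zero hτ h0), hc, mul_div_cancel₀ _ h0]

/-- The number of small solutions of `τ ^ m * h τ = ε` for `ε` near zero. -/
theorem exists_nhds_encard_eq {m : ℕ} {f h : ℂ → ℂ} (hh : AnalyticAt ℂ h 0) (h0 : h 0 ≠ 0)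
    (hf : ∀ᶠ τ in 𝓝 0, f τ = τ ^ m * h τ) {U : Set ℂ} (hU : U ∈ 𝓝 0) :
    ∃ U' ∈ 𝓝 (0 : ℂ), U' ⊆ U ∧ ∀ᶠ ε in 𝓝[≠] 0, {τ | τ ∈ U' ∧ f τ = ε}.encard = m := by
  rcases eq_or_ne m 0 with rfl | hm
  · have h1 : ∀ᶠ τ in 𝓝 0, ‖h 0‖ / 2 < ‖h τ‖ :=
      hh.continuousAt.norm.eventually_const_lt (half_lt_self (norm_pos_iff.2 h0))
    refine ⟨_, inter_mem hU (inter_mem hf h1), inter_subset_left, ?_⟩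
    have h2 : ∀ᶠ ε in 𝓝 (0 : ℂ), ‖ε‖ < ‖h 0‖ / 2 :=
      continuous_norm.continuousAt.eventually_lt_const (by simpa using h0)
    filter_upwards [nhdsWithin_le_nhds h2] with ε hε
    rw [Nat.cast_zero, encard_eq_zero, eq_empty_iff_forall_notMem]
    rintro τ ⟨⟨-, h3, h4⟩, rfl⟩
    simp only [mem_ofPred_eq, pow_zero, one_mul] at h3 h4
    rw [h3] at hε
    exact lt_asymm hε h4
  · obtain ⟨r, hr, hr0, hrm⟩ := exists_analytic_root hm hh h0
    have hg : HasStrictDerivAt (fun τ => τ * r τ) (r 0) 0 :=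
      ((hasStrictDerivAt_id (0 : ℂ)).mul hr.hasStrictDerivAt).congr_deriv (by simp)
    -- In the coordinate `w = τ r(τ)` the function is `w ^ m`, so small solutions correspond to the
    -- `m` roots of `ε`.
    let e := (hg.hasStrictFDerivAt_equiv hr0).toOpenPartialHomeomorph (fun τ => τ * r τ)
    have he : ∀ τ, e τ = τ * r τ := fun τ => rfl
    have hes : (0 : ℂ) ∈ e.source := (hg.hasStrictFDerivAt_equiv hr0).mem_toOpenPartialHomeomorph_source
    obtain ⟨V, hVU, hV, hV0⟩ := mem_nhds_iff.1 (inter_mem hU (inter_mem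
      (inter_mem hf hrm) (e.open_source.mem_nhds hes)))
    have hVs : V ⊆ e.source := fun x hx => (hVU hx).2.2
    have h1 : e '' V ∈ 𝓝 (0 : ℂ) := (e.isOpen_image_of_subset_source hV hVs).mem_nhds
      ⟨0, hV0, by rw [he, zero_mul]⟩
    obtain ⟨δ, hδ, hδV⟩ := Metric.mem_nhds_iff.1 h1
    refine ⟨V ∩ e ⁻¹' Metric.ball 0 δ, inter_mem (hV.mem_nhds hV0)
      ((e.continuousAt hes).preimage_mem_nhds (by
        rw [he, zero_mul]; exact Metric.ball_mem_nhds _ hδ)), fun x hx => (hVU hx.1).1, ?_⟩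
    have h2 : ∀ᶠ ε in 𝓝 (0 : ℂ), ‖ε‖ < δ ^ m :=
      continuous_norm.continuousAt.eventually_lt_const (by simpa using pow_pos hδ m)
    filter_upwards [nhdsWithin_le_nhds h2, self_mem_nhdsWithin] with ε hε hε0
    have h3 : ∀ τ ∈ V, f τ = e τ ^ m := fun τ hτ => by
      have h4 := (hVU hτ).2.1
      rw [h4.1, he, mul_pow]
      congr 1
      exact h4.2.symm
    rw [← encard_setOf_pow_eq hm hε0, ← (e.injOn.mono (s₁ := {τ | τ ∈ V ∩ e ⁻¹' Metric.ball 0 δ ∧ f τ = ε})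
      fun x hx => hVs hx.1.1).encard_image]
    congr 1
    ext w
    constructor
    · rintro ⟨τ, ⟨⟨hτ, -⟩, rfl⟩, rfl⟩
      exact (h3 τ hτ).symm
    · intro hw
      have hw : w ^ m = ε := hw
      have hwδ : w ∈ Metric.ball (0 : ℂ) δ := by
        rw [mem_ball_zero_iff]
        rw [← hw, norm_pow] at hε
        exact lt_of_pow_lt_pow_left₀ m hδ.le hε
      obtain ⟨τ, hτ, rfl⟩ := hδV hwδ
      exact ⟨τ, ⟨⟨hτ, hwδ⟩, (h3 τ hτ).trans hw⟩, rfl⟩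

open Classical in
/-- Local counts of a family of subsets of a compact space add up. -/
theorem eventually_encard_eq_sum {X ι : Type*} [TopologicalSpace X] [CompactSpace X] [T2Space X]
    {l : Filter ι} (G : ι → Set X) (m : X → ℕ) (S : Finset X) (hS : ∀ x ∉ S, m x = 0)
    (h : ∀ x, ∀ U ∈ 𝓝 x, ∃ U' ∈ 𝓝 x, U' ⊆ U ∧ ∀ᶠ i in l, (G i ∩ U').encard = m x) :
    ∀ᶠ i in l, (G i).encard = (∑ x ∈ S, m x : ℕ) := by
  obtain ⟨U, hU, hdisj⟩ := S.finite_toSet.t2_separation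
  choose U' hU' hU'U hcount using fun x => h x (U x) ((hU x).2.mem_nhds (hU x).1)
  -- Away from the finite set `S` every point has a neighbourhood free of eventual solutions, and
  -- finitely many of these cover the compact complement.
  have hK : IsCompact (⋃ x ∈ S, interior (U' x))ᶜ :=
    (isOpen_biUnion fun _ _ => isOpen_interior).isClosed_compl.isCompact
  obtain ⟨T, hT, hTK⟩ := hK.elim_nhds_subcover U' fun x _ => hU' x
  have hTS : ∀ x ∈ T, m x = 0 := fun x hx => hS x fun h0 => hT x hx
    (mem_iUnion₂.2 ⟨x, h0, mem_interior_iff_mem_nhds.2 (hU' x)⟩)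
  have h1 : ∀ᶠ i in l, ∀ x ∈ S ∪ T, (G i ∩ U' x).encard = m x := by
    exact (Filter.eventually_all_finset _).2 fun x _ => hcount x
  filter_upwards [h1] with i hi
  have h2 : G i = ⋃ x ∈ S, G i ∩ U' x := by
    refine subset_antisymm (fun y hy => ?_) (iUnion₂_subset fun x _ => inter_subset_left)
    by_cases hyK : y ∈ ⋃ x ∈ S, interior (U' x)
    · obtain ⟨x, hx, hyx⟩ := mem_iUnion₂.1 hyK
      exact mem_iUnion₂.2 ⟨x, hx, hy, interior_subset hyx⟩
    · obtain ⟨x, hx, hyx⟩ := mem_iUnion₂.1 (hTK hyK)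
      have h3 := hi x (Finset.mem_union_right _ hx)
      rw [hTS x hx, Nat.cast_zero, encard_eq_zero] at h3
      exact absurd ⟨hy, hyx⟩ (h3 ▸ notMem_empty y)
  have h4 : ∀ S' ⊆ S, (⋃ x ∈ S', G i ∩ U' x).encard = (∑ x ∈ S', m x : ℕ) := by
    intro S'
    induction S' using Finset.induction_on with
    | empty => simp
    | insert a S' ha ih =>
      intro hS'
      rw [Finset.set_biUnion_insert, encard_union_eq, ih ((Finset.subset_insert _ _).trans hS'),
        Finset.sum_insert ha, Nat.cast_add, hi a (Finset.mem_union_left _ (hS' (Finset.mem_insert_self _ _)))]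
      rw [disjoint_iUnion₂_right]
      intro x hx
      refine ((hdisj (hS' (Finset.mem_insert_self _ _)) (hS' (Finset.mem_insert_of_mem hx)) ?_).mono
        (inter_subset_right.trans (hU'U a)) (inter_subset_right.trans (hU'U x)))
      rintro rfl
      exact ha hx
  rw [h2, h4 S subset_rfl]

end FibreCount

/-! ### Degree of the divisor of a meromorphic function -/

section DegreeOfMeromorphic

open Filter Topology Set

variable {X : Type*} [TopologicalSpace X]

theorem tendsto_punctured {e : OpenPartialHomeomorph X ℂ} {x : X} (hx : x ∈ e.source)
    (h0 : e x = 0) : Tendsto e (𝓝[≠] x) (𝓝[≠] 0) := by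
  have h1 := e.continuousAt hx
  rw [ContinuousAt, h0] at h1
  refine tendsto_nhdsWithin_iff.2 ⟨h1.mono_left nhdsWithin_le_nhds, ?_⟩
  filter_upwards [self_mem_nhdsWithin, nhdsWithin_le_nhds (e.open_source.mem_nhds hx)] with y hy hys
  intro hy0
  exact hy (e.injOn hys hx (hy0.trans h0.symm))

theorem tendsto_symm_punctured {e : OpenPartialHomeomorph X ℂ} {x : X} (hx : x ∈ e.source)
    (h0 : e x = 0) : Tendsto e.symm (𝓝[≠] 0) (𝓝[≠] x) := by
  have ht : (0 : ℂ) ∈ e.target := h0 ▸ e.map_source hx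
  have hs : e.symm 0 = x := by rw [← h0, e.left_inv hx]
  have h1 := e.continuousAt_symm ht
  rw [ContinuousAt, hs] at h1
  refine tendsto_nhdsWithin_iff.2 ⟨h1.mono_left nhdsWithin_le_nhds, ?_⟩
  filter_upwards [self_mem_nhdsWithin, nhdsWithin_le_nhds (e.open_target.mem_nhds ht)] with τ hτ hτt
  intro hτ0
  refine hτ ?_
  have := e.right_inv hτt
  rw [hτ0, h0] at this
  exact this.symm

theorem neBot_punctured {e : OpenPartialHomeomorph X ℂ} {x : X} (hx : x ∈ e.source)
    (h0 : e x = 0) : (𝓝[≠] x).NeBot := (tendsto_symm_punctured hx h0).neBot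

/-- Near zero the function `f` takes the values along the filter `l` exactly `m` times. -/
def HasLocalCount (f : ℂ → ℂ) (l : Filter ℂ) (m : ℕ) : Prop :=
  ∀ V ∈ 𝓝 (0 : ℂ), ∃ V' ∈ 𝓝 (0 : ℂ), V' ⊆ V ∧ ∀ᶠ ε in l, {τ | τ ∈ V' ∧ f τ = ε}.encard = m

theorem exists_nhds_encard_eq_of_chart {e : OpenPartialHomeomorph X ℂ} {x : X} (hx : x ∈ e.source)
    (h0 : e x = 0) {φ : X → ℂ} {f : ℂ → ℂ} (hf : ∀ᶠ y in 𝓝 x, φ y = f (e y)) {l : Filter ℂ} {m : ℕ}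
    (h : HasLocalCount f l m) {U : Set X} (hU : U ∈ 𝓝 x) :
    ∃ U' ∈ 𝓝 x, U' ⊆ U ∧ ∀ᶠ ε in l, ({y | φ y = ε} ∩ U').encard = m := by
  have ht : (0 : ℂ) ∈ e.target := h0 ▸ e.map_source hx
  have hs : e.symm 0 = x := by rw [← h0, e.left_inv hx]
  have h1 := e.continuousAt_symm ht
  rw [ContinuousAt, hs] at h1
  have h2 := e.continuousAt hx
  rw [ContinuousAt, h0] at h2
  obtain ⟨V', hV', hV'V, hcount⟩ := h _ (inter_mem (e.open_target.mem_nhds ht)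
    (h1 (inter_mem hU hf)))
  have hsub : ∀ y ∈ e.source ∩ e ⁻¹' V', y ∈ U ∧ φ y = f (e y) := fun y hy => by
    have h3 := (hV'V hy.2).2
    rw [mem_preimage, e.left_inv hy.1] at h3
    exact h3
  refine ⟨e.source ∩ e ⁻¹' V', inter_mem (e.open_source.mem_nhds hx) (h2 hV'),
    fun y hy => (hsub y hy).1, ?_⟩
  filter_upwards [hcount] with ε hε
  rw [← hε, ← (e.injOn.mono (s₁ := {y | φ y = ε} ∩ (e.source ∩ e ⁻¹' V'))
    fun y hy => hy.2.1).encard_image]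
  congr 1
  ext τ
  constructor
  · rintro ⟨y, ⟨hy1, hy2⟩, rfl⟩
    exact ⟨hy2.2, (hsub y hy2).2.symm.trans hy1⟩
  · rintro ⟨hτ, hτε⟩
    have hτt := (hV'V hτ).1
    have hmem : e.symm τ ∈ e.source ∩ e ⁻¹' V' :=
      ⟨e.map_target hτt, by rw [mem_preimage, e.right_inv hτt]; exact hτ⟩
    refine ⟨e.symm τ, ⟨?_, hmem⟩, e.right_inv hτt⟩
    have := (hsub _ hmem).2
    rw [e.right_inv hτt, hτε] at this
    exact this


section LocalCount

theorem hasLocalCount_of_sub_eq {f k : ℂ → ℂ} (hk : AnalyticAt ℂ k 0) (hk0 : k 0 ≠ 0) {m : ℕ}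
    {c : ℂ} (hf : ∀ᶠ τ in 𝓝 0, f τ - c = τ ^ m * k τ) : HasLocalCount f (𝓝[≠] c) m := fun V hV => by
  obtain ⟨V', hV', hV'V, h⟩ := exists_nhds_encard_eq hk hk0 hf hV
  refine ⟨V', hV', hV'V, ?_⟩
  have h1 : Tendsto (fun ε => ε - c) (𝓝[≠] c) (𝓝[≠] 0) := by
    refine tendsto_nhdsWithin_iff.2 ⟨?_, ?_⟩
    · have : Tendsto (fun ε => ε - c) (𝓝 c) (𝓝 (c - c)) := (continuous_sub_right c).tendsto c
      rw [sub_self] at this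
      exact this.mono_left nhdsWithin_le_nhds
    · filter_upwards [self_mem_nhdsWithin] with ε hε
      exact sub_ne_zero.2 hε
  filter_upwards [h1.eventually h] with ε hε
  rw [← hε]
  congr 1
  ext τ
  simp

theorem hasLocalCount_zero {f : ℂ → ℂ} {l : Filter ℂ} {P : ℂ → Prop} (hP : ∀ᶠ τ in 𝓝 0, P (f τ))
    (hl : ∀ᶠ ε in l, ¬ P ε) : HasLocalCount f l 0 := fun V hV => by
  refine ⟨_, inter_mem hV hP, inter_subset_left, ?_⟩
  filter_upwards [hl] with ε hε
  rw [Nat.cast_zero, encard_eq_zero, eq_empty_iff_forall_notMem]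
  rintro τ ⟨⟨-, h⟩, rfl⟩
  exact hε h

theorem eventually_bounded {f : ℂ → ℂ} (hf : ContinuousAt f 0) :
    HasLocalCount f (Bornology.cobounded ℂ) 0 := by
  refine hasLocalCount_zero (P := fun w => ‖w‖ < ‖f 0‖ + 1)
    (hf.norm.eventually_lt_const (lt_add_one _)) ?_
  filter_upwards [(tendsto_norm_cobounded_atTop (E := ℂ)).eventually_ge_atTop (‖f 0‖ + 1)] with ε hε
  exact not_lt.2 hε

variable {f h : ℂ → ℂ} {p : ℕ} (hh : AnalyticAt ℂ h 0) (h0 : h 0 ≠ 0)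
  (hf : ∀ᶠ τ in 𝓝 0, f τ = τ ^ (-(p : ℤ)) * h τ)

include hf in
theorem eventually_inv_eq : ∀ᶠ τ in 𝓝 0, (fun τ => (f τ)⁻¹) τ = τ ^ p * (fun τ => (h τ)⁻¹) τ := by
  filter_upwards [hf] with τ hτ
  simp only [hτ, mul_inv, zpow_neg, inv_inv, zpow_natCast]

include hh h0 hf in
theorem eventually_zero_or_large (hp : p ≠ 0) (B : ℝ) : ∀ᶠ τ in 𝓝 0, f τ = 0 ∨ B < ‖f τ‖ := by
  have h1 : Tendsto (fun τ : ℂ => τ ^ p * (h τ)⁻¹) (𝓝 0) (𝓝 (0 ^ p * (h 0)⁻¹)) :=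
    ((continuous_pow p).continuousAt.mul (hh.continuousAt.inv₀ h0)).tendsto
  rw [zero_pow hp, zero_mul] at h1
  have hB : 0 < |B| + 1 := by positivity
  have h2 := (norm_zero (E := ℂ) ▸ h1.norm).eventually_lt_const (inv_pos.2 hB)
  filter_upwards [h2, eventually_inv_eq hf] with τ h3 h4
  rw [or_iff_not_imp_left]
  intro h5
  rw [← h4, norm_inv, inv_lt_inv₀ (norm_pos_iff.2 h5) hB] at h3
  linarith [le_abs_self B]

include hh h0 hf in
-- Near a pole the function is large, except that the convention `0 ^ (-p) = 0` gives it the value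
-- zero at the pole itself. The punctured neighbourhood of `c` avoids this value, also when `c = 0`.
theorem hasLocalCount_pole_level (hp : p ≠ 0) (c : ℂ) : HasLocalCount f (𝓝[≠] c) 0 := by
  refine hasLocalCount_zero (P := fun w => w = 0 ∨ ‖c‖ + 1 < ‖w‖)
    (eventually_zero_or_large hh h0 hf hp _) ?_
  have h1 : ∀ᶠ ε in 𝓝[≠] c, ε ≠ 0 := by
    rcases eq_or_ne c 0 with rfl | hc
    · exact self_mem_nhdsWithin
    · exact nhdsWithin_le_nhds (isOpen_ne.mem_nhds hc)
  have h2 : ∀ᶠ ε in 𝓝 c, ‖ε‖ < ‖c‖ + 1 :=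
    continuous_norm.continuousAt.eventually_lt_const (lt_add_one _)
  filter_upwards [h1, nhdsWithin_le_nhds h2] with ε hε1 hε2
  rintro (h3 | h3)
  · exact hε1 h3
  · exact lt_asymm hε2 h3

include hh h0 hf in
theorem hasLocalCount_pole : HasLocalCount f (Bornology.cobounded ℂ) p := fun V hV => by
  obtain ⟨V', hV', hV'V, h⟩ := exists_nhds_encard_eq (hh.inv h0) (inv_ne_zero h0)
    (eventually_inv_eq hf) hV
  refine ⟨V', hV', hV'V, ?_⟩
  have h1 : Tendsto (fun ε : ℂ => ε⁻¹) (Bornology.cobounded ℂ) (𝓝[≠] 0) := tendsto_inv₀_cobounded'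
  filter_upwards [h1.eventually h] with ε hε
  rw [← hε]
  congr 1
  ext τ
  simp

end LocalCount

/-- The local expression of a meromorphic function. -/
def localExpr (d : ℤ) (h : ℂ → ℂ) (τ : ℂ) : ℂ := τ ^ d * h τ

theorem localExpr_natCast {d : ℤ} {h : ℂ → ℂ} {p : ℕ} (hp : d = p) :
    ∀ᶠ τ in 𝓝 0, localExpr d h τ = τ ^ p * h τ := Eventually.of_forall fun τ => by
  rw [localExpr, hp, zpow_natCast]

theorem localExpr_neg {d : ℤ} {h : ℂ → ℂ} {p : ℕ} (hp : d = -p) :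
    ∀ᶠ τ in 𝓝 0, localExpr d h τ = τ ^ (-(p : ℤ)) * h τ := Eventually.of_forall fun τ => by
  rw [localExpr, hp]

theorem analyticAt_localExpr {d : ℤ} {h : ℂ → ℂ} (hh : AnalyticAt ℂ h 0) {p : ℕ} (hp : d = p) :
    AnalyticAt ℂ (localExpr d h) 0 :=
  ((analyticAt_id.pow p).mul hh).congr (by
    filter_upwards [localExpr_natCast hp] with τ hτ
    exact hτ.symm)

theorem eventually_localExpr_ne_or_eq {d : ℤ} {h : ℂ → ℂ} (hh : AnalyticAt ℂ h 0) (h0 : h 0 ≠ 0) {c : ℂ}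
    (hc : c ≠ 0) : (∀ᶠ τ in 𝓝[≠] 0, localExpr d h τ ≠ c) ∨ ∀ᶠ τ in 𝓝 0, localExpr d h τ = c := by
  obtain ⟨p, hp | hp⟩ := d.eq_nat_or_neg
  · rcases ((analyticAt_localExpr hh hp).sub
      (analyticAt_const (v := c))).eventually_eq_zero_or_eventually_ne_zero with h1 | h1
    · exact Or.inr (h1.mono fun τ hτ => sub_eq_zero.1 hτ)
    · exact Or.inl (h1.mono fun τ hτ => sub_ne_zero.1 hτ)
  · rcases eq_or_ne p 0 with rfl | hp0
    · rcases ((analyticAt_localExpr hh (p := 0) (by simpa using hp)).sub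
        (analyticAt_const (v := c))).eventually_eq_zero_or_eventually_ne_zero with h1 | h1
      · exact Or.inr (h1.mono fun τ hτ => sub_eq_zero.1 hτ)
      · exact Or.inl (h1.mono fun τ hτ => sub_ne_zero.1 hτ)
    · refine Or.inl (nhdsWithin_le_nhds ?_)
      filter_upwards [eventually_zero_or_large hh h0 (localExpr_neg hp) hp0 ‖c‖] with τ hτ h1
      rw [h1] at hτ
      exact hτ.elim hc (lt_irrefl _)

variable (D : X →₀ ℤ) (φ : X → ℂ)
  (e : X → OpenPartialHomeomorph X ℂ) (he : ∀ x, x ∈ (e x).source) (he0 : ∀ x, e x x = 0)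
  (h : X → ℂ → ℂ) (hh : ∀ x, AnalyticAt ℂ (h x) 0) (h0 : ∀ x, h x 0 ≠ 0)
  (hφ : ∀ x, ∀ᶠ y in 𝓝 x, φ y = e x y ^ D x * h x (e x y))

include he he0 hφ in
theorem eventually_ne_of_localExpr {P : ℂ → Prop} {x : X}
    (hP : ∀ᶠ τ in 𝓝[≠] 0, P (localExpr (D x) (h x) τ)) : ∀ᶠ y in 𝓝[≠] x, P (φ y) := by
  filter_upwards [(tendsto_punctured (he x) (he0 x)).eventually hP, nhdsWithin_le_nhds (hφ x)]
    with y h1 h2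
  rw [h2]; exact h1

include he he0 hh h0 hφ in
/-- A meromorphic function with a nontrivial divisor is nowhere locally constant. -/
theorem eventually_ne_of_divisor [T1Space X] [PreconnectedSpace X] (hD : D ≠ 0) {c : ℂ} (hc : c ≠ 0) (x : X) :
    ∀ᶠ y in 𝓝[≠] x, φ y ≠ c := by
  have hNB : ∀ x, (𝓝[≠] x).NeBot := fun x => neBot_punctured (he x) (he0 x)
  have hdich : ∀ x, (∀ᶠ y in 𝓝[≠] x, φ y ≠ c) ∨ ∀ᶠ y in 𝓝 x, φ y = c := fun x => by
    rcases eventually_localExpr_ne_or_eq (hh x) (h0 x) hc with h1 | h1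
    · exact Or.inl (eventually_ne_of_localExpr D φ e he he0 h hφ (P := fun w => w ≠ c) h1)
    · right
      have h2 := (e x).continuousAt (he x)
      rw [ContinuousAt, he0] at h2
      filter_upwards [h2.eventually h1, hφ x] with y h3 h4
      rw [h4]; exact h3
  -- By the identity principle the set where `φ` is locally the constant `c` is open and closed. If
  -- it were everything, the expansions would have no zeros and no poles.
  have hcl : IsClopen {x | ∀ᶠ y in 𝓝 x, φ y = c} := by
    refine ⟨⟨?_⟩, isOpen_setOfPred_eventually_nhds⟩
    rw [isOpen_iff_mem_nhds]
    intro x hx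
    rcases hdich x with h1 | h1
    · have h2 := eventually_eventually_nhdsWithin.2 h1
      rw [eventually_nhdsWithin_iff] at h2
      filter_upwards [h2] with y hy hy'
      by_cases hyx : y = x
      · exact hx (hyx ▸ hy')
      · have h3 := hy hyx
        have hle : 𝓝[≠] y ≤ 𝓝 y := nhdsWithin_le_nhds
        have h4 : ∀ᶠ z in 𝓝[≠] y, φ z ≠ c := by
          have h5 := eventually_nhdsWithin_iff.1 h3
          filter_upwards [hle h5, hle (isOpen_ne.mem_nhds hyx)] with z hz hzx
          exact hz hzx
        obtain ⟨z, hz1, hz2⟩ := (h4.and (hle hy')).exists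
        exact hz1 hz2
    · exact absurd h1 hx
  rcases isClopen_iff.1 hcl with h1 | h1
  · exact (hdich x).resolve_right fun h2 => (h1 ▸ h2 : x ∈ (∅ : Set X))
  · exfalso
    refine hD (Finsupp.ext fun x => ?_)
    by_contra hx
    have h2 : ∀ᶠ y in 𝓝 x, φ y = c := (h1 ▸ mem_univ x : x ∈ {x | ∀ᶠ y in 𝓝 x, φ y = c})
    have h3 := (hφ x).self_of_nhds
    rw [h2.self_of_nhds, he0, zero_zpow _ hx, zero_mul] at h3
    exact hc h3

variable [CompactSpace X]

theorem finite_of_eventually_ne {c : ℂ} (hne : ∀ x, ∀ᶠ y in 𝓝[≠] x, φ y ≠ c) : {x | φ x = c}.Finite := by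
  obtain ⟨T, -, hT⟩ := isCompact_univ.elim_nhds_subcover (fun x => {y | y ≠ x → φ y ≠ c})
    fun x _ => eventually_nhdsWithin_iff.1 (hne x)
  refine T.finite_toSet.subset fun y hy => ?_
  obtain ⟨x, hx, hyx⟩ := mem_iUnion₂.1 (hT (mem_univ y))
  by_contra h0
  exact hyx (fun h1 => h0 (h1 ▸ hx)) hy

variable [T2Space X]

include he he0 hh h0 hφ in
theorem eventually_encard_fibre {c : ℂ} (hne : ∀ x, ∀ᶠ y in 𝓝[≠] x, φ y ≠ c) :
    ∃ d : ℕ, ∀ᶠ ε in 𝓝[≠] c, {x | φ x = ε}.encard = d := by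
  have h1 : ∀ x, ∃ m : ℕ, (φ x ≠ c → m = 0) ∧ HasLocalCount (localExpr (D x) (h x)) (𝓝[≠] c) m := fun x => by
    have hpos : ∀ p : ℕ, D x = p → ∃ m : ℕ, (φ x ≠ c → m = 0) ∧
        HasLocalCount (localExpr (D x) (h x)) (𝓝[≠] c) m := fun p hp => by
      have h2 := (analyticAt_localExpr (hh x) hp).sub (analyticAt_const (v := c))
      have h3 : ¬ ∀ᶠ τ in 𝓝 0, (localExpr (D x) (h x) - (fun _ => c : ℂ → ℂ)) τ = 0 := fun h4 => by
        have := neBot_punctured (he x) (he0 x)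
        obtain ⟨y, hy1, hy2, hy3⟩ := (((tendsto_punctured (he x) (he0 x)).eventually
          (nhdsWithin_le_nhds h4)).and ((hne x).and (nhdsWithin_le_nhds (hφ x)))).exists
        exact hy2 (hy3.trans (sub_eq_zero.1 hy1))
      obtain ⟨m, k, hk, hk0, hkf⟩ := h2.exists_eventuallyEq_pow_smul_nonzero_iff.2 h3
      simp only [sub_zero, smul_eq_mul] at hkf
      refine ⟨m, fun hxc => ?_, hasLocalCount_of_sub_eq hk hk0 hkf⟩
      by_contra hm
      have h5 := hkf.self_of_nhds
      rw [zero_pow hm, zero_mul] at h5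
      refine hxc ((hφ x).self_of_nhds.trans ?_)
      rw [he0]
      exact sub_eq_zero.1 h5
    obtain ⟨p, hp | hp⟩ := (D x).eq_nat_or_neg
    · exact hpos p hp
    · rcases eq_or_ne p 0 with rfl | hp0
      · exact hpos 0 (by simpa using hp)
      · exact ⟨0, fun _ => rfl, hasLocalCount_pole_level (hh x) (h0 x) (localExpr_neg hp) hp0 c⟩
  choose m hm0 hm using h1
  refine ⟨_, eventually_encard_eq_sum (fun ε => {x | φ x = ε}) m
    (finite_of_eventually_ne φ hne).toFinset (fun x hx => hm0 x ?_) fun x U hU =>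
      exists_nhds_encard_eq_of_chart (he x) (he0 x) (hφ x) (hm x) hU⟩
  simpa using hx

include he he0 hh h0 hφ in
theorem eventually_encard_fibre_zero :
    ∀ᶠ ε in 𝓝[≠] 0, {x | φ x = ε}.encard = (∑ x ∈ D.support, (D x).toNat : ℕ) := by
  refine eventually_encard_eq_sum (fun ε => {x | φ x = ε}) (fun x => (D x).toNat) D.support
    (fun x hx => by simp [Finsupp.notMem_support_iff.1 hx]) fun x U hU =>
      exists_nhds_encard_eq_of_chart (f := localExpr (D x) (h x)) (he x) (he0 x) (hφ x) ?_ hU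
  obtain ⟨p, hp | hp⟩ := (D x).eq_nat_or_neg
  · refine hasLocalCount_of_sub_eq (hh x) (h0 x) ?_
    filter_upwards [localExpr_natCast hp] with τ hτ
    rw [sub_zero, hτ, hp, Int.toNat_natCast]
  · have h1 : (D x).toNat = 0 := by omega
    rw [h1]
    rcases eq_or_ne p 0 with rfl | hp0
    · refine hasLocalCount_of_sub_eq (hh x) (h0 x) ?_
      filter_upwards [localExpr_natCast (p := 0) (by simpa using hp)] with τ hτ
      rw [sub_zero, hτ]
    · exact hasLocalCount_pole_level (hh x) (h0 x) (localExpr_neg hp) hp0 0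

include he he0 hh h0 hφ in
theorem eventually_encard_fibre_infinity :
    ∀ᶠ ε in Bornology.cobounded ℂ, {x | φ x = ε}.encard = (∑ x ∈ D.support, (-D x).toNat : ℕ) := by
  refine eventually_encard_eq_sum (fun ε => {x | φ x = ε}) (fun x => (-D x).toNat) D.support
    (fun x hx => by simp [Finsupp.notMem_support_iff.1 hx]) fun x U hU =>
      exists_nhds_encard_eq_of_chart (f := localExpr (D x) (h x)) (he x) (he0 x) (hφ x) ?_ hU
  obtain ⟨p, hp | hp⟩ := (D x).eq_nat_or_neg
  · have h1 : (-D x).toNat = 0 := by omega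
    rw [h1]
    exact eventually_bounded (analyticAt_localExpr (hh x) hp).continuousAt
  · have h1 : (-D x).toNat = p := by omega
    rw [h1]
    exact hasLocalCount_pole (hh x) (h0 x) (localExpr_neg hp)

include he he0 hh h0 hφ in
/-- The degree of the divisor of a meromorphic function on a compact Riemann surface vanishes. -/
theorem sum_ord_meromorphic_eq_zero [PreconnectedSpace X] : D.sum (fun _ m => m) = 0 := by
  rcases eq_or_ne D 0 with rfl | hD
  · simp
  have h1 : ∀ c, ∃ d : ℕ, (c = 0 → d = ∑ x ∈ D.support, (D x).toNat) ∧
      ∀ᶠ ε in 𝓝[≠] c, {x | φ x = ε}.encard = d := fun c => by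
    rcases eq_or_ne c 0 with rfl | hc
    · exact ⟨_, fun _ => rfl, eventually_encard_fibre_zero D φ e he he0 h hh h0 hφ⟩
    · obtain ⟨d, hd⟩ := eventually_encard_fibre D φ e he he0 h hh h0 hφ
        (eventually_ne_of_divisor D φ e he he0 h hh h0 hφ hD hc)
      exact ⟨d, fun h => absurd h hc, hd⟩
  choose d hd0 hd using h1
  -- A value near `c'` is also near `c` when `c'` is near `c`, so the two counts agree.
  have hloc : IsLocallyConstant d := by
    rw [IsLocallyConstant.iff_eventually_eq]
    intro c
    have h2 := eventually_nhdsWithin_iff.1 (eventually_eventually_nhdsWithin.2 (hd c))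
    filter_upwards [h2] with c' hc'
    by_cases h3 : c' = c
    · rw [h3]
    · have hle : 𝓝[≠] c' ≤ 𝓝 c' := nhdsWithin_le_nhds
      have h4 := (eventually_nhdsWithin_iff.1 (hc' h3)).filter_mono hle
      obtain ⟨ε, hε1, hε2, hε3⟩ := ((hd c').and (h4.and (hle (isOpen_ne.mem_nhds h3)))).exists
      have := hε1.symm.trans (hε2 hε3)
      exact_mod_cast this
  have hinf := eventually_encard_fibre_infinity D φ e he he0 h hh h0 hφ
  obtain ⟨R, hR⟩ : ∃ R : ℝ, ∀ ε : ℂ, R < ‖ε‖ → {x | φ x = ε}.encard = (∑ x ∈ D.support, (-D x).toNat : ℕ) := by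
    rw [← comap_norm_atTop, eventually_comap, eventually_atTop] at hinf
    obtain ⟨R, hR⟩ := hinf
    exact ⟨R, fun ε hε => hR _ hε.le ε rfl⟩
  obtain ⟨c, hc⟩ : ∃ c : ℂ, R < ‖c‖ := ⟨(|R| + 1 : ℝ), by
    rw [Complex.norm_real, Real.norm_of_nonneg (by positivity)]
    linarith [le_abs_self R]⟩
  have h5 : d c = ∑ x ∈ D.support, (-D x).toNat := by
    obtain ⟨ε, hε1, hε2⟩ := ((hd c).and (nhdsWithin_le_nhds
      (continuous_norm.continuousAt.eventually_const_lt hc))).exists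
    have := hε1.symm.trans (hR ε hε2)
    exact_mod_cast this
  -- The plane is connected, so the count near zero, the number of zeros, equals the count at large
  -- values, the number of poles.
  have h6 := hloc.apply_eq_of_preconnectedSpace c 0
  rw [h5, hd0 0 rfl] at h6
  have h7 : D.sum (fun _ m => m) = ((∑ x ∈ D.support, (D x).toNat : ℕ) : ℤ) -
      (∑ x ∈ D.support, (-D x).toNat : ℕ) := by
    rw [Finsupp.sum, Nat.cast_sum, Nat.cast_sum, ← Finset.sum_sub_distrib]
    refine Finset.sum_congr rfl fun x _ => ?_
    omega
  rw [h7, h6, sub_self]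

end DegreeOfMeromorphic

/-! ### Complex manifolds as locally ringed spaces -/

section ComplexManifold

open Filter Topology Set

/-- Complex affine space. -/
abbrev Cn (N : ℕ) := EuclideanSpace ℂ (Fin N)

variable {N : ℕ} {M : Type} [TopologicalSpace M] [ChartedSpace (Cn N) M]

/-- A complex manifold as a locally ringed space. -/
abbrev anSpace (N : ℕ) (M : Type) [TopologicalSpace M] [ChartedSpace (Cn N) M] :
    LocallyRingedSpace.{0} := ChartedSpace.locallyRingedSpace 𝓘(ℂ, Cn N) M

open Classical in
/-- The function underlying a section of the structure sheaf, extended by zero. -/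
def secFun {U : Opens (anSpace N M)} (s : Sec (anSpace N M) U) (x : M) : ℂ :=
  if h : x ∈ U then s.1 ⟨x, h⟩ else 0

theorem secFun_of_mem {U : Opens (anSpace N M)} (s : Sec (anSpace N M) U) {x : M} (h : x ∈ U) :
    secFun s x = s.1 ⟨x, h⟩ := dif_pos h

theorem secFun_add {U : Opens (anSpace N M)} (s t : Sec (anSpace N M) U) {x : M} (h : x ∈ U) :
    secFun (s + t) x = secFun s x + secFun t x := by
  simp only [secFun_of_mem _ h]; rfl

theorem secFun_mul {U : Opens (anSpace N M)} (s t : Sec (anSpace N M) U) {x : M} (h : x ∈ U) :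
    secFun (s * t) x = secFun s x * secFun t x := by
  simp only [secFun_of_mem _ h]; rfl

theorem secFun_one {U : Opens (anSpace N M)} {x : M} (h : x ∈ U) :
    secFun (1 : Sec (anSpace N M) U) x = 1 := by
  simp only [secFun_of_mem _ h]; rfl

theorem secFun_res {U V : Opens (anSpace N M)} (hV : V ≤ U) (s : Sec (anSpace N M) U) {x : M}
    (h : x ∈ V) : secFun (resSec hV s) x = secFun s x := by
  rw [secFun_of_mem _ h]
  exact (secFun_of_mem s (hV h)).symm

/-- The value of a germ. -/
abbrev evalGerm (x : M) : Loc (anSpace N M) x →+* ℂ :=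
  smoothSheafCommRing.eval 𝓘(ℂ, Cn N) 𝓘(ℂ) M ℂ x

theorem evalGerm_germAt {U : Opens (anSpace N M)} (s : Sec (anSpace N M) U) {x : M} (h : x ∈ U) :
    evalGerm (N := N) (M := M) x (germAt s x h) = secFun (M := M) s x := by
  refine Eq.trans ?_ (secFun_of_mem s h).symm
  exact smoothSheafCommRing.eval_germ (IM := 𝓘(ℂ, Cn N)) (I := 𝓘(ℂ)) (M := M) (R := ℂ) U x h s

theorem mem_maxI_iff {x : M} (g : Loc (anSpace N M) x) :
    g ∈ maxI (anSpace N M) x ↔ evalGerm x g = 0 := by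
  have h1 := smoothSheafCommRing.nonunits_stalk (IM := 𝓘(ℂ, Cn N)) (M := M) x
  exact (Set.ext_iff.1 h1 g)

theorem germAt_mem_maxI_iff {U : Opens (anSpace N M)} (s : Sec (anSpace N M) U) {x : M} (h : x ∈ U) :
    germAt s x h ∈ maxI (anSpace N M) x ↔ secFun s x = 0 := by
  rw [mem_maxI_iff, evalGerm_germAt]

theorem germAt_eq_iff {U V : Opens (anSpace N M)} (s : Sec (anSpace N M) U) (t : Sec (anSpace N M) V)
    {x : M} (hU : x ∈ U) (hV : x ∈ V) :
    germAt s x hU = germAt t x hV ↔ secFun s =ᶠ[𝓝 x] secFun t := by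
  constructor
  · intro h
    obtain ⟨W, hxW, i, j, hij⟩ := (anSpace N M).presheaf.germ_eq x hU hV s t h
    filter_upwards [W.2.mem_nhds hxW] with y hy
    have h1 : resSec (leOfHom i) s = resSec (leOfHom j) t := hij
    rw [← secFun_res (leOfHom i) s hy, h1, secFun_res (leOfHom j) t hy]
  · intro h
    obtain ⟨W, hW, hWo, hxW⟩ := mem_nhds_iff.1 h
    let W' : Opens (anSpace N M) := ⟨W, hWo⟩ ⊓ (U ⊓ V)
    have h1 : W' ≤ U := inf_le_right.trans inf_le_left
    have h2 : W' ≤ V := inf_le_right.trans inf_le_right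
    have h3 : resSec h1 s = resSec h2 t := by
      refine Subtype.ext (funext fun y => ?_)
      have h4 := hW y.2.1
      have h5 : secFun (resSec h1 s) y.1 = secFun (resSec h2 t) y.1 := by
        rw [secFun_res h1 s y.2, secFun_res h2 t y.2]; exact h4
      rw [secFun_of_mem _ y.2, secFun_of_mem _ y.2] at h5
      exact h5
    rw [← germAt_resSec h1 s x ⟨hxW, hU, hV⟩, h3, germAt_resSec h2 t x ⟨hxW, hU, hV⟩]

theorem contMDiff_restrict {U : Opens M} {f : M → ℂ} (hf : ContMDiffOn 𝓘(ℂ, Cn N) 𝓘(ℂ) ∞ f U) :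
    ContMDiff 𝓘(ℂ, Cn N) 𝓘(ℂ) ∞ (fun x : U => f x) := fun x =>
  contMDiffAt_subtype_iff.2 (hf.contMDiffAt (U.2.mem_nhds x.2))

/-- The section given by a holomorphic function. -/
def mkSec (U : Opens M) (f : M → ℂ) (hf : ContMDiffOn 𝓘(ℂ, Cn N) 𝓘(ℂ) ∞ f U) :
    Sec (anSpace N M) U :=
  let s : ContMDiffMap 𝓘(ℂ, Cn N) 𝓘(ℂ) U ℂ ∞ := ⟨fun x => f x, contMDiff_restrict hf⟩
  s

theorem secFun_mkSec {U : Opens M} {f : M → ℂ} (hf : ContMDiffOn 𝓘(ℂ, Cn N) 𝓘(ℂ) ∞ f U) {x : M}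
    (h : x ∈ U) : secFun (mkSec U f hf) x = f x := by
  rw [secFun_of_mem _ h]; rfl

theorem contMDiffAt_secFun {U : Opens (anSpace N M)} (s : Sec (anSpace N M) U) {x : M} (h : x ∈ U) :
    ContMDiffAt 𝓘(ℂ, Cn N) 𝓘(ℂ) ∞ (secFun (M := M) s) x := by
  have key : ∀ (V : Opens M) (s' : ContMDiffMap 𝓘(ℂ, Cn N) 𝓘(ℂ) V ℂ ∞) (f : M → ℂ) (hx : x ∈ V),
      (∀ y : V, f y = s' y) → ContMDiffAt 𝓘(ℂ, Cn N) 𝓘(ℂ) ∞ f x := by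
    intro V s' f hx hf
    refine (contMDiffAt_subtype_iff (U := V) (x := ⟨x, hx⟩)).1 ?_
    rw [show (fun y : V => f y) = s' from funext hf]
    exact s'.contMDiff.contMDiffAt
  exact key U s _ h fun y => secFun_of_mem (M := M) s y.2

end ComplexManifold

/-! ### Germs represented by holomorphic functions -/

section HolomorphicGerms

open Filter Topology Set

variable {N : ℕ} {M : Type} [TopologicalSpace M] [ChartedSpace (Cn N) M]

/-- A function that is holomorphic near `x`. -/
def HolAt (N : ℕ) {M : Type} [TopologicalSpace M] [ChartedSpace (Cn N) M] (x : M) (f : M → ℂ) :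
    Prop :=
  ∀ᶠ y in 𝓝 x, ContMDiffAt 𝓘(ℂ, Cn N) 𝓘(ℂ) ∞ f y

variable {x : M} {f g : M → ℂ}

theorem HolAt.contMDiffAt (hf : HolAt N x f) : ContMDiffAt 𝓘(ℂ, Cn N) 𝓘(ℂ) ∞ f x :=
  hf.self_of_nhds

theorem HolAt.add (hf : HolAt N x f) (hg : HolAt N x g) : HolAt N x (f + g) := by
  filter_upwards [hf, hg] with y h1 h2 using h1.add h2

theorem HolAt.mul (hf : HolAt N x f) (hg : HolAt N x g) : HolAt N x (f * g) := by
  filter_upwards [hf, hg] with y h1 h2 using h1.mul h2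

theorem HolAt.sub (hf : HolAt N x f) (hg : HolAt N x g) : HolAt N x (f - g) := by
  filter_upwards [hf, hg] with y h1 h2 using h1.sub h2

theorem holAt_const (c : ℂ) : HolAt N x (fun _ => c) :=
  Eventually.of_forall fun _ => contMDiffAt_const

theorem holAt_secFun {U : Opens (anSpace N M)} (s : Sec (anSpace N M) U) (h : x ∈ U) :
    HolAt N x (secFun (M := M) s) := by
  filter_upwards [U.2.mem_nhds h] with y hy using contMDiffAt_secFun s hy

/-- An open neighbourhood on which a function is holomorphic. -/
theorem HolAt.exists_opens (hf : HolAt N x f) :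
    ∃ U : Opens M, x ∈ U ∧ ContMDiffOn 𝓘(ℂ, Cn N) 𝓘(ℂ) ∞ f U := by
  obtain ⟨W, hW, hWo, hxW⟩ := mem_nhds_iff.1 hf
  exact ⟨⟨W, hWo⟩, hxW, fun y hy => (hW hy).contMDiffWithinAt⟩

theorem exists_toGerm (hf : HolAt N x f) : ∃ a : Loc (anSpace N M) x,
    ∀ (U : Opens (anSpace N M)) (s : Sec (anSpace N M) U) (h : x ∈ U),
      germAt s x h = a ↔ secFun (M := M) s =ᶠ[𝓝 x] f := by
  obtain ⟨V, hxV, hV⟩ := hf.exists_opens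
  refine ⟨germAt (mkSec V f hV) x hxV, fun U s h => ?_⟩
  rw [germAt_eq_iff]
  have h1 : secFun (M := M) (mkSec V f hV) =ᶠ[𝓝 x] f := by
    filter_upwards [V.2.mem_nhds hxV] with y hy using secFun_mkSec hV hy
  exact ⟨fun h2 => h2.trans h1, fun h2 => h2.trans h1.symm⟩

/-- The germ of a holomorphic function. -/
def toGerm (hf : HolAt N x f) : Loc (anSpace N M) x := (exists_toGerm hf).choose

theorem germAt_eq_toGerm_iff (hf : HolAt N x f) {U : Opens (anSpace N M)} (s : Sec (anSpace N M) U)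
    (h : x ∈ U) : germAt s x h = toGerm hf ↔ secFun (M := M) s =ᶠ[𝓝 x] f :=
  (exists_toGerm hf).choose_spec U s h

theorem germAt_eq_toGerm {U : Opens (anSpace N M)} (s : Sec (anSpace N M) U) (h : x ∈ U) :
    germAt s x h = toGerm (holAt_secFun s h) :=
  (germAt_eq_toGerm_iff _ s h).2 (EventuallyEq.refl _ _)

theorem exists_eq_toGerm (a : Loc (anSpace N M) x) : ∃ (f : M → ℂ) (hf : HolAt N x f),
    toGerm hf = a := by
  obtain ⟨V, hV, t, rfl⟩ := (anSpace N M).presheaf.exists_germ_eq a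
  exact ⟨_, holAt_secFun t hV, (germAt_eq_toGerm t hV).symm⟩

theorem exists_germAt_eq_toGerm (hf : HolAt N x f) :
    ∃ (U : Opens (anSpace N M)) (h : x ∈ U) (s : Sec (anSpace N M) U), germAt s x h = toGerm hf ∧
      ∀ y ∈ U, secFun (M := M) s y = f y := by
  obtain ⟨V, hxV, hV⟩ := hf.exists_opens
  have h1 : ∀ y ∈ V, secFun (M := M) (mkSec V f hV) y = f y := fun y hy => secFun_mkSec hV hy
  exact ⟨V, hxV, mkSec V f hV, (germAt_eq_toGerm_iff hf _ hxV).2 (by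
    filter_upwards [V.2.mem_nhds hxV] with y hy using h1 y hy), h1⟩

theorem toGerm_eq_iff (hf : HolAt N x f) (hg : HolAt N x g) :
    toGerm hf = toGerm hg ↔ f =ᶠ[𝓝 x] g := by
  obtain ⟨V, hV, t, ht, h1⟩ := exists_germAt_eq_toGerm hf
  have h2 : secFun (M := M) t =ᶠ[𝓝 x] f := by
    filter_upwards [V.2.mem_nhds hV] with y hy using h1 y hy
  rw [← ht, germAt_eq_toGerm_iff]
  exact ⟨fun h => h2.symm.trans h, fun h => h2.trans h⟩

theorem toGerm_add (hf : HolAt N x f) (hg : HolAt N x g) :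
    toGerm (hf.add hg) = toGerm hf + toGerm hg := by
  obtain ⟨U, hU, s, hs, h1⟩ := exists_germAt_eq_toGerm hf
  obtain ⟨V, hV, t, ht, h2⟩ := exists_germAt_eq_toGerm hg
  have hUV : x ∈ U ⊓ V := ⟨hU, hV⟩
  have h3 := germAt_add (resSec (inf_le_left : U ⊓ V ≤ U) s) (resSec (inf_le_right : U ⊓ V ≤ V) t)
    x hUV
  rw [germAt_resSec, germAt_resSec] at h3
  rw [← hs, ← ht]
  refine Eq.trans ((germAt_eq_toGerm_iff _ _ hUV).2 ?_).symm h3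
  filter_upwards [(U ⊓ V).2.mem_nhds hUV] with y hy
  refine (secFun_add (M := M) _ _ hy).trans ?_
  rw [secFun_res _ _ hy, secFun_res _ _ hy, h1 y hy.1, h2 y hy.2]; rfl

theorem toGerm_mul (hf : HolAt N x f) (hg : HolAt N x g) :
    toGerm (hf.mul hg) = toGerm hf * toGerm hg := by
  obtain ⟨U, hU, s, hs, h1⟩ := exists_germAt_eq_toGerm hf
  obtain ⟨V, hV, t, ht, h2⟩ := exists_germAt_eq_toGerm hg
  have hUV : x ∈ U ⊓ V := ⟨hU, hV⟩
  have h3 := germAt_mul (resSec (inf_le_left : U ⊓ V ≤ U) s) (resSec (inf_le_right : U ⊓ V ≤ V) t)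
    x hUV
  rw [germAt_resSec, germAt_resSec] at h3
  rw [← hs, ← ht]
  refine Eq.trans ((germAt_eq_toGerm_iff _ _ hUV).2 ?_).symm h3
  filter_upwards [(U ⊓ V).2.mem_nhds hUV] with y hy
  refine (secFun_mul (M := M) _ _ hy).trans ?_
  rw [secFun_res _ _ hy, secFun_res _ _ hy, h1 y hy.1, h2 y hy.2]; rfl

theorem toGerm_one : toGerm (holAt_const (N := N) (x := x) 1) = 1 := by
  have h := (germAt_eq_toGerm_iff (holAt_const (N := N) (x := x) 1)
    (1 : Sec (anSpace N M) ⊤) (show x ∈ (⊤ : Opens (anSpace N M)) from trivial)).2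
    (Eventually.of_forall fun y => secFun_one (M := M) (by trivial))
  rw [← h, germAt_one]

theorem toGerm_zero : toGerm (holAt_const (N := N) (x := x) 0) = 0 := by
  have h := toGerm_add (holAt_const (N := N) (x := x) 0) (holAt_const (N := N) (x := x) 0)
  rw [(toGerm_eq_iff _ (holAt_const (N := N) (x := x) 0)).2
    (Eventually.of_forall fun y => add_zero _)] at h
  exact left_eq_add.1 h

theorem toGerm_sub (hf : HolAt N x f) (hg : HolAt N x g) :
    toGerm (hf.sub hg) = toGerm hf - toGerm hg := by
  rw [eq_sub_iff_add_eq, ← toGerm_add, toGerm_eq_iff]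
  exact Eventually.of_forall fun y => sub_add_cancel _ _

theorem evalGerm_toGerm (hf : HolAt N x f) : evalGerm (N := N) x (toGerm hf) = f x := by
  obtain ⟨U, hU, s, hs, h1⟩ := exists_germAt_eq_toGerm hf
  rw [← hs]
  exact (evalGerm_germAt s hU).trans (h1 x hU)

theorem toGerm_mem_maxI_iff (hf : HolAt N x f) :
    toGerm hf ∈ maxI (anSpace N M) x ↔ f x = 0 :=
  (mem_maxI_iff _).trans (by rw [evalGerm_toGerm])

theorem toGerm_mem_idealAt_iff (hf : HolAt N x f) (Z : Set M) :
    toGerm hf ∈ idealAt (anSpace N M) Z x ↔ ∀ᶠ y in 𝓝 x, y ∈ Z → f y = 0 := by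
  obtain ⟨U, hU, s, hs, h1⟩ := exists_germAt_eq_toGerm hf
  rw [← hs]
  constructor
  · intro h
    obtain ⟨V, hV, hxV, h2⟩ := exists_of_mem_idealAt hU h
    filter_upwards [V.2.mem_nhds hxV] with y hy hyZ
    rw [← h1 y (hV hy)]
    exact (germAt_mem_maxI_iff s (hV hy)).1 (h2 y hy hyZ)
  · intro h
    obtain ⟨W, hW, hWo, hxW⟩ := mem_nhds_iff.1 h
    let V : Opens (anSpace N M) := ⟨W, hWo⟩ ⊓ U
    rw [← germAt_resSec (inf_le_right : V ≤ U) s x ⟨hxW, hU⟩]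
    refine mem_idealAt _ _ fun w hw hwZ => ?_
    rw [germAt_resSec]
    exact (germAt_mem_maxI_iff s hw.2).2 ((h1 w hw.2).trans (hW hw.1 hwZ))

end HolomorphicGerms

/-! ### Directional derivatives as derivations of the local ring -/

section HolomorphicDerivations

open Filter Topology Set

variable {N : ℕ} {M : Type} [TopologicalSpace M] [ChartedSpace (Cn N) M]

theorem contMDiffAt_chartAt_iff [IsManifold 𝓘(ℂ, Cn N) ∞ M] {x y : M} {f : M → ℂ}
    (hy : y ∈ (chartAt (Cn N) x).source) :
    ContMDiffAt 𝓘(ℂ, Cn N) 𝓘(ℂ) ∞ f y ↔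
      ContDiffAt ℂ ∞ (f ∘ (chartAt (Cn N) x).symm) (chartAt (Cn N) x y) := by
  rw [← contMDiffAt_iff_contDiffAt]
  set φ := chartAt (Cn N) x
  have h1 : ContMDiffAt 𝓘(ℂ, Cn N) 𝓘(ℂ, Cn N) ∞ φ y :=
    contMDiffAt_of_mem_maximalAtlas (IsManifold.chart_mem_maximalAtlas x) hy
  have h2 : ContMDiffAt 𝓘(ℂ, Cn N) 𝓘(ℂ, Cn N) ∞ φ.symm (φ y) :=
    contMDiffAt_symm_of_mem_maximalAtlas (IsManifold.chart_mem_maximalAtlas x) (φ.map_source hy)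
  constructor
  · intro h
    refine ContMDiffAt.comp (φ y) (I' := 𝓘(ℂ, Cn N)) ?_ h2
    rwa [φ.left_inv hy]
  · intro h
    refine (h.comp y h1).congr_of_eventuallyEq ?_
    filter_upwards [φ.open_source.mem_nhds hy] with w hw
    simp [φ.left_inv hw]

/-- A directional derivative in the chart at `x`. -/
def chartDeriv (x : M) (v : Cn N) (f : M → ℂ) (y : M) : ℂ :=
  fderiv ℂ (f ∘ (chartAt (Cn N) x).symm) (chartAt (Cn N) x y) v

theorem contMDiffAt_chartDeriv [IsManifold 𝓘(ℂ, Cn N) ∞ M] {x y : M} (v : Cn N) {f : M → ℂ}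
    (hy : y ∈ (chartAt (Cn N) x).source) (hf : ContMDiffAt 𝓘(ℂ, Cn N) 𝓘(ℂ) ∞ f y) :
    ContMDiffAt 𝓘(ℂ, Cn N) 𝓘(ℂ) ∞ (chartDeriv x v f) y := by
  have h1 := ((contMDiffAt_chartAt_iff hy).1 hf).fderiv_right (m := ∞) (by simp)
  have h2 : ContDiffAt ℂ ∞ (fun w => fderiv ℂ (f ∘ (chartAt (Cn N) x).symm) w v)
      (chartAt (Cn N) x y) := h1.clm_apply contDiffAt_const
  exact h2.contMDiffAt.comp y
    (contMDiffAt_of_mem_maximalAtlas (IsManifold.chart_mem_maximalAtlas x) hy)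

theorem HolAt.chartDeriv [IsManifold 𝓘(ℂ, Cn N) ∞ M] {x : M} (v : Cn N) {f : M → ℂ}
    (hf : HolAt N x f) : HolAt N x (chartDeriv x v f) := by
  filter_upwards [hf, (chartAt (Cn N) x).open_source.mem_nhds (mem_chart_source _ x)] with y h1 h2
  exact contMDiffAt_chartDeriv v h2 h1

theorem differentiableAt_chart [IsManifold 𝓘(ℂ, Cn N) ∞ M] {x y : M} {f : M → ℂ}
    (hy : y ∈ (chartAt (Cn N) x).source) (hf : ContMDiffAt 𝓘(ℂ, Cn N) 𝓘(ℂ) ∞ f y) :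
    DifferentiableAt ℂ (f ∘ (chartAt (Cn N) x).symm) (chartAt (Cn N) x y) :=
  ((contMDiffAt_chartAt_iff hy).1 hf).differentiableAt (by simp)

theorem chartDeriv_add [IsManifold 𝓘(ℂ, Cn N) ∞ M] {x y : M} (v : Cn N) {f g : M → ℂ}
    (hy : y ∈ (chartAt (Cn N) x).source) (hf : ContMDiffAt 𝓘(ℂ, Cn N) 𝓘(ℂ) ∞ f y)
    (hg : ContMDiffAt 𝓘(ℂ, Cn N) 𝓘(ℂ) ∞ g y) :
    chartDeriv x v (f + g) y = chartDeriv x v f y + chartDeriv x v g y := by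
  have h1 := fderiv_add (differentiableAt_chart hy hf) (differentiableAt_chart hy hg)
  have h2 := congrArg (fun L => L v) h1
  exact h2

theorem chartDeriv_mul [IsManifold 𝓘(ℂ, Cn N) ∞ M] {x y : M} (v : Cn N) {f g : M → ℂ}
    (hy : y ∈ (chartAt (Cn N) x).source) (hf : ContMDiffAt 𝓘(ℂ, Cn N) 𝓘(ℂ) ∞ f y)
    (hg : ContMDiffAt 𝓘(ℂ, Cn N) 𝓘(ℂ) ∞ g y) :
    chartDeriv x v (f * g) y = f y * chartDeriv x v g y + g y * chartDeriv x v f y := by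
  have h1 := fderiv_mul (differentiableAt_chart hy hf) (differentiableAt_chart hy hg)
  have h2 := congrArg (fun L => L v) h1
  have h3 : (f * g) ∘ (chartAt (Cn N) x).symm =
      f ∘ (chartAt (Cn N) x).symm * g ∘ (chartAt (Cn N) x).symm := rfl
  simpa [chartDeriv, h3, (chartAt (Cn N) x).left_inv hy] using h2

theorem chartDeriv_congr {x : M} (v : Cn N) {f g : M → ℂ} (h : f =ᶠ[𝓝 x] g) :
    chartDeriv x v f =ᶠ[𝓝 x] chartDeriv x v g := by
  filter_upwards [h.eventually_nhds,
    (chartAt (Cn N) x).open_source.mem_nhds (mem_chart_source _ x)] with y h1 h2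
  refine congrArg (fun L : Cn N →L[ℂ] ℂ => L v) (Filter.EventuallyEq.fderiv_eq ?_)
  have h3 := (chartAt (Cn N) x).symm.continuousAt ((chartAt (Cn N) x).map_source h2)
  rw [ContinuousAt, (chartAt (Cn N) x).left_inv h2] at h3
  exact h3.eventually h1

/-- The derivation of the ring of germs given by a directional derivative. -/
theorem exists_derivation [IsManifold 𝓘(ℂ, Cn N) ∞ M] (x : M) (v : Cn N) :
    ∃ D : Derivation ℤ (Loc (anSpace N M) x) (Loc (anSpace N M) x),
      ∀ (f : M → ℂ) (hf : HolAt N x f), D (toGerm hf) = toGerm (hf.chartDeriv v) := by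
  choose f hf hfa using fun a : Loc (anSpace N M) x => exists_eq_toGerm (N := N) (M := M) a
  -- Defined through a chosen representative; the result depends only on the germ because
  -- differentiation is local.
  let D₀ : Loc (anSpace N M) x → Loc (anSpace N M) x := fun a => toGerm ((hf a).chartDeriv v)
  have hs := (chartAt (Cn N) x).open_source.mem_nhds (mem_chart_source _ x)
  have hD : ∀ (g : M → ℂ) (hg : HolAt N x g), D₀ (toGerm hg) = toGerm (hg.chartDeriv v) :=
    fun g hg => (toGerm_eq_iff _ _).2 (chartDeriv_congr v ((toGerm_eq_iff _ _).1 (hfa _)))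
  have hadd : ∀ a b, D₀ (a + b) = D₀ a + D₀ b := by
    intro a b
    rw [← hfa a, ← hfa b, ← toGerm_add, hD, hD, hD, ← toGerm_add, toGerm_eq_iff]
    filter_upwards [hs, hf a, hf b] with y h1 h2 h3 using chartDeriv_add v h1 h2 h3
  have hmul : ∀ a b, D₀ (a * b) = a • D₀ b + b • D₀ a := by
    intro a b
    rw [← hfa a, ← hfa b, ← toGerm_mul, hD, hD, hD, smul_eq_mul, smul_eq_mul, ← toGerm_mul,
      ← toGerm_mul, ← toGerm_add, toGerm_eq_iff]
    filter_upwards [hs, hf a, hf b] with y h1 h2 h3 using chartDeriv_mul v h1 h2 h3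
  exact ⟨Derivation.mk' (AddMonoidHom.mk' D₀ hadd).toIntLinearMap hmul, hD⟩

/-- The coordinates of the chart at `x`, vanishing at `x`. -/
def chartCoord (x : M) (j : Fin N) (y : M) : ℂ := (chartAt (Cn N) x y - chartAt (Cn N) x x) j

theorem holAt_chartCoord [IsManifold 𝓘(ℂ, Cn N) ∞ M] (x : M) (j : Fin N) :
    HolAt N x (chartCoord x j) := by
  filter_upwards [(chartAt (Cn N) x).open_source.mem_nhds (mem_chart_source _ x)] with y hy
  have h1 : ContMDiffAt 𝓘(ℂ, Cn N) 𝓘(ℂ, Cn N) ∞ (chartAt (Cn N) x) y :=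
    contMDiffAt_of_mem_maximalAtlas (IsManifold.chart_mem_maximalAtlas x) hy
  have h2 : ContDiff ℂ ∞ (fun v : Cn N => (v - chartAt (Cn N) x x) j) :=
    (EuclideanSpace.proj (𝕜 := ℂ) j).contDiff.comp (contDiff_id.sub contDiff_const)
  exact h2.contMDiff.contMDiffAt.comp y h1

theorem chartDeriv_chartCoord (x : M) (v : Cn N) (j : Fin N) :
    chartDeriv x v (chartCoord x j) x = v j := by
  set φ := chartAt (Cn N) x
  have h1 : (chartCoord x j) ∘ φ.symm =ᶠ[𝓝 (φ x)]
      fun w => EuclideanSpace.proj (𝕜 := ℂ) j (w - φ x) := by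
    filter_upwards [φ.open_target.mem_nhds (φ.map_source (mem_chart_source _ x))] with w hw
    change (φ (φ.symm w) - φ x) j = _
    rw [φ.right_inv hw]; rfl
  have h2 : HasFDerivAt (fun w : Cn N => EuclideanSpace.proj (𝕜 := ℂ) j (w - φ x))
      (EuclideanSpace.proj (𝕜 := ℂ) j : Cn N →L[ℂ] ℂ) (φ x) := by
    exact (EuclideanSpace.proj (𝕜 := ℂ) j : Cn N →L[ℂ] ℂ).hasFDerivAt.comp (φ x)
      ((hasFDerivAt_id (φ x)).sub_const (φ x))
  rw [chartDeriv, h1.fderiv_eq, h2.fderiv]; rfl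

theorem hasCoordinates_anSpace [IsManifold 𝓘(ℂ, Cn N) ∞ M] (x : M) :
    HasCoordinates N (Loc (anSpace N M) x) := by
  choose D hD using fun j : Fin N => exists_derivation (N := N) (M := M) x (EuclideanSpace.single j 1)
  refine ⟨D, fun j => toGerm (holAt_chartCoord x j), fun i => ?_, fun i j => ?_⟩
  · refine (toGerm_mem_maxI_iff _).2 ?_
    simp [chartCoord]
  · have h1 : (if i = j then 1 else 0 : Loc (anSpace N M) x) =
        toGerm (holAt_const (N := N) (x := x) (if i = j then 1 else 0)) := by
      split_ifs
      · exact toGerm_one.symm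
      · exact toGerm_zero.symm
    rw [hD, h1, ← toGerm_sub]
    refine (toGerm_mem_maxI_iff _).2 ?_
    simp [chartDeriv_chartCoord, eq_comm]

/-- Evaluation at `x` shows that constants represent all residue classes, so the residue field is
`ℂ`. -/
theorem isAlgClosed_anSpace (x : M) :
    IsAlgClosed (IsLocalRing.ResidueField (Loc (anSpace N M) x)) := by
  let c : ℂ →+* Loc (anSpace N M) x :=
    { toFun := fun z => toGerm (holAt_const z)
      map_one' := toGerm_one
      map_zero' := toGerm_zero
      map_mul' := fun a b => toGerm_mul (holAt_const a) (holAt_const b)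
      map_add' := fun a b => toGerm_add (holAt_const a) (holAt_const b) }
  refine isAlgClosed_of_surjective ((IsLocalRing.residue _).comp c) fun b => ?_
  obtain ⟨a, rfl⟩ := IsLocalRing.residue_surjective b
  obtain ⟨f, hf, rfl⟩ := exists_eq_toGerm (N := N) (M := M) a
  refine ⟨f x, ?_⟩
  rw [RingHom.comp_apply, eq_comm, ← sub_eq_zero, ← map_sub, IsLocalRing.residue_eq_zero_iff]
  exact (mem_maxI_iff _).2 (by
    rw [map_sub, evalGerm_toGerm]
    exact sub_eq_zero.2 (evalGerm_toGerm (holAt_const (f x))).symm)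

theorem isSmoothAlong_anSpace [T1Space M] [IsManifold 𝓘(ℂ, Cn N) ∞ M] (Z : Set M) :
    IsSmoothAlong (anSpace N M) N Z where
  isUnit_natCast x _ _ k hk := by
    by_contra h
    have h1 := (mem_maxI_iff (N := N) (M := M) (x := x) _).1 ((IsLocalRing.mem_maximalIdeal _).2 h)
    rw [map_natCast] at h1
    exact hk (by exact_mod_cast h1)
  isAlgClosed x _ _ := isAlgClosed_anSpace (M := M) x
  coordinates x _ _ := hasCoordinates_anSpace (M := M) x
  dense U s h w hw hwZ := h w hw hwZ (isClosed_singleton (X := M))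

end HolomorphicDerivations

/-! ### Charts of a smooth curve by the inverse function theorem -/

section CurveChart

open Filter Topology Set

open Classical in
/-- A chart of a subset that a homeomorphism identifies with a slice. -/
def sliceChart {X E F : Type*} [TopologicalSpace X] [TopologicalSpace E] [TopologicalSpace F]
    [Zero F] (Θ : OpenPartialHomeomorph X (E × F)) (Z : Set X) (z : Z)
    (h : ∀ y ∈ Θ.source, y ∈ Z ↔ (Θ y).2 = 0) : OpenPartialHomeomorph Z E where
  toFun y := (Θ y).1
  -- The point `z` is only a default value; on the target the condition always holds.
  invFun c := if hc : Θ.symm (c, 0) ∈ Z then ⟨_, hc⟩ else z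
  source := {y | (y : X) ∈ Θ.source}
  target := {c | (c, 0) ∈ Θ.target}
  map_source' y hy := by
    have h1 : ((Θ y).1, (0 : F)) = Θ y := Prod.ext rfl ((h y hy).1 y.2).symm
    simpa only [mem_ofPred_eq, h1] using Θ.map_source hy
  map_target' c hc := by
    have h1 : Θ.symm (c, 0) ∈ Z := (h _ (Θ.map_target hc)).2 (by rw [Θ.right_inv hc])
    simpa only [mem_ofPred_eq, dif_pos h1] using Θ.map_target hc
  left_inv' y hy := by
    have h1 : ((Θ y).1, (0 : F)) = Θ y := Prod.ext rfl ((h y hy).1 y.2).symm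
    have h2 : Θ.symm ((Θ y).1, (0 : F)) = y := by rw [h1, Θ.left_inv hy]
    have h3 : Θ.symm ((Θ y).1, (0 : F)) ∈ Z := by rw [h2]; exact y.2
    rw [dif_pos h3]
    exact Subtype.ext h2
  right_inv' c hc := by
    have h1 : Θ.symm (c, 0) ∈ Z := (h _ (Θ.map_target hc)).2 (by rw [Θ.right_inv hc])
    simp only [dif_pos h1]
    rw [Θ.right_inv hc]
  continuousOn_toFun := continuous_fst.comp_continuousOn
    (Θ.continuousOn.comp continuous_subtype_val.continuousOn fun _ hy => hy)
  continuousOn_invFun := by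
    rw [IsInducing.subtypeVal.continuousOn_iff]
    refine (Θ.continuousOn_symm.comp (f := fun c : E => (c, (0 : F)))
      (by fun_prop) fun c hc => hc).congr fun c hc => ?_
    have h1 : Θ.symm (c, 0) ∈ Z := (h _ (Θ.map_target hc)).2 (by rw [Θ.right_inv hc])
    simp only [Function.comp_apply, dif_pos h1]
  open_source := Θ.open_source.preimage continuous_subtype_val
  open_target := Θ.open_target.preimage (by fun_prop)

variable {n : ℕ} {M : Type} [TopologicalSpace M] [ChartedSpace (Cn (n + 1)) M]
  [IsManifold 𝓘(ℂ, Cn (n + 1)) ∞ M]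

/-- A vector annihilated by the differentials of generators of the maximal ideal is zero. -/
theorem eq_zero_of_chartDeriv_eq_zero {z : M} {S : Set (M → ℂ)} (hS : ∀ f ∈ S, HolAt (n + 1) z f)
    (hspan : maxI (anSpace (n + 1) M) z ≤
      Ideal.span {a | ∃ (f : M → ℂ) (hf : f ∈ S), toGerm (hS f hf) = a})
    (hS0 : ∀ f ∈ S, f z = 0) {v : Cn (n + 1)} (hv : ∀ f ∈ S, chartDeriv z v f z = 0) : v = 0 := by
  obtain ⟨D, hD⟩ := exists_derivation (M := M) z v
  have key : ∀ a ∈ Ideal.span {a | ∃ (f : M → ℂ) (hf : f ∈ S), toGerm (hS f hf) = a},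
      evalGerm z a = 0 ∧ evalGerm z (D a) = 0 := by
    intro a ha
    induction ha using Submodule.span_induction with
    | mem a ha =>
      obtain ⟨f, hf, rfl⟩ := ha
      rw [hD, evalGerm_toGerm, evalGerm_toGerm]
      exact ⟨hS0 f hf, hv f hf⟩
    | zero => simp
    | add a b _ _ ha hb =>
      rw [map_add, map_add, map_add, ha.1, ha.2, hb.1, hb.2, add_zero]
      exact ⟨rfl, rfl⟩
    | smul a b _ hb =>
      rw [smul_eq_mul, Derivation.leibniz, map_mul, map_add, smul_eq_mul, smul_eq_mul, map_mul,
        map_mul, hb.1, hb.2]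
      simp
  ext j
  -- By the Leibniz rule the derivative along `v` of every function vanishing at `z` is zero there;
  -- for the chart coordinates these derivatives are the entries of `v`.
  have h1 := (key _ (hspan ((toGerm_mem_maxI_iff (holAt_chartCoord z j)).2
    (by simp [chartCoord])))).2
  rw [hD, evalGerm_toGerm, chartDeriv_chartCoord] at h1
  exact h1

/-- A smooth curve in a complex manifold has charts in which holomorphic functions are analytic. -/
theorem exists_curve_chart {Z : Set M} (z : Z) {f : Fin n → M → ℂ} {t : M → ℂ}
    (hf : ∀ i, HolAt (n + 1) (z : M) (f i)) (ht : HolAt (n + 1) (z : M) t) (ht0 : t z = 0)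
    (hZ : ∀ᶠ y in 𝓝 (z : M), y ∈ Z ↔ ∀ i, f i y = 0)
    (hspan : maxI (anSpace (n + 1) M) z.1 ≤
      Ideal.span (range fun i => toGerm (hf i)) ⊔ Ideal.span {toGerm ht}) :
    ∃ e : OpenPartialHomeomorph Z ℂ, z ∈ e.source ∧ (∀ y ∈ e.source, e y = t y) ∧
      ∀ g : M → ℂ, HolAt (n + 1) (z : M) g →
        ∃ h : ℂ → ℂ, AnalyticAt ℂ h 0 ∧ ∀ᶠ y : Z in 𝓝 z, g y = h (e y) := by
  set φ := chartAt (Cn (n + 1)) (z : M)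
  have hzφ : (z : M) ∈ φ.source := mem_chart_source _ _
  let Ψ : Cn (n + 1) → ℂ × (Fin n → ℂ) := fun v => (t (φ.symm v), fun i => f i (φ.symm v))
  have hΨ : ContDiffAt ℂ 1 Ψ (φ z) := by
    refine ContDiffAt.of_le ?_ (show (1 : WithTop ℕ∞) ≤ ∞ by exact_mod_cast le_top)
    exact ((contMDiffAt_chartAt_iff hzφ).1 ht.contMDiffAt).prodMk
      (contDiffAt_pi.2 fun i => (contMDiffAt_chartAt_iff hzφ).1 (hf i).contMDiffAt)
  have hΨd := (hΨ.differentiableAt (by simp)).hasFDerivAt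
  set A := fderiv ℂ Ψ (φ z)
  have hA : HasFDerivAt Ψ A (φ z) := hΨd
  have hf0 : ∀ i, f i z = 0 := hZ.self_of_nhds.1 z.2
  have hinj : Function.Injective A := by
    rw [injective_iff_map_eq_zero]
    intro v hv
    have h1 : chartDeriv (z : M) v t z = 0 := by
      have h2 := (hasFDerivAt_fst (𝕜 := ℂ) (p := Ψ (φ z))).comp (φ z) hA
      have h3 : fderiv ℂ (t ∘ φ.symm) (φ z) = _ := h2.fderiv
      change fderiv ℂ (t ∘ φ.symm) (φ z) v = 0
      rw [h3, ContinuousLinearMap.comp_apply, hv]; rfl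
    have h2 : ∀ i, chartDeriv (z : M) v (f i) z = 0 := fun i => by
      have h2 := ((ContinuousLinearMap.proj (R := ℂ) (φ := fun _ : Fin n => ℂ) i).comp
        (ContinuousLinearMap.snd ℂ ℂ (Fin n → ℂ))).hasFDerivAt.comp (φ z) hA
      have h3 : fderiv ℂ (f i ∘ φ.symm) (φ z) = _ := h2.fderiv
      change fderiv ℂ (f i ∘ φ.symm) (φ z) v = 0
      rw [h3, ContinuousLinearMap.comp_apply, hv]; rfl
    have hS : ∀ g ∈ insert t (range f), HolAt (n + 1) (z : M) g := by
      rintro _ (rfl | ⟨i, rfl⟩)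
      exacts [ht, hf i]
    refine eq_zero_of_chartDeriv_eq_zero (z := (z : M)) (S := insert t (range f)) hS ?_ ?_ ?_
    · refine hspan.trans (sup_le ?_ ?_)
      · rw [Ideal.span_le]
        rintro _ ⟨i, rfl⟩
        exact Ideal.subset_span ⟨f i, Or.inr ⟨i, rfl⟩, rfl⟩
      · rw [Ideal.span_le, singleton_subset_iff]
        exact Ideal.subset_span ⟨t, Or.inl rfl, rfl⟩
    · rintro _ (rfl | ⟨i, rfl⟩)
      exacts [ht0, hf0 i]
    · rintro _ (rfl | ⟨i, rfl⟩)
      exacts [h1, h2 i]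
  -- An injective differential between spaces of dimension `n + 1` is an isomorphism, so `t` and the
  -- equations of the curve together form a chart.
  let B : Cn (n + 1) ≃L[ℂ] ℂ × (Fin n → ℂ) :=
    (LinearEquiv.ofInjectiveOfFinrankEq A.toLinearMap hinj
      (by simp [add_comm])).toContinuousLinearEquiv
  have hB : HasFDerivAt Ψ (B : Cn (n + 1) →L[ℂ] ℂ × (Fin n → ℂ)) (φ z) := by
    have h1 : (B : Cn (n + 1) →L[ℂ] ℂ × (Fin n → ℂ)) = A := by
      ext v <;> rfl
    rwa [h1]
  let E := hΨ.toOpenPartialHomeomorph Ψ hB one_ne_zero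
  have hzE : φ z ∈ E.source := hΨ.mem_toOpenPartialHomeomorph_source hB one_ne_zero
  have hEz : E (φ z) = (0, 0) := by
    change Ψ (φ z) = _
    simp only [Ψ, φ.left_inv hzφ, ht0, hf0]; rfl
  obtain ⟨O, hO, hOo, hzO⟩ := mem_nhds_iff.1 hZ
  let Θ := (φ.trans E).restrOpen O hOo
  have hΘ : ∀ y ∈ Θ.source, Θ y = (t y, fun i => f i y) := fun y hy => by
    change Ψ (φ y) = _
    have h1 : y ∈ φ.source := hy.1.1
    simp only [Ψ, φ.left_inv h1]
  have hΘZ : ∀ y ∈ Θ.source, y ∈ Z ↔ (Θ y).2 = 0 := fun y hy => by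
    rw [hΘ y hy, funext_iff]
    exact hO hy.2
  have hzΘ : (z : M) ∈ Θ.source := ⟨⟨hzφ, hzE⟩, hzO⟩
  let e := sliceChart Θ Z z hΘZ
  refine ⟨e, hzΘ, fun y hy => congrArg Prod.fst (hΘ y hy), fun g hg => ?_⟩
  refine ⟨fun c => (g ∘ φ.symm) (E.symm (c, 0)), ?_, ?_⟩
  · have h1 : ContDiffAt ℂ 1 E.symm (Ψ (φ z)) := hΨ.to_localInverse hB one_ne_zero
    have h2 : ContDiffAt ℂ 1 (g ∘ φ.symm) (E.symm (0, 0)) := by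
      rw [← hEz, E.left_inv hzE]
      exact ((contMDiffAt_chartAt_iff hzφ).1 hg.contMDiffAt).of_le
        (show (1 : WithTop ℕ∞) ≤ ∞ by exact_mod_cast le_top)
    have h3 : ContDiffAt ℂ 1 E.symm ((0 : ℂ), (0 : Fin n → ℂ)) := by
      rw [← hEz]; exact h1
    have h4 : ContDiffAt ℂ 1 (fun c : ℂ => (c, (0 : Fin n → ℂ))) 0 :=
      contDiffAt_id.prodMk contDiffAt_const
    have h5 : ContDiffAt ℂ 1 (fun c => (g ∘ φ.symm) (E.symm (c, 0))) (0 : ℂ) :=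
      ContDiffAt.comp (0 : ℂ) (g := g ∘ φ.symm) h2 (ContDiffAt.comp (0 : ℂ) (g := E.symm) h3 h4)
    -- Complex differentiability in a neighbourhood suffices for analyticity, so class `C¹` is
    -- enough throughout.
    rw [Complex.analyticAt_iff_eventually_differentiableAt]
    filter_upwards [h5.eventually (by simp)] with c hc using hc.differentiableAt (by simp)
  · filter_upwards [e.open_source.mem_nhds hzΘ] with y hy
    have hy' : (y : M) ∈ Θ.source := hy
    have h1 : (e y, (0 : Fin n → ℂ)) = E (φ y) := Prod.ext rfl ((hΘZ y hy').1 y.2).symm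
    simp only [Function.comp_apply, h1]
    have h2 : φ y ∈ E.source := hy'.1.2
    rw [E.left_inv h2, φ.left_inv hy'.1.1]

end CurveChart

/-! ### Local form of holomorphic functions on the curve -/

section CompactCurve

open Filter Topology Set

variable {n : ℕ} {M : Type} [TopologicalSpace M] [ChartedSpace (Cn (n + 1)) M]

theorem HolAt.pow {N : ℕ} {M : Type} [TopologicalSpace M] [ChartedSpace (Cn N) M] {x : M}
    {f : M → ℂ} (hf : HolAt N x f) (k : ℕ) : HolAt N x (f ^ k) := by
  filter_upwards [hf] with y h using h.pow k

theorem toGerm_pow {N : ℕ} {M : Type} [TopologicalSpace M] [ChartedSpace (Cn N) M] {x : M}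
    {f : M → ℂ} (hf : HolAt N x f) (k : ℕ) : toGerm (hf.pow k) = toGerm hf ^ k := by
  induction k with
  | zero =>
    rw [pow_zero (toGerm hf), ← toGerm_one, toGerm_eq_iff]
    exact Eventually.of_forall fun y => by simp
  | succ k ih =>
    rw [pow_succ (toGerm hf), ← ih, ← toGerm_mul, toGerm_eq_iff]
    exact Eventually.of_forall fun y => by simp [pow_succ]

theorem idealAt_eq_top {N : ℕ} {M : Type} [TopologicalSpace M] [ChartedSpace (Cn N) M]
    {Z : Set M} (hZ : IsClosed Z) {x : M} (hx : x ∉ Z) : idealAt (anSpace N M) Z x = ⊤ := by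
  rw [Ideal.eq_top_iff_one]
  have h := (toGerm_mem_idealAt_iff (holAt_const (N := N) (x := x) 1) Z).2 (by
    filter_upwards [hZ.isOpen_compl.mem_nhds hx] with y hy hyZ using absurd hyZ hy)
  rwa [toGerm_one] at h

/-- Off the closed set `Z` its ideal is the unit ideal, so its generators cannot all vanish at such
a point. -/
theorem eventually_mem_iff_of_frame {N : ℕ} {M : Type} [TopologicalSpace M] [ChartedSpace (Cn N) M]
    {ι : Type*} {Z : Set M} (hZ : IsClosed Z) {U : Opens (anSpace N M)}
    {x : ι → Sec (anSpace N M) U}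
    (hx : ∀ (w : M) (hw : w ∈ U), idealAt (anSpace N M) Z w =
      Ideal.span (range fun i => germAt (x i) w hw)) {y : M} (hy : y ∈ U) :
    y ∈ Z ↔ ∀ i, secFun (M := M) (x i) y = 0 := by
  constructor
  · intro h i
    refine (germAt_mem_maxI_iff (M := M) (x i) hy).1 (idealAt_le_maxI (M := anSpace N M) h ?_)
    rw [hx y hy]
    exact Ideal.subset_span ⟨i, rfl⟩
  · intro h
    by_contra h0
    have h1 := hx y hy
    rw [idealAt_eq_top hZ h0] at h1
    refine (IsLocalRing.maximalIdeal.isMaximal (Loc (anSpace N M) y)).ne_top (top_unique ?_)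
    rw [h1, Ideal.span_le]
    rintro _ ⟨i, rfl⟩
    exact (germAt_mem_maxI_iff (M := M) (x i) hy).2 (h i)

/-- Local charts of a smooth curve, and the local form of holomorphic functions on it. -/
theorem exists_chart_of_isSmoothCurve [T1Space M] [IsManifold 𝓘(ℂ, Cn (n + 1)) ∞ M] {Z : Set M}
    (hZ : IsSmoothCurve (anSpace (n + 1) M) Z) (z : Z) {U : Opens (anSpace (n + 1) M)}
    (hzU : z.1 ∈ U) (x : (detNormalBundle (anSpace (n + 1) M) n Z).Frame U) :
    ∃ (e : OpenPartialHomeomorph Z ℂ) (τ : Loc (anSpace (n + 1) M) z.1), z ∈ e.source ∧ e z = 0 ∧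
      (∀ (k : ℕ) (b : Loc (anSpace (n + 1) M) z.1), τ ^ k * b ∈ idealAt (anSpace (n + 1) M) Z z.1 →
        b ∈ idealAt (anSpace (n + 1) M) Z z.1) ∧
      ∀ (g : M → ℂ) (hg : HolAt (n + 1) z.1 g) (i : ℕ),
        ordOn (anSpace (n + 1) M) Z z.1 (toGerm hg) = i →
        ∃ (u : Loc (anSpace (n + 1) M) z.1) (h : ℂ → ℂ), AnalyticAt ℂ h 0 ∧ h 0 ≠ 0 ∧
          evalGerm z.1 u = h 0 ∧ toGerm hg - u * τ ^ i ∈ idealAt (anSpace (n + 1) M) Z z.1 ∧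
          ∀ᶠ y : Z in 𝓝 z, g y = e y ^ i * h (e y) := by
  obtain ⟨_, _⟩ := hZ.2 z.1 z.2 (isClosed_singleton (X := M))
  set I := idealAt (anSpace (n + 1) M) Z z.1 with hI
  obtain ⟨τ, hτm, hτ⟩ := exists_sup_span_eq_maximalIdeal I
  obtain ⟨t, ht, rfl⟩ := exists_eq_toGerm (M := M) τ
  have ht0 : t z = 0 := (toGerm_mem_maxI_iff ht).1
    (hτm.le (Submodule.mem_sup_right (Ideal.mem_span_singleton_self _)))
  obtain ⟨e, hze, het, he⟩ := exists_curve_chart z (f := fun i => secFun (M := M) (x.1 i))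
    (fun i => holAt_secFun (x.1 i) hzU) ht ht0
    (by
      filter_upwards [U.2.mem_nhds hzU] with y hy
      exact eventually_mem_iff_of_frame (M := M) hZ.1 x.2 hy)
    (by
      refine hτm.ge.trans (sup_le_sup_right (le_of_eq ?_) _)
      rw [hI, x.2 z.1 hzU]
      congr 2
      exact funext fun i => germAt_eq_toGerm (M := M) (x.1 i) hzU)
  refine ⟨e, toGerm ht, hze, (het z hze).trans ht0, fun k b hb => ?_, fun g hg i hi => ?_⟩
  · rw [← Ideal.Quotient.eq_zero_iff_mem, map_mul, map_pow] at hb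
    exact Ideal.Quotient.eq_zero_iff_mem.1
      ((mul_eq_zero.1 hb).resolve_left (pow_ne_zero _ hτ.ne_zero))
  · rw [ordOn_eq] at hi
    have hg0 : Ideal.Quotient.mk I (toGerm hg) ≠ 0 := fun h0 => by
      rw [h0, IsDiscreteValuationRing.addVal_zero] at hi
      exact ENat.top_ne_natCast _ hi
    obtain ⟨k, w, hw⟩ := IsDiscreteValuationRing.eq_unit_mul_pow_irreducible hg0 hτ
    have hk : k = i := by
      rw [IsDiscreteValuationRing.addVal_def _ w hτ k hw] at hi
      exact_mod_cast hi
    subst hk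
    obtain ⟨u, hu⟩ := Ideal.Quotient.mk_surjective (w : Loc (anSpace (n + 1) M) z.1 ⧸ I)
    obtain ⟨f, hf, rfl⟩ := exists_eq_toGerm (M := M) u
    have hd : toGerm hg - toGerm hf * toGerm ht ^ k ∈ I := by
      rw [← Ideal.Quotient.eq_zero_iff_mem, map_sub, map_mul, map_pow, hu, hw, sub_self]
    -- If `f` vanished at `z`, its class would be divisible by the uniformizer, although it is a
    -- unit.
    have hf0 : f z ≠ 0 := fun h0 => by
      have h1 : toGerm hf ∈ maxI (anSpace (n + 1) M) z.1 := (toGerm_mem_maxI_iff hf).2 h0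
      have h2 := Ideal.mem_map_of_mem (Ideal.Quotient.mk I) (hτm.ge h1)
      rw [Ideal.map_sup, Ideal.map_quotient_self, bot_sup_eq, Ideal.map_span, image_singleton, hu,
        Ideal.mem_span_singleton] at h2
      exact hτ.not_isUnit (isUnit_of_dvd_unit h2 w.isUnit)
    obtain ⟨h, hh, hfe⟩ := he f hf
    have hez : e z = 0 := (het z hze).trans ht0
    have hfz : f z = h 0 := by rw [hfe.self_of_nhds, hez]
    refine ⟨toGerm hf, h, hh, hfz ▸ hf0, (evalGerm_toGerm hf).trans hfz, hd, ?_⟩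
    rw [← toGerm_pow, ← toGerm_mul, ← toGerm_sub] at hd
    have h4 := (toGerm_mem_idealAt_iff _ Z).1 hd
    filter_upwards [hfe, e.open_source.mem_nhds hze, continuousAt_subtype_val.eventually h4]
      with y h5 h6 h7
    have h8 := sub_eq_zero.1 (h7 y.2)
    rw [h8, het y h6, ← het y h6, ← h5, het y h6]
    exact mul_comm _ _

end CompactCurve

/-! ### Degree zero on a compact curve in a complex manifold -/

section CompactCurveDegree

open Filter Topology Set

variable {n : ℕ} {M : Type} [TopologicalSpace M] [ChartedSpace (Cn (n + 1)) M]

/-- The degree of a principal divisor on a compact curve in a complex manifold is zero. -/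
theorem degreeZero_of_isCompact [T2Space M] [IsManifold 𝓘(ℂ, Cn (n + 1)) ∞ M] {Z : Set M}
    (hZ : IsSmoothCurve (anSpace (n + 1) M) Z) (hc : IsCompact Z)
    (hconn : _root_.IsConnected Z) {d : ℤ}
    (hN : HasDegree (anSpace (n + 1) M) Z (detNormalBundle (anSpace (n + 1) M) n Z) d) :
    DegreeZero (anSpace (n + 1) M) Z := by
  intro N a b D hzN hD hord hcompat
  -- Only the frames are used: they provide `n` local equations of the curve, from which the charts
  -- are built.
  obtain ⟨-, ⟨-, U, F, -, -, hzU, -, -⟩, -⟩ := hN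
  have hcl : ∀ z : M, IsClosed {z} := fun z => isClosed_singleton
  let pt : Z → {z : anSpace (n + 1) M // z ∈ Z ∧ IsClosed {z}} := fun z => ⟨z.1, z.2, hcl z.1⟩
  choose e τ hze he0 hτ hloc using fun z : Z => exists_chart_of_isSmoothCurve hZ z (hzU z) (F z)
  have hform : ∀ z : Z, ∃ (i j : ℕ) (u v : Loc (anSpace (n + 1) M) z.1) (h k : ℂ → ℂ),
      D z.1 = (i : ℤ) - (j : ℤ) ∧ AnalyticAt ℂ h 0 ∧ h 0 ≠ 0 ∧ AnalyticAt ℂ k 0 ∧ k 0 ≠ 0 ∧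
      evalGerm z.1 u = h 0 ∧ evalGerm z.1 v = k 0 ∧
      germAt (a (pt z)) z.1 (hzN (pt z)) - u * τ z ^ i ∈ idealAt (anSpace (n + 1) M) Z z.1 ∧
      germAt (b (pt z)) z.1 (hzN (pt z)) - v * τ z ^ j ∈ idealAt (anSpace (n + 1) M) Z z.1 ∧
      (∀ᶠ y : Z in 𝓝 z, secFun (M := M) (a (pt z)) y = e z y ^ i * h (e z y)) ∧
      ∀ᶠ y : Z in 𝓝 z, secFun (M := M) (b (pt z)) y = e z y ^ j * k (e z y) := by
    intro z
    obtain ⟨i, j, hi, hj, hij⟩ := hord (pt z) z.1 (hzN (pt z)) z.2 (hcl z.1)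
    obtain ⟨u, h, h1, h2, h3, h4, h5⟩ := hloc z _ (holAt_secFun (a (pt z)) (hzN (pt z))) i
      ((congrArg _ (germAt_eq_toGerm (M := M) _ _).symm).trans hi)
    obtain ⟨v, k, k1, k2, k3, k4, k5⟩ := hloc z _ (holAt_secFun (b (pt z)) (hzN (pt z))) j
      ((congrArg _ (germAt_eq_toGerm (M := M) _ _).symm).trans hj)
    rw [← germAt_eq_toGerm (M := M) _ (hzN (pt z))] at h4 k4
    exact ⟨i, j, u, v, h, k, hij, h1, h2, k1, k2, h3, k3, h4, k4, h5, k5⟩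
  choose i j u v h k hDij hh h0 hk k0 hu hv hau hbv ha hb using hform
  have : CompactSpace Z := isCompact_iff_compactSpace.1 hc
  have : ConnectedSpace Z := isConnected_iff_connectedSpace.1 hconn
  let D' : Z →₀ ℤ := D.comapDomain (Subtype.val : Z → M) Subtype.val_injective.injOn
  have hD' : ∀ z, D' z = D z.1 := fun z => rfl
  -- Off the divisor the numerator and the denominator have the same order at `y`; cancelling the
  -- common power of `τ y` compares the fraction of the chart at `x` with the quotient of leading
  -- coefficients at `y`.
  have hcomp : ∀ x y : Z, y.1 ∈ N (pt x) → D y.1 = 0 →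
      secFun (M := M) (a (pt x)) y * k y 0 = h y 0 * secFun (M := M) (b (pt x)) y := by
    intro x y hy hDy
    have hij : i y = j y := by have := hDij y; omega
    have h1 := hcompat (pt x) (pt y) y.1 hy (hzN (pt y)) y.2 (hcl y.1)
    have h2 : τ y ^ i y * (germAt (a (pt x)) y.1 hy * v y - u y * germAt (b (pt x)) y.1 hy) ∈
        idealAt (anSpace (n + 1) M) Z y.1 := by
      have h3 := Ideal.mul_mem_left _ (germAt (b (pt x)) y.1 hy) (hau y)
      have h4 := Ideal.mul_mem_left _ (germAt (a (pt x)) y.1 hy) (hbv y)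
      have h5 := add_mem (sub_mem h1 h4) h3
      rw [← hij] at h5
      convert h5 using 1
      ring
    have h3 := (mem_maxI_iff (M := M) _).1 (idealAt_le_maxI (M := anSpace (n + 1) M) y.2 (hτ y _ _ h2))
    rw [map_sub, map_mul, map_mul, hu, hv, sub_eq_zero] at h3
    have h4 := evalGerm_germAt (M := M) (a (pt x)) hy
    have h5 := evalGerm_germAt (M := M) (b (pt x)) hy
    rw [h4, h5] at h3
    exact h3
  have hsum : D'.sum (fun _ m => m) = 0 := by
    -- The function is assembled from leading coefficients. The factor `0 ^ D' x` equals one off the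
    -- divisor and zero at zeros and poles, matching the local expansion at its centre.
    refine sum_ord_meromorphic_eq_zero D' (fun x => 0 ^ D' x * (h x 0 / k x 0)) e hze he0
      (fun x c => h x c / k x c) (fun x => (hh x).div (hk x) (k0 x))
      (fun x => div_ne_zero (h0 x) (k0 x)) fun x => ?_
    have hfin : {y : Z | y ≠ x → D' y = 0} ∈ 𝓝 x := by
      have h1 : IsClosed ((D'.support : Set Z) \ {x}) :=
        (D'.support.finite_toSet.subset sdiff_subset).isClosed
      filter_upwards [h1.isOpen_compl.mem_nhds (fun h => h.2 rfl)] with y hy hyx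
      by_contra h2
      exact hy ⟨by simpa using h2, hyx⟩
    have het : Tendsto (e x) (𝓝 x) (𝓝 0) := by
      have := (e x).continuousAt (hze x)
      rwa [ContinuousAt, he0 x] at this
    filter_upwards [hfin, ha x, hb x, (e x).open_source.mem_nhds (hze x),
      het.eventually ((hh x).continuousAt.eventually_ne (h0 x)),
      het.eventually ((hk x).continuousAt.eventually_ne (k0 x)),
      continuousAt_subtype_val.eventually ((N (pt x)).2.mem_nhds (hzN (pt x)))]
      with y h1 h2 h3 h4 h5 h6 h7
    by_cases hyx : y = x
    · subst hyx
      simp only [he0 y]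
    · have hy0 : e x y ≠ 0 := fun h8 => hyx ((e x).injOn h4 (hze x) (h8.trans (he0 x).symm))
      have h8 := hcomp x y h7 (h1 hyx)
      rw [h2, h3] at h8
      simp only [h1 hyx, zpow_zero, one_mul]
      rw [hD' x, hDij x, zpow_sub₀ hy0, zpow_natCast, zpow_natCast, div_mul_div_comm,
        div_eq_div_iff (k0 y) (mul_ne_zero (pow_ne_zero _ hy0) h6)]
      exact h8.symm.trans (mul_comm _ _ |>.trans (by ring))
  rw [← hsum]
  exact (Finsupp.sum_comapDomain (Subtype.val : Z → M) D (fun _ m => m) ⟨fun x hx => hx, Subtype.val_injective.injOn,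
    fun x hx => ⟨⟨x, (hD x (Finsupp.mem_support_iff.1 hx)).1⟩, hx, rfl⟩⟩).symm

end CompactCurveDegree

end

end CurveSing

theorem mainTheorem7 (n p : ℕ) :
    -- `M` is a smooth variety of dimension `n + 1`, `Z` is complete
    (∀ (k : Type u) [Field k] [IsAlgClosed k] [CharZero k] (M : Scheme.{u})
        (π : M ⟶ Spec (CommRingCat.of k)) [SmoothOfRelativeDimension (n + 1) π]
        [IsSeparated π] [QuasiCompact π] (X : Set M) (Z : Closeds M),
        IsProper ((Scheme.IdealSheafData.vanishingIdeal Z).subschemeι ≫ π) →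
        CurveSing.IsOrdinaryAlongCurve M.toLocallyRingedSpace n p X (Z : Set M) →
        CurveSing.JumpBound M.toLocallyRingedSpace n p X (Z : Set M)) ∧
    -- `M` is a complex analytic manifold of dimension `n + 1`, `Z` is compact
    (∀ (M : Type) [TopologicalSpace M] [T2Space M]
        [ChartedSpace (EuclideanSpace ℂ (Fin (n + 1))) M]
        [IsManifold 𝓘(ℂ, EuclideanSpace ℂ (Fin (n + 1))) ω M] (X Z : Set M),
        IsCompact Z →
        CurveSing.IsOrdinaryAlongCurve
          (ChartedSpace.locallyRingedSpace 𝓘(ℂ, EuclideanSpace ℂ (Fin (n + 1))) M) n p X Z →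
        CurveSing.JumpBound
          (ChartedSpace.locallyRingedSpace 𝓘(ℂ, EuclideanSpace ℂ (Fin (n + 1))) M) n p X Z) := by
  refine ⟨fun k _ _ _ M π _ _ _ X Z _ h => h.jumpBound (CurveSing.isSmoothAlong_of_smooth π Z.isClosed)
    (CurveSing.degreeZero_of_isProper π Z h.smoothCurve h.connected),
    fun M _ _ _ _ X Z hZ h dX dN hX hN => ?_⟩
  have : IsManifold 𝓘(ℂ, EuclideanSpace ℂ (Fin (n + 1))) ∞ M := IsManifold.of_le (n := ω) le_top
  -- The hypothesis on the degree of the normal bundle is also used for `DegreeZero`, since its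
  -- frames give the equations of `Z`.
  exact h.jumpBound (CurveSing.isSmoothAlong_anSpace Z)
    (CurveSing.degreeZero_of_isCompact h.smoothCurve hZ h.connected hN) dX dN hX hN
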